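/- Setting. There are $N$ items, of which a set $S$ of $K$ items is defective. Fix $0<q<1/2$, a rate $0<R<1-H(q)=1+q\log_2 q+(1-q)\log_2(1-q)$, and an integer $p\ge 1$. Codes. A rate-$R$ code sequence consists of encoders $f_n:\{0,1\}^n\to\{0,1\}^{\lceil n/R\rceil}$ and decoders $g_n$ in the opposite direction. It is reliable with exponent $\kappa>0$ if, for all large $n$ and every message $x$, $\Pr(g_n(f_n(x)+w)\ne x)<2^{-\kappa n}$ for i.i.d. Bernoulli($q$) noise $w$. Testing. Let $Mr=N\ell$. Pair the $N\ell$ edge sockets of the items ($\ell$ per item) with the $Mr$ edge sockets of $M$ bins ($r$ per bin) uniformly at random. Put $n=\lceil\log_2 r\rceil$, let $b_j$ be the $n$-bit expansion of the location $j\in\{0,\dots,r-1\}$, and let $\pi^0=\mathrm{id}$ and $\pi^1,\dots,\pi^{p-1}$ be independent uniform permutations of the locations. The signature matrix $U'$ has as column $j$ the words $f_n(b_{\pi^i(j)})$, $\overline{f_n(b_{\pi^i(j)})}$, $i=0,\dots,p-1$, stacked. For every bin, a block of $2p\lceil n/R\rceil$ tests is obtained by placing the columns of $U'$, in order, at the items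 connected to that bin (zero columns elsewhere). The test results are $y=A\odot x+w$, where $x$ is the indicator vector of $S$, $\odot$ is the Boolean (AND/OR) matrix-vector product, and $w$ is i.i.d. Bernoulli($q$) noise added mod 2, independent of $A$. Decoding. Singleton rule: at a bin with words $y_{i1},y_{i2}$ ($0\le i<p$), declare the item at location $j$ if $g_n(y_{i1})=b_{\pi^i(j)}$ for all $i$. Double-ton rule: given an already decoded item of the bin, at location $a$, do the same with $y_{i1}$ replaced by the word that equals $y_{i1}$ where $f_n(b_{\pi^i(a)})$ is $0$ and $\overline{y_{i2}}$ where it is $1$. The decoder applies the singleton rule to all bins and then, iteratively for each decoded item, the double-ton rule to all bins connected to it; it outputs all decoded items. Constants. Let $0<\varepsilon<1$, and let $\ell\in\mathbb N$ and $c_\varepsilon>0$ be such that either the density evolution $p_0=1$, $p_{j+1}=\bigl[1-(\rho_1+\rho_2(1-p_j))\bigr]^{\ell-1}$ with $\rho_1=e^{-\lambda}$, $\rho_2=\lambda e^{-\lambda}$, $\lambda=\ell/c_\varepsilon$, satisfies $\lim_j p_j\le\varepsilon$, or $(\varepsilon,c_\varepsilon,\ell)$ is one of $(10^{-3},6.13,7)$,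 $(10^{-4},7.88,9)$, $(10^{-5},9.63,10)$, $(10^{-6},11.36,12)$, $(10^{-7},13.10,14)$, $(10^{-8},14.84,15)$, $(10^{-9},16.57,17)$. Theorem. (a) There are $\kappa>0$ and a rate-$R$ code sequence with maximum-likelihood decoders that is reliable with exponent $\kappa$. (b) For every $\kappa>0$, every rate-$R$ code sequence that is reliable with exponent $\kappa$, and all constants as above, there is $\gamma>0$ such that the following holds along every sequence of $N,K,M,r$ with $Mr=N\ell$, $K\to\infty$, $K=o(N^{1-1/p})$ and $M/K\to c_\varepsilon$ (in particular for $M=c_\varepsilon K$), and every choice of defective sets $S$ with $|S|=K$: 1. the number of tests is $m=2pM\lceil\lceil\log_2 r\rceil/R\rceil=(1+o(1))\,2p\,\frac1R\,c_\varepsilon K\log_2\frac{N\ell}{c_\varepsilon K}$; 2. with probability tending to $1$, the decoder outputs at least a $(1-\varepsilon)$ fraction of the defective items and no non-defective item; 3. the probability that fewer than a $(1-\varepsilon)$ fraction of the defective items is output is $O\bigl(N^{-\kappa}+e^{-\gamma K}\bigr)$; in particular it is $O(N^{-\kappa})$ if $\log N=o(K)$. -/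

import Mathlib

open Filter Topology Asymptotics

namespace RobustSaffron

/-! ### Binary codes and the binary symmetric channel -/

/-- Probability of the bit pattern `w` when its bits are i.i.d. Bernoulli(`q`). -/
noncomputable def noiseWeight {ι : Type*} [Fintype ι] (q : ℝ) (w : ι → Bool) : ℝ :=
  ∏ i, if w i then q else 1 - q

/-- Addition over the binary field, entry by entry. -/
def addNoise {ι : Type*} (y w : ι → Bool) : ι → Bool := fun i => xor (y i) (w i)

/-- A binary code with messages of `n` bits and codewords of `L` bits: the encoder `f` and the
decoder `g`. -/
structure BinCode (n L : ℕ) where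
  enc : (Fin n → Bool) → (Fin L → Bool)
  dec : (Fin L → Bool) → (Fin n → Bool)

/-- Block length `n / R` (rounded up) of a code of rate `R` with `n` message bits. -/
noncomputable def codeLen (R : ℝ) (n : ℕ) : ℕ := ⌈(n : ℝ) / R⌉₊

open Classical in
/-- `Pr (g (f x + w) ≠ x)` for i.i.d. Bernoulli(`q`) noise `w`. -/
noncomputable def errorProb {n L : ℕ} (q : ℝ) (C : BinCode n L) (x : Fin n → Bool) : ℝ :=
  ∑ w : Fin L → Bool, if C.dec (addNoise (C.enc x) w) ≠ x then noiseWeight q w else 0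

/-- The decoder is a maximum-likelihood decoder for noise level `q`: the conditional probability
of receiving `z` is maximal for the message `g z`. -/
def IsMLDecoder {n L : ℕ} (q : ℝ) (C : BinCode n L) : Prop :=
  ∀ (z : Fin L → Bool) (x : Fin n → Bool),
    noiseWeight q (addNoise (C.enc x) z) ≤ noiseWeight q (addNoise (C.enc (C.dec z)) z)

/-- A sequence of codes of rate `R` whose error probability is below `2 ^ (-κ n)` for every
message, for all large `n`. -/
def ReliableCodes (q R κ : ℝ) (C : (n : ℕ) → BinCode n (codeLen R n)) : Prop :=
  ∀ᶠ n : ℕ in atTop, ∀ x : Fin n → Bool, errorProb q (C n) x < (2 : ℝ) ^ (-(κ * n))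

/-! ### The left-and-right-regular graph ensemble -/

/-- A left-and-right-regular bipartite (multi)graph: the `N * ℓ` edge sockets of the items
(`ℓ` per item) are paired with the `M * r` edge sockets of the bins (`r` per bin). -/
abbrev Graph (N ℓ M r : ℕ) : Type := (Fin N × Fin ℓ) ≃ (Fin M × Fin r)

/-- The items connected to bin `b`, i.e. the support of row `b` of the adjacency matrix. -/
def nbrs {N ℓ M r : ℕ} (G : Graph N ℓ M r) (b : Fin M) : Finset (Fin N) :=
  Finset.univ.image fun s : Fin r => (G.symm (b, s)).1

theorem rank_lt {N ℓ M r : ℕ} (G : Graph N ℓ M r) (b : Fin M) (v : Fin N) (hv : v ∈ nbrs G b) :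
    ((nbrs G b).filter (· < v)).card < r := by
  have h1 : ((nbrs G b).filter (· < v)).card < (nbrs G b).card := by
    apply Finset.card_lt_card
    rw [Finset.filter_ssubset]
    exact ⟨v, hv, lt_irrefl v⟩
  have h2 : (nbrs G b).card ≤ r := by
    simpa [nbrs] using
      (Finset.card_image_le (s := (Finset.univ : Finset (Fin r)))
        (f := fun s : Fin r => (G.symm (b, s)).1))
  omega

/-- The location of item `v` in bin `b`: the index of the signature column that is placed at `v`.
The columns are placed in order at the non-zero positions of row `b` of the adjacency matrix. -/
def loc {N ℓ M r : ℕ} (G : Graph N ℓ M r) (b : Fin M) (v : Fin N) (hv : v ∈ nbrs G b) : Fin r :=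
  ⟨((nbrs G b).filter (· < v)).card, rank_lt G b v hv⟩

/-! ### The modified signature matrix and the testing matrix -/

/-- The random permutations `π¹, …, πᵖ⁻¹` of the `r` locations. -/
abbrev SigPerms (p r : ℕ) : Type := Fin (p - 1) → Equiv.Perm (Fin r)

/-- The permutation used in section `i`: the identity in section `0`, then `π¹, …, πᵖ⁻¹`. -/
def sectionPerm {p r : ℕ} (π : SigPerms p r) (i : Fin p) : Equiv.Perm (Fin r) :=
  if h : i.val = 0 then 1 else π ⟨i.val - 1, by omega⟩

/-- The `⌈log₂ r⌉`-bit binary expansion of a location, most significant bit first. -/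
def bits {r : ℕ} (j : Fin r) : Fin (Nat.clog 2 r) → Bool := fun t => j.val.testBit (Fin.rev t).val

/-- The codeword `f (b_{πⁱ_j})` in section `i` of column `j`. -/
def codeword {p r L : ℕ} (C : BinCode (Nat.clog 2 r) L) (π : SigPerms p r) (i : Fin p)
    (j : Fin r) : Fin L → Bool :=
  C.enc (bits (sectionPerm π i j))

/-- Entries of the modified signature matrix. Section `i` consists of a codeword
(`side = false`) followed by its complement (`side = true`). -/
def signature {p r L : ℕ} (C : BinCode (Nat.clog 2 r) L) (π : SigPerms p r)
    (i : Fin p) (side : Bool) (t : Fin L) (j : Fin r) : Bool :=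
  xor side (codeword C π i j t)

/-- The tests: bin, section, first or second half of the section, position in the codeword. -/
abbrev TestIndex (M p L : ℕ) : Type := Fin M × Fin p × Bool × Fin L

/-- The testing matrix `A`: in the rows of bin `b`, the signature columns are placed at the items
connected to `b`, and all other columns vanish. -/
def testMatrix {N ℓ M r p L : ℕ} (C : BinCode (Nat.clog 2 r) L) (G : Graph N ℓ M r)
    (π : SigPerms p r) (τ : TestIndex M p L) (v : Fin N) : Bool :=
  if hv : v ∈ nbrs G τ.1 then signature C π τ.2.1 τ.2.2.1 τ.2.2.2 (loc G τ.1 v hv) else false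

/-- The noisy test results `y = A ⊙ x + w`, where `x` is the indicator vector of the set `S`
of defective items and `⊙` is the Boolean matrix-vector product. -/
def testResults {N ℓ M r p L : ℕ} (C : BinCode (Nat.clog 2 r) L) (G : Graph N ℓ M r)
    (π : SigPerms p r) (S : Finset (Fin N)) (w : TestIndex M p L → Bool) :
    TestIndex M p L → Bool :=
  addNoise (fun τ => decide (∃ v ∈ S, testMatrix C G π τ v = true)) w

/-! ### The decoder -/

/-- Singleton rule, applied to one `L`-bit word per section: location `j` is declared if the
error-control decoder outputs the expansion of `πⁱ_j` in every section `i` (where `π⁰ = id`). -/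
def Declares {p r L : ℕ} (C : BinCode (Nat.clog 2 r) L) (π : SigPerms p r)
    (z : Fin p → Fin L → Bool) (j : Fin r) : Prop :=
  ∀ i : Fin p, C.dec (z i) = bits (sectionPerm π i j)

/-- The first halves of the sections at bin `b`. -/
def firstHalves {M p L : ℕ} (y : TestIndex M p L → Bool) (b : Fin M) : Fin p → Fin L → Bool :=
  fun i t => y (b, i, false, t)

/-- The words left at bin `b` for the second item of a double-ton whose first item has the known
location `a`: at positions where the codeword of `a` vanishes the first half of the section is
read, at the others the complement of its second half. -/
def residual {p r M L : ℕ} (C : BinCode (Nat.clog 2 r) L) (π : SigPerms p r)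
    (y : TestIndex M p L → Bool) (b : Fin M) (a : Fin r) : Fin p → Fin L → Bool :=
  fun i t => if codeword C π i a t then !(y (b, i, true, t)) else y (b, i, false, t)

/-- The items output by the peeling decoder from the test results `y`: first the items declared
by the singleton rule at some bin, then iteratively, for each decoded item `u` and each bin
connected to `u`, the item declared there by the resolvable double-ton rule. The output does not
depend on the order in which decoded items are processed; it is the least set closed under the
two rules. -/
inductive Decoded {N ℓ M r p L : ℕ} (C : BinCode (Nat.clog 2 r) L) (G : Graph N ℓ M r)
    (π : SigPerms p r) (y : TestIndex M p L → Bool) : Fin N → Prop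
  | singleton (b : Fin M) (v : Fin N) (hv : v ∈ nbrs G b)
      (h : Declares C π (firstHalves y b) (loc G b v hv)) : Decoded C G π y v
  | doubleton (b : Fin M) (u v : Fin N) (hu : u ∈ nbrs G b) (hv : v ∈ nbrs G b)
      (hdec : Decoded C G π y u)
      (h : Declares C π (residual C π y b (loc G b u hu)) (loc G b v hv)) : Decoded C G π y v

open Classical in
/-- At least a `1 - ε` fraction of the defective items is recovered. -/
def Recovers {N ℓ M r p L : ℕ} (C : BinCode (Nat.clog 2 r) L) (ε : ℝ) (S : Finset (Fin N))
    (G : Graph N ℓ M r) (π : SigPerms p r) (w : TestIndex M p L → Bool) : Prop :=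
  (1 - ε) * (S.card : ℝ) ≤ ((S.filter fun v => Decoded C G π (testResults C G π S w) v).card : ℝ)

/-- Only defective items are output. -/
def NoFalseAlarm {N ℓ M r p L : ℕ} (C : BinCode (Nat.clog 2 r) L) (S : Finset (Fin N))
    (G : Graph N ℓ M r) (π : SigPerms p r) (w : TestIndex M p L → Bool) : Prop :=
  ∀ v, Decoded C G π (testResults C G π S w) v → v ∈ S

open Classical in
/-- Probability of the event `E` when the graph is uniform in the ensemble, the permutations
`π¹, …, πᵖ⁻¹` are independent and uniform, the noise bits are i.i.d. Bernoulli(`q`), and the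
three are independent. -/
noncomputable def prob {N ℓ M r p L : ℕ} (q : ℝ)
    (E : Graph N ℓ M r → SigPerms p r → (TestIndex M p L → Bool) → Prop) : ℝ :=
  (∑ G : Graph N ℓ M r, ∑ π : SigPerms p r, ∑ w : TestIndex M p L → Bool,
      if E G π w then noiseWeight q w else 0) /
    (Fintype.card (Graph N ℓ M r) * Fintype.card (SigPerms p r))

/-! ### The constants -/

/-- One step of density evolution for left degree `ℓ` and `M = c K` bins, with
`ρ₁ = exp (-λ)`, `ρ₂ = λ exp (-λ)` and `λ = ℓ / c`. -/
noncomputable def deStep (ℓ : ℕ) (c x : ℝ) : ℝ :=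
  (1 - (Real.exp (-(ℓ / c)) + ℓ / c * Real.exp (-(ℓ / c)) * (1 - x))) ^ (ℓ - 1)

/-- The density evolution limit, started from `1` (nothing identified), is at most `ε`. -/
def DensityEvolution (ε : ℝ) (ℓ : ℕ) (c : ℝ) : Prop :=
  ∃ a ≤ ε, Tendsto (fun j : ℕ => (deStep ℓ c)^[j] 1) atTop (𝓝 a)

/-- The tabulated (rounded) triples `(ε, c_ε, ℓ)`. -/
noncomputable def constantsTable : Set (ℝ × ℝ × ℕ) :=
  {(1 / 10 ^ 3, 6.13, 7), (1 / 10 ^ 4, 7.88, 9), (1 / 10 ^ 5, 9.63, 10), (1 / 10 ^ 6, 11.36, 12),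
    (1 / 10 ^ 7, 13.10, 14), (1 / 10 ^ 8, 14.84, 15), (1 / 10 ^ 9, 16.57, 17)}

end RobustSaffron

open RobustSaffron

/-! Codes. For a uniform generator matrix a fixed non-zero message has a uniform codeword. Given the
noise `w`, of probability `W(w)`, the chance that some codeword competes with zero is at most `min
(1, X) ≤ X ^ ρ` with `X = 2 ^ n / (2 ^ L * W(w))`. Averaging over `w` factors over bits, and the
derivative of the exponent at `ρ = 0` is a positive multiple of `R` minus the capacity
(`exists_linErr_le`, `exists_tilt`).

Recovery. A bin with one or two defective items is faulty if its noise would spoil a decision; given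
the graph and the permutations, bins are faulty independently, with probability at most `8 p δ`.
Undecoded defective items form a stuck set: peeling that ignores the faulty bins `F` cannot enter it
(`stuck_not_decoded`). `F` depends on the noise while the stuck-set estimate holds for fixed `F`, so
a union over all small `F` is taken; this is affordable because the estimate is exponentially small
in `K` (`exists_stuck_bound`). Many faulty bins are exponentially unlikely once `8 p δ` is a small
constant, so the codes only need a small error probability and the final bound is `exp (-γ K)` by
itself.

Stuck sets. The occupied bin sockets form a uniform set of size `K ℓ`. Comparison with independent
sockets costs a factor linear in `K ℓ`, and Chernoff bounds then show that the numbers of bins with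
one and two defective sockets are close to their Poisson values. With the occupancy fixed, the
pairing of the defective sockets is still a uniform permutation, which is exposed step by step. Let
`A` be pending sockets whose items must lie in the stuck set. An exposed socket cannot be alone in
its bin; if it shares the bin with one partner, the partner's item must be stuck too, and its `ℓ -
1` other sockets become pending; otherwise nothing is learned. Hence `t ^ |A|` bounds the survival
probability as soon as `1 - ρ₁ - ρ₂ + ρ₂ t ^ (ℓ - 1) < t`, up to `μ ^ s` for stopping after `s`
steps (`card_unmarked_le`). Applied to the sockets of `m = δ K` items and averaged over such sets,
this makes a stuck set of `ε K` items exponentially unlikely if `t ^ ℓ < ε`. A density evolution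
limit of at most `ε` supplies such a `t`, since it bounds survival along `ℓ - 1` sockets while an
item has `ℓ`.

False alarms. For fixed noise the words at a bin depend on the permutations only through the
defective locations. Section `0` singles out one candidate location, and each of the other `p - 1`
sections confirms a non-defective candidate with probability at most `2 / r`, unless half of the bin
is defective. The union bound has order `K (K / N) ^ (p - 1) = (K / N ^ (1 - 1/p)) ^ p`, which tends
to zero (`prob_falseAlarm_le`). -/

namespace RobustSaffron

/-! ### Bernoulli noise -/

theorem noiseWeight_nonneg {ι : Type*} [Fintype ι] {q : ℝ} (h0 : 0 ≤ q) (h1 : q ≤ 1)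
    (w : ι → Bool) : 0 ≤ noiseWeight q w :=
  Finset.prod_nonneg fun i _ => by split_ifs <;> linarith

/-- Expectation of `f` under i.i.d. Bernoulli(`q`) noise. -/
noncomputable def noiseExp {ι : Type*} [Fintype ι] [DecidableEq ι] (q : ℝ)
    (f : (ι → Bool) → ℝ) : ℝ :=
  ∑ w, noiseWeight q w * f w

section noiseExp
variable {ι : Type*} [Fintype ι] [DecidableEq ι] {q : ℝ}

theorem noiseExp_prod (h : ι → Bool → ℝ) :
    noiseExp q (fun w => ∏ i, h i (w i)) = ∏ i, (q * h i true + (1 - q) * h i false) := by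
  have h1 := Finset.prod_univ_sum (fun _ : ι => (Finset.univ : Finset Bool))
    (fun i x => (if x = true then q else 1 - q) * h i x)
  simp only [Fintype.sum_bool, if_true, Bool.false_eq_true, if_false, Fintype.piFinset_univ] at h1
  rw [h1, noiseExp]
  refine Finset.sum_congr rfl fun w _ => ?_
  rw [noiseWeight, ← Finset.prod_mul_distrib]

theorem noiseExp_const (c : ℝ) : noiseExp q (fun _ : ι → Bool => c) = c := by
  have h := noiseExp_prod (q := q) (fun (_ : ι) (_ : Bool) => (1 : ℝ))
  simp only [Finset.prod_const_one, mul_one, add_sub_cancel] at h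
  have h2 : noiseExp q (fun _ : ι → Bool => c) = noiseExp q (fun _ : ι → Bool => 1) * c := by
    simp [noiseExp, Finset.sum_mul]
  rw [h2, h, one_mul]

theorem noiseExp_mono (h0 : 0 ≤ q) (h1 : q ≤ 1) {f g : (ι → Bool) → ℝ} (h : ∀ w, f w ≤ g w) :
    noiseExp q f ≤ noiseExp q g :=
  Finset.sum_le_sum fun w _ => mul_le_mul_of_nonneg_left (h w) (noiseWeight_nonneg h0 h1 w)

theorem noiseExp_sum {α : Type*} (s : Finset α) (f : α → (ι → Bool) → ℝ) :
    noiseExp q (fun w => ∑ a ∈ s, f a w) = ∑ a ∈ s, noiseExp q (f a) := by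
  simp only [noiseExp, Finset.mul_sum]
  exact Finset.sum_comm

theorem noiseExp_add (f g : (ι → Bool) → ℝ) :
    noiseExp q (fun w => f w + g w) = noiseExp q f + noiseExp q g := by
  simp only [noiseExp, mul_add, Finset.sum_add_distrib]

/-- The marginal distribution of the noise along an injective map of positions. -/
theorem noiseExp_comp_injective {ι' : Type*} [Fintype ι'] [DecidableEq ι'] {g : ι' → ι}
    (hg : Function.Injective g) (f : (ι' → Bool) → ℝ) :
    noiseExp q (fun w : ι → Bool => f (fun j => w (g j))) = noiseExp q f := by
  have key : ∀ w' : ι' → Bool,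
      noiseExp q (fun w : ι → Bool => if (fun j => w (g j)) = w' then (1 : ℝ) else 0)
        = noiseWeight q w' := by
    intro w'
    classical
    -- The indicator of a prescribed restricted pattern is a product over all positions: the factor
    -- is `1` off the image of `g`, and injectivity makes the factor at `g j` test `w' j` only.
    let h : ι → Bool → ℝ := fun i x => if ∀ j, g j = i → x = w' j then 1 else 0
    have e1 : ∀ w : ι → Bool,
        (if (fun j => w (g j)) = w' then (1 : ℝ) else 0) = ∏ i, h i (w i) := by
      intro w
      simp only [h]
      rw [Finset.prod_ite_zero]
      simp only [Finset.prod_const_one, Finset.mem_univ, true_imp_iff]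
      refine if_congr ?_ rfl rfl
      rw [funext_iff]
      constructor
      · rintro h i j rfl; exact h j
      · intro h j; exact h _ j rfl
    simp only [e1]
    rw [noiseExp_prod, noiseWeight]
    have e2 : ∀ i, i ∉ Finset.univ.image g → (q * h i true + (1 - q) * h i false) = 1 := by
      intro i hi
      have : ∀ x, h i x = 1 := by
        intro x
        simp only [h]
        rw [if_pos]
        intro j hj
        exact absurd (Finset.mem_image.2 ⟨j, Finset.mem_univ _, hj⟩) hi
      rw [this, this]; ring
    rw [← Finset.prod_subset (Finset.subset_univ (Finset.univ.image g)) (fun i _ hi => e2 i hi),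
      Finset.prod_image (fun a _ b _ hab => hg hab)]
    refine Finset.prod_congr rfl fun j _ => ?_
    have : ∀ x, h (g j) x = if x = w' j then 1 else 0 := by
      intro x
      simp only [h]
      refine if_congr ⟨fun H => H j rfl, fun H k hk => ?_⟩ rfl rfl
      rw [hg hk, H]
    rw [this, this]
    cases w' j <;> simp
  have e3 : ∀ w : ι → Bool, f (fun j => w (g j))
      = ∑ w' : ι' → Bool, f w' * (if (fun j => w (g j)) = w' then (1 : ℝ) else 0) := by
    intro w
    simp
  simp only [e3]
  rw [noiseExp_sum, noiseExp]
  refine Finset.sum_congr rfl fun w' _ => ?_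
  rw [← key w', noiseExp, noiseExp, Finset.sum_mul]
  exact Finset.sum_congr rfl fun w _ => by ring

/-- Noise on disjoint blocks of positions is independent. -/
theorem noiseExp_block {α β : Type*} [Fintype α] [DecidableEq α] [Fintype β] [DecidableEq β]
    (f : α → (β → Bool) → ℝ) :
    noiseExp q (fun w : α × β → Bool => ∏ a, f a (fun b => w (a, b)))
      = ∏ a, noiseExp q (f a) := by
  simp only [noiseExp]
  rw [Finset.prod_univ_sum, Fintype.piFinset_univ]
  refine Fintype.sum_equiv (Equiv.curry α β Bool) _ _ fun w => ?_
  rw [Finset.prod_mul_distrib]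
  congr 1
  rw [noiseWeight, Fintype.prod_prod_type]
  rfl

theorem noiseExp_nonneg (h0 : 0 ≤ q) (h1 : q ≤ 1) {f : (ι → Bool) → ℝ} (h : ∀ w, 0 ≤ f w) :
    0 ≤ noiseExp q f := by
  have := noiseExp_mono (q := q) h0 h1 (f := fun _ => 0) h
  rwa [noiseExp_const] at this

open Classical in
theorem errorProb_eq {n L : ℕ} (C : BinCode n L) (x : Fin n → Bool) :
    errorProb q C x
      = noiseExp q (fun w => if C.dec (addNoise (C.enc x) w) ≠ x then (1 : ℝ) else 0) := by
  rw [errorProb, noiseExp]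
  refine Finset.sum_congr rfl fun w _ => ?_
  split_ifs <;> simp

end noiseExp

/-! ### Random linear codes with maximum-likelihood decoding -/

/-- Codeword of `x` in the linear code with generator matrix `A`. -/
def linEnc {n L : ℕ} (A : Fin n → Fin L → ZMod 2) (x : Fin n → Bool) : Fin L → Bool :=
  fun t => decide ((∑ i, (if x i then A i t else 0)) ≠ 0)

/-- Linearity turns the comparison of two messages into that of their difference with `0`, so that
one bound serves all messages. -/
theorem addNoise_linEnc {n L : ℕ} (A : Fin n → Fin L → ZMod 2) (x y : Fin n → Bool)
    (w : Fin L → Bool) :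
    addNoise (linEnc A y) (addNoise (linEnc A x) w) = addNoise (linEnc A (addNoise y x)) w := by
  funext t
  have h : ∀ a b : ZMod 2, xor (decide (a ≠ 0)) (decide (b ≠ 0)) = decide (a + b ≠ 0) := by decide
  have h2 : ∀ (a b : Bool) (c : ZMod 2),
      ((if a then c else 0) + (if b then c else 0) : ZMod 2) = if xor a b then c else 0 := by decide
  simp only [addNoise, linEnc]
  rw [← Bool.xor_assoc, h, ← Finset.sum_add_distrib]
  simp only [h2]
  rfl

theorem addNoise_self_left {ι : Type*} (a w : ι → Bool) : addNoise a (addNoise a w) = w := by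
  funext t; simp [addNoise]

/-- For a uniform generator matrix, every non-zero message has a uniform codeword. -/
theorem sum_linEnc {n L : ℕ} (u : Fin n → Bool) (i : Fin n) (hu : u i = true)
    (F : (Fin L → Bool) → ℝ) :
    ∑ A : Fin n → Fin L → ZMod 2, F (linEnc A u)
      = Fintype.card (Fin n → Fin L → ZMod 2) / (2 : ℝ) ^ L * ∑ v : Fin L → Bool, F v := by
  have h1 : ∀ v : Fin L → Bool, ∑ A : Fin n → Fin L → ZMod 2, F (addNoise (linEnc A u) v)
      = ∑ A : Fin n → Fin L → ZMod 2, F (linEnc A u) := by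
    intro v
    -- Adding `v` to row `i`, which `u` selects, translates the codeword of `u` by `v`. The law of
    -- this codeword is therefore translation invariant, hence uniform.
    let B : Fin n → Fin L → ZMod 2 := fun j t => if j = i then (if v t then 1 else 0) else 0
    refine Fintype.sum_equiv (Equiv.addRight B) _ _ fun A => ?_
    congr 1
    funext t
    have h : ∀ (a : ZMod 2) (b : Bool),
      xor (decide (a ≠ 0)) b = decide (a + (if b then 1 else 0) ≠ 0) := by decide
    simp only [addNoise, linEnc]
    rw [h]
    have h3 : ∑ j, (if u j = true then (Equiv.addRight B A) j t else 0)
        = (∑ j, if u j = true then A j t else 0) + ∑ j, (if u j = true then B j t else 0) := by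
      rw [← Finset.sum_add_distrib]
      refine Finset.sum_congr rfl fun j _ => ?_
      split_ifs <;> simp
    have h4 : ∑ j, (if u j = true then B j t else 0) = if v t = true then 1 else 0 := by
      rw [Finset.sum_eq_single i]
      · simp [B, hu]
      · intro j _ hj; simp [B, hj]
      · simp
    rw [h3, h4]
  have h2 : (2 : ℝ) ^ L * ∑ A : Fin n → Fin L → ZMod 2, F (linEnc A u)
      = Fintype.card (Fin n → Fin L → ZMod 2) * ∑ v : Fin L → Bool, F v := by
    calc (2 : ℝ) ^ L * ∑ A : Fin n → Fin L → ZMod 2, F (linEnc A u)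
        = ∑ v : Fin L → Bool, ∑ A : Fin n → Fin L → ZMod 2, F (addNoise (linEnc A u) v) := by
          simp only [h1]
          simp
      _ = ∑ A : Fin n → Fin L → ZMod 2, ∑ v : Fin L → Bool, F (addNoise (linEnc A u) v) :=
          Finset.sum_comm
      _ = ∑ A : Fin n → Fin L → ZMod 2, ∑ v : Fin L → Bool, F v := by
          refine Finset.sum_congr rfl fun A _ => ?_
          have hb : Function.Bijective (fun v => addNoise (linEnc A u) v) :=
            (Function.Involutive.bijective fun v => addNoise_self_left _ v)
          exact Fintype.sum_bijective _ hb _ _ fun v => rfl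
      _ = _ := by simp
  field_simp
  linarith

/-- A maximum-likelihood decoder of the linear code with generator matrix `A`. -/
noncomputable def linCode (q : ℝ) {n L : ℕ} (A : Fin n → Fin L → ZMod 2) : BinCode n L where
  enc := linEnc A
  dec := fun z => (Finite.exists_max fun x => noiseWeight q (addNoise (linEnc A x) z)).choose

theorem linCode_isML (q : ℝ) {n L : ℕ} (A : Fin n → Fin L → ZMod 2) :
    IsMLDecoder q (linCode q A) := fun z =>
  (Finite.exists_max fun x => noiseWeight q (addNoise (linEnc A x) z)).choose_spec

open Classical in
/-- Probability that some non-zero codeword is at least as likely as the zero codeword. -/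
noncomputable def linErr (q : ℝ) {n L : ℕ} (A : Fin n → Fin L → ZMod 2) : ℝ :=
  noiseExp q fun w => if ∃ u : Fin n → Bool, (∃ i, u i = true) ∧
    noiseWeight q w ≤ noiseWeight q (addNoise (linEnc A u) w) then 1 else 0

/-- If the decoder answers `y ≠ x`, the codeword of `y + x` explains the noise at least as well as
the zero codeword. Ties count as errors in `linErr`, so the choice among maximisers is immaterial.
-/
theorem errorProb_linCode_le {q : ℝ} (h0 : 0 ≤ q) (h1 : q ≤ 1) {n L : ℕ}
    (A : Fin n → Fin L → ZMod 2) (x : Fin n → Bool) :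
    errorProb q (linCode q A) x ≤ linErr q A := by
  rw [errorProb_eq, linErr]
  refine noiseExp_mono h0 h1 fun w => ?_
  by_cases h : (linCode q A).dec (addNoise ((linCode q A).enc x) w) ≠ x
  · rw [if_pos h, if_pos]
    set y := (linCode q A).dec (addNoise ((linCode q A).enc x) w) with hy
    refine ⟨addNoise y x, ?_, ?_⟩
    · by_contra hc
      push Not at hc
      apply h
      funext i
      have := hc i
      simpa [addNoise] using this
    · rw [← addNoise_linEnc]
      have := linCode_isML q A (addNoise ((linCode q A).enc x) w) x
      rw [← hy] at this
      change noiseWeight q (addNoise (linEnc A x) (addNoise (linEnc A x) w)) ≤ _ at this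
      rwa [addNoise_self_left] at this
  · rw [if_neg h]
    split_ifs <;> norm_num

theorem noiseWeight_pos {ι : Type*} [Fintype ι] {q : ℝ} (h0 : 0 < q) (h1 : q < 1)
    (w : ι → Bool) : 0 < noiseWeight q w :=
  Finset.prod_pos fun i _ => by split_ifs <;> linarith

theorem sum_noiseWeight {ι : Type*} [Fintype ι] [DecidableEq ι] (q : ℝ) :
    ∑ w : ι → Bool, noiseWeight q w = 1 := by
  have := noiseExp_const (ι := ι) (q := q) 1
  simpa [noiseExp] using this

-- First-moment bound over random generators, tempered by the power `ρ`: without it the atypical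
-- noise patterns, for which the expected number of competitors exceeds `1`, would dominate the
-- average.
open Classical in
theorem exists_linErr_le {q : ℝ} (h0 : 0 < q) (h1 : q < 1) (n L : ℕ) {ρ : ℝ} (hρ0 : 0 < ρ)
    (hρ1 : ρ ≤ 1) :
    ∃ A : Fin n → Fin L → ZMod 2, linErr q A
      ≤ ((2 : ℝ) ^ n / 2 ^ L) ^ ρ * (q ^ (1 - ρ) + (1 - q) ^ (1 - ρ)) ^ L := by
  by_contra hcon
  push Not at hcon
  set D : ℝ := ((Fintype.card (Fin n → Fin L → ZMod 2) : ℕ) : ℝ) with hD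
  have hDpos : 0 < D := by rw [hD]; exact_mod_cast Fintype.card_pos
  have hsum : ∑ A : Fin n → Fin L → ZMod 2, linErr q A
      ≤ D * (((2 : ℝ) ^ n / 2 ^ L) ^ ρ * (q ^ (1 - ρ) + (1 - q) ^ (1 - ρ)) ^ L) := by
    simp only [linErr]
    rw [← noiseExp_sum]
    have hpt : ∀ w : Fin L → Bool,
        ∑ A : Fin n → Fin L → ZMod 2, (if ∃ u : Fin n → Bool, (∃ i, u i = true) ∧
          noiseWeight q w ≤ noiseWeight q (addNoise (linEnc A u) w) then (1 : ℝ) else 0)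
        ≤ D * (((2 : ℝ) ^ n / 2 ^ L) / noiseWeight q w) ^ ρ := by
      intro w
      have hW := noiseWeight_pos h0 h1 w
      set X : ℝ := ((2 : ℝ) ^ n / 2 ^ L) / noiseWeight q w with hX
      have hXpos : 0 < X := by positivity
      have b1 : ∑ A : Fin n → Fin L → ZMod 2, (if ∃ u : Fin n → Bool, (∃ i, u i = true) ∧
          noiseWeight q w ≤ noiseWeight q (addNoise (linEnc A u) w) then (1 : ℝ) else 0) ≤ D := by
        rw [hD]
        calc _ ≤ ∑ A : Fin n → Fin L → ZMod 2, (1 : ℝ) :=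
              Finset.sum_le_sum fun A _ => by split_ifs <;> norm_num
          _ = _ := by simp
      have b2 : ∑ A : Fin n → Fin L → ZMod 2, (if ∃ u : Fin n → Bool, (∃ i, u i = true) ∧
          noiseWeight q w ≤ noiseWeight q (addNoise (linEnc A u) w) then (1 : ℝ) else 0)
          ≤ D * X := by
        -- Markov's inequality: the likelihood ratio dominates the indicator of a competitor, and
        -- its sum over all words is `1 / W(w)`.
        let F : (Fin L → Bool) → ℝ := fun v => noiseWeight q (addNoise v w) / noiseWeight q w
        have hFsum : ∑ v, F v = 1 / noiseWeight q w := by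
          simp only [F]
          rw [← Finset.sum_div]
          congr 1
          rw [← sum_noiseWeight (ι := Fin L) q]
          have hb : Function.Bijective (fun v : Fin L → Bool => addNoise v w) :=
            Function.Involutive.bijective fun v => by funext t; simp [addNoise]
          exact Fintype.sum_bijective _ hb _ _ fun v => rfl
        have hF0 : ∀ v, 0 ≤ F v := fun v => div_nonneg (noiseWeight_pos h0 h1 _).le hW.le
        calc _ ≤ ∑ A : Fin n → Fin L → ZMod 2,
                ∑ u ∈ Finset.univ.filter (fun u : Fin n → Bool => ∃ i, u i = true),
                  F (linEnc A u) := by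
              refine Finset.sum_le_sum fun A _ => ?_
              split_ifs with h
              · obtain ⟨u, hu, hle⟩ := h
                refine le_trans ?_ (Finset.single_le_sum (fun u _ => hF0 (linEnc A u))
                  (Finset.mem_filter.2 ⟨Finset.mem_univ u, hu⟩))
                simp only [F]
                rwa [le_div_iff₀ hW, one_mul]
              · exact Finset.sum_nonneg fun u _ => hF0 _
          _ = ∑ u ∈ Finset.univ.filter (fun u : Fin n → Bool => ∃ i, u i = true),
                ∑ A : Fin n → Fin L → ZMod 2, F (linEnc A u) := Finset.sum_comm
          _ = ∑ u ∈ Finset.univ.filter (fun u : Fin n → Bool => ∃ i, u i = true),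
                D / 2 ^ L * (1 / noiseWeight q w) := by
              refine Finset.sum_congr rfl fun u hu => ?_
              obtain ⟨i, hi⟩ := (Finset.mem_filter.1 hu).2
              rw [sum_linEnc u i hi, hFsum]
          _ ≤ ∑ u : Fin n → Bool, D / 2 ^ L * (1 / noiseWeight q w) :=
              Finset.sum_le_sum_of_subset_of_nonneg (Finset.filter_subset _ _)
                fun _ _ _ => by positivity
          _ = D * X := by
              simp only [Finset.sum_const, Finset.card_univ, Fintype.card_fun, Fintype.card_bool,
                Fintype.card_fin, nsmul_eq_mul, Nat.cast_pow, Nat.cast_ofNat, hX]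
              field_simp
      -- `min (1, X) ≤ X ^ ρ` for `0 < ρ ≤ 1`.
      rcases le_total X 1 with hX1 | hX1
      · refine b2.trans (mul_le_mul_of_nonneg_left ?_ hDpos.le)
        calc X = X ^ (1 : ℝ) := (Real.rpow_one X).symm
          _ ≤ X ^ ρ := Real.rpow_le_rpow_of_exponent_ge hXpos hX1 hρ1
      · refine b1.trans (le_mul_of_one_le_right hDpos.le ?_)
        exact Real.one_le_rpow hX1 hρ0.le
    refine (noiseExp_mono h0.le h1.le hpt).trans (le_of_eq ?_)
    have hpt2 : ∀ w : Fin L → Bool, D * (((2 : ℝ) ^ n / 2 ^ L) / noiseWeight q w) ^ ρ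
        = D * ((2 : ℝ) ^ n / 2 ^ L) ^ ρ * ∏ t, (if w t then q else 1 - q) ^ (-ρ) := by
      intro w
      have hW := noiseWeight_pos h0 h1 w
      rw [Real.div_rpow (by positivity) hW.le, Real.finsetProd_rpow _ _
        (fun t _ => by split_ifs <;> linarith), ← noiseWeight, Real.rpow_neg hW.le, mul_assoc,
        div_eq_mul_inv]
    simp only [hpt2]
    have hpull : noiseExp q (fun w : Fin L → Bool => D * ((2 : ℝ) ^ n / 2 ^ L) ^ ρ *
          ∏ t, (if w t then q else 1 - q) ^ (-ρ))
        = D * ((2 : ℝ) ^ n / 2 ^ L) ^ ρ *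
          noiseExp q (fun w : Fin L → Bool => ∏ t, (if w t then q else 1 - q) ^ (-ρ)) := by
      simp only [noiseExp, Finset.mul_sum]
      exact Finset.sum_congr rfl fun w _ => by ring
    rw [hpull, noiseExp_prod (fun _ x => (if x then q else 1 - q) ^ (-ρ))]
    simp only [if_true, Bool.false_eq_true, if_false, Finset.prod_const, Finset.card_univ,
      Fintype.card_fin]
    have e1 : ∀ a : ℝ, 0 < a → a * a ^ (-ρ) = a ^ (1 - ρ) := by
      intro a ha
      rw [sub_eq_add_neg, Real.rpow_add ha, Real.rpow_one]
    rw [e1 q h0, e1 (1 - q) (by linarith), mul_assoc]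
  have hlt : D * (((2 : ℝ) ^ n / 2 ^ L) ^ ρ * (q ^ (1 - ρ) + (1 - q) ^ (1 - ρ)) ^ L)
      < ∑ A : Fin n → Fin L → ZMod 2, linErr q A := by
    calc _ = ∑ A : Fin n → Fin L → ZMod 2,
          (((2 : ℝ) ^ n / 2 ^ L) ^ ρ * (q ^ (1 - ρ) + (1 - q) ^ (1 - ρ)) ^ L) := by
          simp [hD]
      _ < _ := Finset.sum_lt_sum_of_nonempty Finset.univ_nonempty fun A _ => hcon A
  linarith

/-- Below capacity the exponent of the random coding bound is negative for some tilt. -/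
theorem exists_tilt {q R : ℝ} (h0 : 0 < q) (h1 : q < 1)
    (hR : R < 1 + q * Real.logb 2 q + (1 - q) * Real.logb 2 (1 - q)) :
    ∃ ρ : ℝ, 0 < ρ ∧ ρ ≤ 1 ∧
      ρ * (R - 1) * Real.log 2 + Real.log (q ^ (1 - ρ) + (1 - q) ^ (1 - ρ)) < 0 := by
  have h1' : 0 < 1 - q := by linarith
  have hl2 : 0 < Real.log 2 := Real.log_pos one_lt_two
  set φ : ℝ → ℝ := fun ρ =>
    ρ * (R - 1) * Real.log 2 + Real.log (q ^ (1 - ρ) + (1 - q) ^ (1 - ρ)) with hφ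
  -- The derivative of `φ` at `0`, equal to `R` minus the capacity, times `log 2`. Since `φ 0 = 0`,
  -- small positive tilts make `φ` negative.
  set d : ℝ := (R - 1) * Real.log 2 - q * Real.log q - (1 - q) * Real.log (1 - q) with hd
  have hdneg : d < 0 := by
    have : R * Real.log 2 < (1 + q * Real.logb 2 q + (1 - q) * Real.logb 2 (1 - q)) * Real.log 2 :=
      mul_lt_mul_of_pos_right hR hl2
    have e : (1 + q * Real.logb 2 q + (1 - q) * Real.logb 2 (1 - q)) * Real.log 2
        = Real.log 2 + q * Real.log q + (1 - q) * Real.log (1 - q) := by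
      simp only [Real.logb]
      field_simp
    rw [e] at this
    rw [hd]; linarith
  have hder : HasDerivAt φ d 0 := by
    have e : ∀ a : ℝ, 0 < a → HasDerivAt (fun ρ : ℝ => a ^ (1 - ρ)) (-(a * Real.log a)) 0 := by
      intro a ha
      have := (((hasDerivAt_id (0 : ℝ)).const_sub 1).const_rpow ha)
      simpa [mul_comm] using this
    have hs := (e q h0).add (e (1 - q) h1')
    have hl := hs.log (by simp)
    have hlin : HasDerivAt (fun ρ : ℝ => ρ * (R - 1) * Real.log 2) ((R - 1) * Real.log 2) 0 := by
      have := ((hasDerivAt_id (0 : ℝ)).mul_const (R - 1)).mul_const (Real.log 2)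
      simpa using this
    have hsum := hlin.add hl
    have e2 : (R - 1) * Real.log 2 + (-(q * Real.log q) + -((1 - q) * Real.log (1 - q))) /
        ((fun ρ : ℝ => q ^ (1 - ρ)) + fun ρ : ℝ => (1 - q) ^ (1 - ρ)) 0 = d := by
      simp only [hd, Pi.add_apply, sub_zero, Real.rpow_one, add_sub_cancel, div_one]
      ring
    rw [e2] at hsum
    exact hsum
  have hφ0 : φ 0 = 0 := by simp [hφ]
  have hslope := hder.tendsto_slope_zero_right
  have hev : ∀ᶠ t in 𝓝[>] (0 : ℝ), t⁻¹ • (φ (0 + t) - φ 0) < 0 :=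
    hslope.eventually (gt_mem_nhds hdneg)
  have hev2 : ∀ᶠ t in 𝓝[>] (0 : ℝ), t ≤ 1 :=
    (eventually_le_nhds (show (0 : ℝ) < 1 by norm_num)).filter_mono nhdsWithin_le_nhds
  obtain ⟨t, ht1, ht2, ht3⟩ := (hev.and (hev2.and self_mem_nhdsWithin)).exists
  refine ⟨t, ht3, ht2, ?_⟩
  have ht3' : 0 < t := ht3
  rw [hφ0, zero_add, sub_zero, smul_eq_mul] at ht1
  have : φ t < 0 := by
    by_contra hc
    push Not at hc
    exact absurd ht1 (not_lt.2 (mul_nonneg (inv_nonneg.2 ht3'.le) hc))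
  exact this

/-- Reliable codes of every rate below capacity, with maximum-likelihood decoders. -/
theorem exists_reliableCodes {q R : ℝ} (h0 : 0 < q) (h1 : q < 1) (hR0 : 0 < R)
    (hR : R < 1 + q * Real.logb 2 q + (1 - q) * Real.logb 2 (1 - q)) :
    ∃ κ : ℝ, 0 < κ ∧ ∃ C : (n : ℕ) → BinCode n (codeLen R n),
      ReliableCodes q R κ C ∧ ∀ n, IsMLDecoder q (C n) := by
  obtain ⟨ρ, hρ0, hρ1, hφ⟩ := exists_tilt h0 h1 hR
  have hl2 : 0 < Real.log 2 := Real.log_pos one_lt_two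
  set g : ℝ := q ^ (1 - ρ) + (1 - q) ^ (1 - ρ) with hg
  have hgpos : 0 < g := add_pos (Real.rpow_pos_of_pos h0 _) (Real.rpow_pos_of_pos (by linarith) _)
  set φ : ℝ := ρ * (R - 1) * Real.log 2 + Real.log g with hφdef
  choose A hA using fun n => exists_linErr_le h0 h1 n (codeLen R n) hρ0 hρ1
  -- The random coding bound is at most `exp (φ n / R)`; half of this exponent is given away to get
  -- a strict inequality.
  refine ⟨-φ / (2 * R * Real.log 2), div_pos (by linarith) (by positivity),
    fun n => linCode q (A n), ?_, fun n => linCode_isML q (A n)⟩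
  filter_upwards [eventually_ge_atTop 1] with n hn x
  refine ((errorProb_linCode_le h0.le h1.le (A n) x).trans (hA n)).trans_lt ?_
  have hn' : (0 : ℝ) < n := by exact_mod_cast hn
  have hL : (n : ℝ) / R ≤ codeLen R n := Nat.le_ceil _
  have e1 : ((2 : ℝ) ^ n / 2 ^ codeLen R n) ^ ρ * g ^ codeLen R n
      = Real.exp (ρ * (n - codeLen R n) * Real.log 2 + codeLen R n * Real.log g) := by
    rw [Real.exp_add]
    congr 1
    · rw [Real.rpow_def_of_pos (by positivity), Real.log_div (by positivity) (by positivity),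
        Real.log_pow, Real.log_pow]
      congr 1; ring
    · rw [mul_comm, Real.exp_mul, Real.exp_log hgpos, Real.rpow_natCast]
  rw [← hg, e1, Real.rpow_def_of_pos two_pos, Real.exp_lt_exp]
  have e2 : Real.log 2 * -(-φ / (2 * R * Real.log 2) * n) = φ * (n / R) / 2 := by
    field_simp
  rw [e2]
  have h3 : Real.log g - ρ * Real.log 2 = φ - ρ * R * Real.log 2 := by rw [hφdef]; ring
  -- Every additional code symbol lowers the bound, so rounding the block length up is harmless.
  have h4 : Real.log g - ρ * Real.log 2 < 0 := by
    rw [h3]; have : 0 < ρ * R * Real.log 2 := by positivity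
    linarith
  have h5 : (codeLen R n : ℝ) * (Real.log g - ρ * Real.log 2)
      ≤ (n / R) * (Real.log g - ρ * Real.log 2) := mul_le_mul_of_nonpos_right hL h4.le
  have h6 : (n : ℝ) / R * (φ - ρ * R * Real.log 2) = φ * (n / R) - ρ * n * Real.log 2 := by
    field_simp
  rw [h3, h6] at h5
  have h7 : φ * (n / R) < 0 := mul_neg_of_neg_of_pos hφ (by positivity)
  have h8 : (codeLen R n : ℝ) * (φ - ρ * R * Real.log 2)
      = codeLen R n * Real.log g - ρ * codeLen R n * Real.log 2 := by rw [← h3]; ring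
  nlinarith

/-! ### Exploration of a random pairing of sockets

Item sockets `E` are paired with bin sockets, also labelled by `E`, by a uniform permutation. The
bin sockets in `T₁` are alone in their bin, those in `T₂` share it with exactly one partner,
given by `τ`. -/

/-- `Z` is a set of items that peeling cannot enter from outside: no socket of `Z` is alone in its
bin, and the partner of every socket of `Z` that has one belongs to `Z`. -/
def PeelClosed {E I : Type*} (item : E → I) (T₁ T₂ : Finset E) (τ : E → E) (σ : Equiv.Perm E)
    (Z : Finset I) : Prop :=
  ∀ e, item e ∈ Z → σ e ∉ T₁ ∧ (σ e ∈ T₂ → item (σ.symm (τ (σ e))) ∈ Z)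

theorem card_perm_agree_le {E : Type*} [Fintype E] [DecidableEq E] (X : Finset E)
    (σ₀ : Equiv.Perm E) :
    (Finset.univ.filter fun σ : Equiv.Perm E => ∀ x ∈ X, σ x = σ₀ x).card
      ≤ (Fintype.card E - X.card).factorial := by
  have h1 : Fintype.card (Equiv.Perm {a // a ∉ X}) = (Fintype.card E - X.card).factorial := by
    rw [Fintype.card_perm, Fintype.card_subtype_compl, Fintype.card_coe]
  rw [← h1, Fintype.card_congr (Equiv.Perm.subtypeEquivSubtypePerm fun a => a ∉ X),
    Fintype.card_subtype]
  refine Finset.card_le_card_of_injOn (fun σ => σ₀⁻¹ * σ) ?_ ?_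
  · intro σ hσ
    simp only [Finset.coe_filter, Finset.mem_univ, true_and, Set.mem_ofPred_eq, not_not] at hσ ⊢
    intro a ha
    simp [hσ a ha]
  · intro a _ b _ hab
    exact mul_left_cancel hab

open Classical in
/-- Pairings that agree with `σ₀` on the exposed sockets `X` and for which peeling can be kept
out of the items of the sockets in `A`. -/
noncomputable def unmarked {E I : Type*} [Fintype E] [DecidableEq E] (item : E → I)
    (T₁ T₂ : Finset E) (τ : E → E) (X : Finset E) (σ₀ : Equiv.Perm E) (A : Finset E) :
    Finset (Equiv.Perm E) :=
  Finset.univ.filter fun σ => (∀ x ∈ X, σ x = σ₀ x) ∧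
    ∃ Z : Finset I, PeelClosed item T₁ T₂ τ σ Z ∧ ∀ e ∈ A, item e ∈ Z

section explore
variable {E I : Type*} [Fintype E] [DecidableEq E] {item : E → I}
  {T₁ T₂ : Finset E} {τ : E → E}

theorem mem_unmarked {X A : Finset E} {σ₀ σ : Equiv.Perm E} :
    σ ∈ unmarked item T₁ T₂ τ X σ₀ A ↔ (∀ x ∈ X, σ x = σ₀ x) ∧
      ∃ Z : Finset I, PeelClosed item T₁ T₂ τ σ Z ∧ ∀ e ∈ A, item e ∈ Z := by
  simp [unmarked]

/-- Exposing one more socket. -/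
theorem exists_expose_one {X A : Finset E} {σ₀ : Equiv.Perm E} {e x : E} :
    ∃ σ₁, (unmarked item T₁ T₂ τ X σ₀ A).filter (fun σ => σ e = x) ⊆
      unmarked item T₁ T₂ τ (insert e X) σ₁ (A.erase e) := by
  -- Any member of the fibre can serve as the new reference pairing `σ₁`; only its values on the
  -- exposed sockets matter.
  rcases ((unmarked item T₁ T₂ τ X σ₀ A).filter (fun σ => σ e = x)).eq_empty_or_nonempty with h | h
  · exact ⟨σ₀, by rw [h]; exact Finset.empty_subset _⟩
  · obtain ⟨σ₁, h₁⟩ := h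
    refine ⟨σ₁, fun σ hσ => ?_⟩
    rw [Finset.mem_filter, mem_unmarked] at h₁ hσ
    obtain ⟨⟨hX, Z, hZ, hA⟩, he⟩ := hσ
    refine mem_unmarked.2 ⟨fun y hy => ?_, Z, hZ, fun y hy => hA y (Finset.mem_of_mem_erase hy)⟩
    rcases Finset.mem_insert.1 hy with rfl | hy
    · rw [he, h₁.2]
    · rw [hX y hy, h₁.1.1 y hy]

/-- Exposing a socket together with its partner. -/
theorem exists_expose_two {X A A' : Finset E} {σ₀ : Equiv.Perm E} {e e' x : E} (he : e ∈ A)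
    (hx : x ∈ T₂) (hA' : ∀ f ∈ A', f ∈ A ∨ item f = item e') :
    ∃ σ₁, ((unmarked item T₁ T₂ τ X σ₀ A).filter (fun σ => σ e = x)).filter
        (fun σ => σ e' = τ x) ⊆
      unmarked item T₁ T₂ τ (insert e' (insert e X)) σ₁ A' := by
  rcases (((unmarked item T₁ T₂ τ X σ₀ A).filter (fun σ => σ e = x)).filter
        (fun σ => σ e' = τ x)).eq_empty_or_nonempty with h | h
  · exact ⟨σ₀, by rw [h]; exact Finset.empty_subset _⟩
  · obtain ⟨σ₁, h₁⟩ := h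
    refine ⟨σ₁, fun σ hσ => ?_⟩
    rw [Finset.mem_filter, Finset.mem_filter, mem_unmarked] at h₁ hσ
    obtain ⟨⟨⟨hX, Z, hZ, hA⟩, hex⟩, hey⟩ := hσ
    refine mem_unmarked.2 ⟨fun y hy => ?_, Z, hZ, fun y hy => ?_⟩
    · rcases Finset.mem_insert.1 hy with rfl | hy
      · rw [hey, h₁.2]
      rcases Finset.mem_insert.1 hy with rfl | hy
      · rw [hex, h₁.1.2]
      · rw [hX y hy, h₁.1.1.1 y hy]
    · rcases hA' y hy with h | h
      · exact hA y h
      · rw [h]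
        -- Closedness forces the item of the partner into `Z`, so all sockets of that item may
        -- become pending.
        have := (hZ e (hA e he)).2 (by rwa [hex])
        rw [hex, ← hey, Equiv.symm_apply_apply] at this
        exact this

theorem card_unmarked_le_factorial (X A : Finset E) (σ₀ : Equiv.Perm E) :
    (unmarked item T₁ T₂ τ X σ₀ A).card ≤ (Fintype.card E - X.card).factorial :=
  (Finset.card_le_card fun σ hσ => Finset.mem_filter.2
    ⟨Finset.mem_univ σ, (mem_unmarked.1 hσ).1⟩).trans (card_perm_agree_le X σ₀)

variable [DecidableEq I]

/-- The exploration of a socket whose bin socket `x` has an unexposed partner. -/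
theorem card_unmarked_pair_le {ℓ B s : ℕ} {t μ ζ : ℝ} (ht0 : 0 < t) (ht1 : t ≤ 1)
    (hℓ : ∀ i, (Finset.univ.filter fun e => item e = i).card = ℓ) (hℓ1 : 1 ≤ ℓ)
    (hτne : ∀ x ∈ T₂, τ x ≠ x)
    (h3 : (ℓ : ℝ) * B ≤ ζ * t * (Fintype.card E - B - 1)) (hζ : 0 ≤ ζ)
    (hB : B + 1 < Fintype.card E)
    (IH : ∀ (X : Finset E) (σ₀ : Equiv.Perm E) (A : Finset E), Disjoint A X →
      X.card + A.card + (ℓ + 2) * s ≤ B →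
      ((unmarked item T₁ T₂ τ X σ₀ A).card : ℝ)
        ≤ (Fintype.card E - X.card).factorial * (t ^ A.card + μ ^ s))
    {X A : Finset E} {σ₀ : Equiv.Perm E} (hAX : Disjoint A X)
    (hcap : X.card + A.card + (ℓ + 2) * (s + 1) ≤ B) {e x : E} (he : e ∈ A) (hx : x ∈ T₂)
    (hτx : τ x ∉ X.image σ₀) :
    (((unmarked item T₁ T₂ τ X σ₀ A).filter (fun σ => σ e = x)).card : ℝ)
      ≤ (Fintype.card E - (X.card + 1)).factorial *
        (μ ^ s + t ^ (A.card - 1) * (t ^ (ℓ - 1) + ζ)) := by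
  set n := Fintype.card E with hn
  have heX : e ∉ X := Finset.disjoint_left.1 hAX he
  have ha : 1 ≤ A.card := Finset.card_pos.2 ⟨e, he⟩
  have hXc : (insert e X).card = X.card + 1 := Finset.card_insert_of_notMem heX
  have hexp : X.card + 2 ≤ n := by nlinarith
  set F := (unmarked item T₁ T₂ τ X σ₀ A).filter (fun σ => σ e = x) with hF
  -- Condition on the item socket `e'` that is paired with the partner `τ x`.
  have hfib : (F.card : ℝ) = ∑ e' : E, ((F.filter (fun σ => σ e' = τ x)).card : ℝ) := by
    rw [Finset.card_eq_sum_card_fiberwise (f := fun σ : Equiv.Perm E => σ.symm (τ x))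
      (t := Finset.univ) (fun _ _ => Finset.mem_coe.2 (Finset.mem_univ _))]
    push_cast
    refine Finset.sum_congr rfl fun e' _ => ?_
    congr 2
    ext σ
    simp only [Finset.mem_filter]
    rw [Equiv.symm_apply_eq, eq_comm]
  have hzero : ∀ e' ∈ insert e X, F.filter (fun σ => σ e' = τ x) = ∅ := by
    intro e' he'
    rw [Finset.filter_eq_empty_iff]
    intro σ hσ hσe
    rw [hF, Finset.mem_filter, mem_unmarked] at hσ
    rcases Finset.mem_insert.1 he' with rfl | he'
    · exact hτne x hx (by rw [← hσe, hσ.2])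
    · exact hτx (Finset.mem_image.2 ⟨e', he', by rw [← hσe, hσ.1.1 e' he']⟩)
  -- Sockets of items that already own an exposed or pending socket. A partner found there need not
  -- bring `ℓ - 1` fresh sockets, but by `h3` this is rare.
  set touched : Finset E := Finset.univ.filter fun e' => item e' ∈ (X ∪ A).image item with htd
  have htouched : (touched.card : ℝ) ≤ ℓ * B := by
    have h : touched.card ≤ ℓ * ((X ∪ A).image item).card := by
      refine Finset.card_le_mul_card_image_of_maps_to (f := item) (fun a ha => ?_) ℓ fun i _ => ?_
      · exact (Finset.mem_filter.1 ha).2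
      · rw [← hℓ i]
        exact Finset.card_le_card (Finset.filter_subset_filter _ (Finset.subset_univ _))
    have h' : ((X ∪ A).image item).card ≤ B :=
      Finset.card_image_le.trans ((Finset.card_union_le _ _).trans (by omega))
    have : touched.card ≤ ℓ * B := by
      exact h.trans (Nat.mul_le_mul_left ℓ h')
    exact_mod_cast this
  have hpt : ∀ e' ∉ insert e X, ((F.filter (fun σ => σ e' = τ x)).card : ℝ)
      ≤ (n - (X.card + 2)).factorial * (t ^ (A.card - 1) * t ^ (ℓ - 1) + μ ^ s
        + if e' ∈ touched then t ^ (A.card - 1) / t else 0) := by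
    intro e' he'
    have hX2 : (insert e' (insert e X)).card = X.card + 2 := by
      rw [Finset.card_insert_of_notMem he', hXc]
    have hee' : e' ≠ e := fun h => he' (h ▸ Finset.mem_insert_self _ _)
    have he'X : e' ∉ X := fun h => he' (Finset.mem_insert_of_mem h)
    by_cases htc : e' ∈ touched
    · rw [if_pos htc]
      obtain ⟨σ₁, hσ₁⟩ := exists_expose_two (item := item) (T₁ := T₁) (τ := τ) (X := X) (σ₀ := σ₀)
        (A' := (A.erase e).erase e') (e' := e') he hx
        (fun f hf => Or.inl (Finset.mem_of_mem_erase (Finset.mem_of_mem_erase hf)))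
      have hdis : Disjoint ((A.erase e).erase e') (insert e' (insert e X)) := by
        rw [Finset.disjoint_left]
        intro f hf hf2
        simp only [Finset.mem_erase, Finset.mem_insert] at hf hf2
        rcases hf2 with h | h | h
        · exact hf.1 h
        · exact hf.2.1 h
        · exact Finset.disjoint_left.1 hAX hf.2.2 h
      have hc1 : (A.erase e).card = A.card - 1 := Finset.card_erase_of_mem he
      have hc2 : A.card - 1 - 1 ≤ ((A.erase e).erase e').card := by
        rw [← hc1]; exact Finset.pred_card_le_card_erase
      have hc3 : ((A.erase e).erase e').card ≤ A.card :=
        (Finset.card_le_card ((Finset.erase_subset _ _).trans (Finset.erase_subset _ _)))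
      have hih := IH _ σ₁ _ hdis (by rw [hX2]; nlinarith)
      -- The budget of `ℓ + 2` per step is generous: `|X| + |A|` grows by at most `2` here and by
      -- exactly `ℓ` for a fresh item.
      rw [hX2] at hih
      have h1 : ((F.filter (fun σ => σ e' = τ x)).card : ℝ)
          ≤ (unmarked item T₁ T₂ τ (insert e' (insert e X)) σ₁ ((A.erase e).erase e')).card := by
        exact_mod_cast Finset.card_le_card hσ₁
      refine (h1.trans hih).trans (mul_le_mul_of_nonneg_left ?_ (by positivity))
      -- Both `e` and `e'` may have been pending, so up to two factors `t` disappear. The resulting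
      -- `1 / t` is cancelled by the factor `t` in `h3`.
      have h2 : t ^ ((A.erase e).erase e').card ≤ t ^ (A.card - 1) / t := by
        rw [le_div_iff₀ ht0, ← pow_succ]
        exact pow_le_pow_of_le_one ht0.le ht1 (by omega)
      have h3 : 0 ≤ t ^ (A.card - 1) * t ^ (ℓ - 1) := by positivity
      linarith
    · rw [if_neg htc, add_zero]
      have hnt : ∀ f ∈ X ∪ A, item f ≠ item e' := by
        intro f hf heq
        exact htc (Finset.mem_filter.2 ⟨Finset.mem_univ _, Finset.mem_image.2 ⟨f, hf, heq⟩⟩)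
      set Fi := (Finset.univ.filter fun f => item f = item e') with hFi
      obtain ⟨σ₁, hσ₁⟩ := exists_expose_two (item := item) (T₁ := T₁) (τ := τ) (X := X) (σ₀ := σ₀)
        (A' := (A.erase e) ∪ Fi.erase e') (e' := e') he hx
        (fun f hf => by
          rcases Finset.mem_union.1 hf with h | h
          · exact Or.inl (Finset.mem_of_mem_erase h)
          · exact Or.inr (Finset.mem_filter.1 (Finset.mem_of_mem_erase h)).2)
      have he'A : e' ∉ A := fun h => hnt e' (Finset.mem_union_right _ h) rfl
      have hdis : Disjoint ((A.erase e) ∪ Fi.erase e') (insert e' (insert e X)) := by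
        rw [Finset.disjoint_left]
        intro f hf hf2
        simp only [Finset.mem_erase, Finset.mem_insert, Finset.mem_union, hFi, Finset.mem_filter,
          Finset.mem_univ, true_and] at hf hf2
        rcases hf with hf | hf
        · rcases hf2 with h | h | h
          · exact he'A (h ▸ hf.2)
          · exact hf.1 h
          · exact Finset.disjoint_left.1 hAX hf.2 h
        · rcases hf2 with h | h | h
          · exact hf.1 h
          · exact hnt e (Finset.mem_union_right _ he) (h ▸ hf.2)
          · exact hnt f (Finset.mem_union_left _ h) hf.2
      -- A fresh item loses its socket `e'` and adds its other `ℓ - 1` sockets to the pending ones,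
      -- none of which was known before.
      have hc : ((A.erase e) ∪ Fi.erase e').card = (A.card - 1) + (ℓ - 1) := by
        rw [Finset.card_union_of_disjoint, Finset.card_erase_of_mem he, Finset.card_erase_of_mem,
          hℓ]
        · simp [hFi]
        · rw [Finset.disjoint_left]
          intro f hf hf2
          exact hnt f (Finset.mem_union_right _ (Finset.mem_of_mem_erase hf))
            (Finset.mem_filter.1 (Finset.mem_of_mem_erase hf2)).2
      have hih := IH _ σ₁ _ hdis (by
        rw [hX2, hc]
        have : (ℓ + 2) * (s + 1) = (ℓ + 2) * s + (ℓ + 2) := by ring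
        omega)
      rw [hX2, hc, pow_add] at hih
      have h1 : ((F.filter (fun σ => σ e' = τ x)).card : ℝ)
          ≤ (unmarked item T₁ T₂ τ (insert e' (insert e X)) σ₁ ((A.erase e) ∪ Fi.erase e')).card := by
        exact_mod_cast Finset.card_le_card hσ₁
      exact h1.trans hih
  set f2 : ℝ := ((n - (X.card + 2)).factorial : ℝ) with hf2
  have hf2pos : 0 ≤ f2 := by positivity
  have hXB : (X.card : ℝ) ≤ B := by
    have : X.card ≤ B := by nlinarith
    exact_mod_cast this
  have hfac : ((n - (X.card + 1)).factorial : ℝ) = ((n : ℝ) - X.card - 1) * f2 := by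
    have : n - (X.card + 1) = (n - (X.card + 2)) + 1 := by omega
    rw [this, Nat.factorial_succ, ← this, hf2]
    push_cast [Nat.cast_sub (show X.card + 1 ≤ n by omega)]
    ring
  rw [hfib, ← Finset.sum_add_sum_compl (insert e X), Finset.sum_eq_zero (fun e' he' => by
    rw [hzero e' he']; simp), zero_add]
  have hcc : (((insert e X)ᶜ).card : ℝ) = (n : ℝ) - X.card - 1 := by
    rw [Finset.card_compl, hXc, Nat.cast_sub (by omega)]
    push_cast; ring
  calc _ ≤ ∑ e' ∈ (insert e X)ᶜ, f2 * (t ^ (A.card - 1) * t ^ (ℓ - 1) + μ ^ s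
        + if e' ∈ touched then t ^ (A.card - 1) / t else 0) :=
        Finset.sum_le_sum fun e' he' => hpt e' (Finset.mem_compl.1 he')
    _ = f2 * (((n : ℝ) - X.card - 1) * (t ^ (A.card - 1) * t ^ (ℓ - 1) + μ ^ s)
        + ∑ e' ∈ (insert e X)ᶜ, if e' ∈ touched then t ^ (A.card - 1) / t else 0) := by
        rw [← Finset.mul_sum, Finset.sum_add_distrib, Finset.sum_const, nsmul_eq_mul, hcc]
    _ ≤ f2 * (((n : ℝ) - X.card - 1) * (t ^ (A.card - 1) * t ^ (ℓ - 1) + μ ^ s)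
        + ((n : ℝ) - X.card - 1) * (t ^ (A.card - 1) * ζ)) := by
        refine mul_le_mul_of_nonneg_left (add_le_add le_rfl ?_) hf2pos
        have h4 : ∑ e' ∈ (insert e X)ᶜ, (if e' ∈ touched then t ^ (A.card - 1) / t else 0)
            ≤ touched.card * (t ^ (A.card - 1) / t) := by
          calc _ ≤ ∑ e' : E, (if e' ∈ touched then t ^ (A.card - 1) / t else 0) :=
                Finset.sum_le_sum_of_subset_of_nonneg (Finset.subset_univ _)
                  fun _ _ _ => by split_ifs <;> positivity
            _ = _ := by simp
        refine h4.trans ?_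
        have h5 : (touched.card : ℝ) ≤ ζ * t * ((n : ℝ) - X.card - 1) := by
          refine (htouched.trans h3).trans (mul_le_mul_of_nonneg_left ?_ (by positivity))
          linarith
        calc _ ≤ ζ * t * ((n : ℝ) - X.card - 1) * (t ^ (A.card - 1) / t) :=
              mul_le_mul_of_nonneg_right h5 (by positivity)
          _ = _ := by field_simp
    _ = _ := by rw [hfac]; ring

/-- Exploration bound: the probability that peeling stays away from all sockets of `A` is at most
`t ^ |A|`, up to an exponentially small term for running out of the budget of `s` steps. -/
theorem card_unmarked_le {ℓ B : ℕ} {t μ ζ : ℝ} (ht0 : 0 < t) (ht1 : t ≤ 1) (hμ0 : 0 ≤ μ)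
    (hℓ : ∀ i, (Finset.univ.filter fun e => item e = i).card = ℓ) (hℓ1 : 1 ≤ ℓ)
    (hdisj : Disjoint T₁ T₂) (hτinj : Set.InjOn τ T₂) (hτne : ∀ x ∈ T₂, τ x ≠ x)
    (h1 : (Fintype.card E : ℝ) - T₁.card ≤ μ * (Fintype.card E - B))
    (h2 : (Fintype.card E : ℝ) - T₁.card - T₂.card + B + T₂.card * (t ^ (ℓ - 1) + ζ)
      ≤ t * (Fintype.card E - B))
    (h3 : (ℓ : ℝ) * B ≤ ζ * t * (Fintype.card E - B - 1)) (hζ : 0 ≤ ζ)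
    (hB : B + 1 < Fintype.card E) (s : ℕ) :
    ∀ (X : Finset E) (σ₀ : Equiv.Perm E) (A : Finset E), Disjoint A X →
      X.card + A.card + (ℓ + 2) * s ≤ B →
      ((unmarked item T₁ T₂ τ X σ₀ A).card : ℝ)
        ≤ (Fintype.card E - X.card).factorial * (t ^ A.card + μ ^ s) := by
  -- With no step left, `μ ^ 0 = 1` makes the bound trivial; with no pending socket, `t ^ 0 = 1`
  -- does.
  induction s with
  | zero =>
    intro X σ₀ A _ _
    have := card_unmarked_le_factorial (item := item) (T₁ := T₁) (T₂ := T₂) (τ := τ) X A σ₀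
    calc ((unmarked item T₁ T₂ τ X σ₀ A).card : ℝ)
        ≤ (Fintype.card E - X.card).factorial * 1 := by rw [mul_one]; exact_mod_cast this
      _ ≤ _ := by
        refine mul_le_mul_of_nonneg_left ?_ (by positivity)
        rw [pow_zero]
        have : 0 < t ^ A.card := by positivity
        linarith
  | succ s IH =>
    intro X σ₀ A hAX hcap
    rcases A.eq_empty_or_nonempty with rfl | ⟨e, he⟩
    · have := card_unmarked_le_factorial (item := item) (T₁ := T₁) (T₂ := T₂) (τ := τ) X ∅ σ₀
      calc ((unmarked item T₁ T₂ τ X σ₀ ∅).card : ℝ)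
          ≤ (Fintype.card E - X.card).factorial * 1 := by rw [mul_one]; exact_mod_cast this
        _ ≤ _ := by
          refine mul_le_mul_of_nonneg_left ?_ (by positivity)
          rw [Finset.card_empty, pow_zero]
          have : 0 ≤ μ ^ (s + 1) := by positivity
          linarith
    set n := Fintype.card E with hn
    have heX : e ∉ X := Finset.disjoint_left.1 hAX he
    have ha : 1 ≤ A.card := Finset.card_pos.2 ⟨e, he⟩
    have hXc : (insert e X).card = X.card + 1 := Finset.card_insert_of_notMem heX
    have hXB' : X.card ≤ B := by nlinarith
    -- Bin sockets whose partner was exposed earlier. They yield no new information and are few,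
    -- because `τ` is injective on `T₂`.
    set Y : Finset E := T₂.filter fun x => τ x ∈ X.image σ₀ with hY
    have hYX : Y.card ≤ X.card := by
      calc Y.card ≤ (X.image σ₀).card :=
            Finset.card_le_card_of_injOn τ (fun x hx => (Finset.mem_filter.1 hx).2)
              (hτinj.mono fun x hx => (Finset.mem_filter.1 hx).1)
        _ ≤ X.card := Finset.card_image_le
    set f1 : ℝ := ((n - (X.card + 1)).factorial : ℝ) with hf1
    have hf1pos : 0 ≤ f1 := by positivity
    set a := A.card with hadef
    set F := fun x => (unmarked item T₁ T₂ τ X σ₀ A).filter (fun σ => σ e = x) with hF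
    -- The four outcomes for the bin socket `x` of `e`: impossible in `T₁`; the factor `t ^ (ℓ - 1)
    -- + ζ` for an unexposed partner; merely dropping `e` when there is no unique partner; and the
    -- same when `x ∈ Y`. After summing over `x`, `h2` pays for the factor `t` of `e` and `h1` for
    -- one more factor `μ`.
    have hpt : ∀ x, ((F x).card : ℝ) ≤ f1 * ((if x ∈ T₁ then 0 else μ ^ s) +
        t ^ (a - 1) * (((if x ∈ T₁ ∪ T₂ then 0 else 1) + (if x ∈ T₂ then t ^ (ℓ - 1) + ζ else 0))
          + if x ∈ Y then 1 else 0)) := by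
      intro x
      have htp : 0 ≤ t ^ (a - 1) := by positivity
      have htl : 0 ≤ t ^ (ℓ - 1) + ζ := by positivity
      have hμs : 0 ≤ μ ^ s := by positivity
      by_cases hx1 : x ∈ T₁
      · have : F x = ∅ := by
          rw [hF, Finset.filter_eq_empty_iff]
          intro σ hσ hσe
          obtain ⟨_, Z, hZ, hA⟩ := mem_unmarked.1 hσ
          exact (hZ e (hA e he)).1 (hσe ▸ hx1)
        rw [this, Finset.card_empty, Nat.cast_zero]
        refine mul_nonneg hf1pos (add_nonneg ?_ (mul_nonneg htp (add_nonneg (add_nonneg ?_ ?_) ?_)))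
        all_goals split_ifs <;> first | assumption | norm_num
      rw [if_neg hx1]
      by_cases hc : x ∈ T₂ ∧ x ∉ Y
      · have hτx : τ x ∉ X.image σ₀ := fun h => hc.2 (Finset.mem_filter.2 ⟨hc.1, h⟩)
        have := card_unmarked_pair_le (item := item) (T₁ := T₁) ht0 ht1 hℓ hℓ1 hτne h3 hζ hB
          IH hAX hcap he hc.1 hτx
        refine this.trans (mul_le_mul_of_nonneg_left ?_ hf1pos)
        rw [if_pos (Finset.mem_union_right _ hc.1), if_pos hc.1, if_neg hc.2, zero_add, add_zero]
      · obtain ⟨σ₁, hσ₁⟩ := exists_expose_one (item := item) (T₁ := T₁) (T₂ := T₂) (τ := τ)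
          (X := X) (A := A) (σ₀ := σ₀) (e := e) (x := x)
        have hdis : Disjoint (A.erase e) (insert e X) := by
          rw [Finset.disjoint_insert_right]
          exact ⟨Finset.notMem_erase _ _, hAX.mono_left (Finset.erase_subset _ _)⟩
        have hc1 : (A.erase e).card = a - 1 := Finset.card_erase_of_mem he
        have hih := IH _ σ₁ _ hdis (by
          rw [hXc, hc1]
          have : (ℓ + 2) * (s + 1) = (ℓ + 2) * s + (ℓ + 2) := by ring
          omega)
        rw [hXc, hc1] at hih
        have hle : ((F x).card : ℝ) ≤ f1 * (t ^ (a - 1) + μ ^ s) :=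
          le_trans (by exact_mod_cast Finset.card_le_card hσ₁) hih
        refine hle.trans (mul_le_mul_of_nonneg_left ?_ hf1pos)
        rw [add_comm]
        refine add_le_add le_rfl (le_mul_of_one_le_right htp ?_)
        by_cases hx2 : x ∈ T₂
        · have hxY : x ∈ Y := by by_contra h; exact hc ⟨hx2, h⟩
          rw [if_pos (Finset.mem_union_right _ hx2), if_pos hx2, if_pos hxY]
          linarith
        · rw [if_neg (by simp [hx1, hx2]), if_neg hx2]
          split_ifs <;> norm_num
    have hfib : ((unmarked item T₁ T₂ τ X σ₀ A).card : ℝ) = ∑ x : E, ((F x).card : ℝ) := by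
      rw [Finset.card_eq_sum_card_fiberwise (f := fun σ : Equiv.Perm E => σ e)
        (t := Finset.univ) (fun _ _ => Finset.mem_coe.2 (Finset.mem_univ _))]
      push_cast
      rfl
    have hXn : X.card + 1 ≤ n := by omega
    have hfac : ((n - X.card).factorial : ℝ) = ((n : ℝ) - X.card) * f1 := by
      have : n - X.card = (n - (X.card + 1)) + 1 := by omega
      rw [this, Nat.factorial_succ, ← this, hf1]
      push_cast [Nat.cast_sub (show X.card ≤ n by omega)]
      ring
    have hXB : (X.card : ℝ) ≤ B := by exact_mod_cast hXB'
    have hYB : (Y.card : ℝ) ≤ B := by exact_mod_cast hYX.trans hXB'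
    have s1 : ∑ x : E, (if x ∈ T₁ then 0 else μ ^ s) = ((n : ℝ) - T₁.card) * μ ^ s := by
      have : ∀ x : E, (if x ∈ T₁ then 0 else μ ^ s) = μ ^ s - if x ∈ T₁ then μ ^ s else 0 := by
        intro x; split_ifs <;> simp
      simp only [this, Finset.sum_sub_distrib]
      simp [hn]
      ring
    have s2 : ∑ x : E, (if x ∈ T₁ ∪ T₂ then (0 : ℝ) else 1) = (n : ℝ) - T₁.card - T₂.card := by
      have : ∀ x : E, (if x ∈ T₁ ∪ T₂ then (0 : ℝ) else 1) = 1 - if x ∈ T₁ ∪ T₂ then 1 else 0 := by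
        intro x; split_ifs <;> simp
      simp only [this, Finset.sum_sub_distrib, Finset.sum_ite_mem, Finset.univ_inter,
        Finset.sum_const, nsmul_eq_mul, mul_one, Finset.card_union_of_disjoint hdisj,
        Finset.card_univ]
      push_cast; ring
    rw [hfib]
    calc ∑ x : E, ((F x).card : ℝ)
        ≤ ∑ x : E, f1 * ((if x ∈ T₁ then 0 else μ ^ s) +
        t ^ (a - 1) * (((if x ∈ T₁ ∪ T₂ then 0 else 1) + (if x ∈ T₂ then t ^ (ℓ - 1) + ζ else 0))
          + if x ∈ Y then 1 else 0)) := Finset.sum_le_sum fun x _ => hpt x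
      _ = f1 * (((n : ℝ) - T₁.card) * μ ^ s + t ^ (a - 1) *
          ((n : ℝ) - T₁.card - T₂.card + T₂.card * (t ^ (ℓ - 1) + ζ) + Y.card)) := by
          rw [← Finset.mul_sum, Finset.sum_add_distrib, s1, ← Finset.mul_sum,
            Finset.sum_add_distrib, Finset.sum_add_distrib, s2]
          simp only [Finset.sum_ite_mem, Finset.univ_inter, Finset.sum_const, nsmul_eq_mul, mul_one]
      _ ≤ f1 * (μ * (n - X.card) * μ ^ s + t ^ (a - 1) * (t * (n - X.card))) := by
          refine mul_le_mul_of_nonneg_left (add_le_add ?_ ?_) hf1pos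
          · refine mul_le_mul_of_nonneg_right (h1.trans ?_) (by positivity)
            exact mul_le_mul_of_nonneg_left (by linarith) hμ0
          · refine mul_le_mul_of_nonneg_left ?_ (by positivity)
            have : t * ((n : ℝ) - B) ≤ t * (n - X.card) :=
              mul_le_mul_of_nonneg_left (by linarith) ht0.le
            linarith
      _ = _ := by
          have : t ^ a = t ^ (a - 1) * t := by rw [← pow_succ]; congr 1; omega
          rw [hfac, this, pow_succ]; ring

end explore

/-- Division-free form of `K.choose m / a.choose m ≤ (K / (a - m)) ^ m`, the price of passing from a
fixed `m`-set to an arbitrary closed set of size `a`. -/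
theorem choose_mul_pow_le (K a m : ℕ) (hm : m ≤ a) :
    K.choose m * (a - m) ^ m ≤ K ^ m * a.choose m := by
  have h1 : K.choose m * m.factorial ≤ K ^ m := by
    rw [mul_comm, ← Nat.descFactorial_eq_factorial_mul_choose]
    exact Nat.descFactorial_le_pow K m
  have h2 : (a - m) ^ m ≤ m.factorial * a.choose m := by
    rw [← Nat.descFactorial_eq_factorial_mul_choose]
    exact (Nat.pow_le_pow_left (by omega) m).trans (Nat.pow_sub_le_descFactorial a m)
  calc K.choose m * (a - m) ^ m ≤ K.choose m * (m.factorial * a.choose m) :=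
        Nat.mul_le_mul_left _ h2
    _ = (K.choose m * m.factorial) * a.choose m := by ring
    _ ≤ _ := Nat.mul_le_mul_right _ h1

open Classical in
/-- A large set of items that peeling does not reach is unlikely. -/
theorem card_large_closed_le {E I : Type*} [Fintype E] [DecidableEq E] [Fintype I]
    [DecidableEq I] {item : E → I} {T₁ T₂ : Finset E} {τ : E → E} {ℓ B : ℕ} {t μ ζ : ℝ}
    (ht0 : 0 < t) (ht1 : t ≤ 1) (hμ0 : 0 ≤ μ)
    (hℓ : ∀ i, (Finset.univ.filter fun e => item e = i).card = ℓ) (hℓ1 : 1 ≤ ℓ)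
    (hdisj : Disjoint T₁ T₂) (hτinj : Set.InjOn τ T₂) (hτne : ∀ x ∈ T₂, τ x ≠ x)
    (h1 : (Fintype.card E : ℝ) - T₁.card ≤ μ * (Fintype.card E - B))
    (h2 : (Fintype.card E : ℝ) - T₁.card - T₂.card + B + T₂.card * (t ^ (ℓ - 1) + ζ)
      ≤ t * (Fintype.card E - B))
    (h3 : (ℓ : ℝ) * B ≤ ζ * t * (Fintype.card E - B - 1)) (hζ : 0 ≤ ζ)
    (hB : B + 1 < Fintype.card E) {a m s : ℕ} (hcap : ℓ * m + (ℓ + 2) * s ≤ B) (hma : m < a) :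
    ((Finset.univ.filter fun σ : Equiv.Perm E =>
        ∃ Z : Finset I, PeelClosed item T₁ T₂ τ σ Z ∧ a ≤ Z.card).card : ℝ)
      ≤ (Fintype.card E).factorial *
        (((Fintype.card I : ℝ) / (a - m)) ^ m * (t ^ (ℓ * m) + μ ^ s)) := by
  set bad := Finset.univ.filter fun σ : Equiv.Perm E =>
        ∃ Z : Finset I, PeelClosed item T₁ T₂ τ σ Z ∧ a ≤ Z.card with hbad
  have hW : ∀ W ∈ Finset.powersetCard m (Finset.univ : Finset I),
      ((Finset.univ.filter fun σ : Equiv.Perm E =>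
        ∃ Z : Finset I, PeelClosed item T₁ T₂ τ σ Z ∧ W ⊆ Z).card : ℝ)
      ≤ (Fintype.card E).factorial * (t ^ (ℓ * m) + μ ^ s) := by
    intro W hW
    -- The exploration starts with nothing exposed and all `ℓ * m` sockets of `W` pending.
    set A := Finset.univ.filter fun e => item e ∈ W with hA
    have hAc : A.card = ℓ * m := by
      have hmaps : Set.MapsTo item A W := fun e he => (Finset.mem_filter.1 he).2
      rw [Finset.card_eq_sum_card_fiberwise hmaps, ← (Finset.mem_powersetCard.1 hW).2, mul_comm,
        ← smul_eq_mul, ← Finset.sum_const]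
      refine Finset.sum_congr rfl fun i hi => ?_
      rw [← hℓ i]
      congr 1
      ext e
      simp only [hA, Finset.mem_filter, Finset.mem_univ, true_and, and_iff_right_iff_imp]
      rintro rfl
      exact hi
    have := card_unmarked_le ht0 ht1 hμ0 hℓ hℓ1 hdisj hτinj hτne h1 h2 h3 hζ hB s ∅ 1 A
      (Finset.disjoint_empty_right _) (by rw [hAc, Finset.card_empty]; omega)
    rw [Finset.card_empty, Nat.sub_zero, hAc] at this
    refine le_trans ?_ this
    have hsub : (Finset.univ.filter fun σ : Equiv.Perm E =>
        ∃ Z : Finset I, PeelClosed item T₁ T₂ τ σ Z ∧ W ⊆ Z)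
        ⊆ unmarked item T₁ T₂ τ ∅ 1 A := by
      intro σ hσ
      obtain ⟨Z, hZ, hWZ⟩ := (Finset.mem_filter.1 hσ).2
      exact mem_unmarked.2 ⟨fun x hx => absurd hx (Finset.notMem_empty x), Z, hZ,
        fun e he => hWZ (Finset.mem_filter.1 he).2⟩
    exact_mod_cast Finset.card_le_card hsub
  -- Double counting of pairs `(σ, W)`: a closed set with at least `a` items contains at least
  -- `a.choose m` sets `W`.
  have hcount : bad.card * a.choose m
      ≤ ∑ W ∈ Finset.powersetCard m (Finset.univ : Finset I),
        (Finset.univ.filter fun σ : Equiv.Perm E =>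
          ∃ Z : Finset I, PeelClosed item T₁ T₂ τ σ Z ∧ W ⊆ Z).card := by
    simp only [Finset.card_filter]
    rw [Finset.sum_comm, ← smul_eq_mul, ← Finset.sum_const]
    refine le_trans (Finset.sum_le_sum fun σ hσ => ?_)
      (Finset.sum_le_sum_of_subset (Finset.subset_univ bad))
    obtain ⟨Z, hZ, haZ⟩ := (Finset.mem_filter.1 hσ).2
    rw [← Finset.card_filter]
    calc a.choose m ≤ Z.card.choose m := Nat.choose_le_choose m haZ
      _ = (Finset.powersetCard m Z).card := (Finset.card_powersetCard m Z).symm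
      _ ≤ _ := by
        refine Finset.card_le_card fun W hW => ?_
        obtain ⟨hW1, hW2⟩ := Finset.mem_powersetCard.1 hW
        exact Finset.mem_filter.2 ⟨Finset.mem_powersetCard.2 ⟨Finset.subset_univ _, hW2⟩,
          Z, hZ, hW1⟩
  set D : ℝ := (Fintype.card E).factorial * (t ^ (ℓ * m) + μ ^ s) with hD
  have hD0 : 0 ≤ D := by positivity
  have hcount' : (bad.card : ℝ) * a.choose m ≤ (Fintype.card I).choose m * D := by
    calc (bad.card : ℝ) * a.choose m
        ≤ ∑ W ∈ Finset.powersetCard m (Finset.univ : Finset I),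
          ((Finset.univ.filter fun σ : Equiv.Perm E =>
            ∃ Z : Finset I, PeelClosed item T₁ T₂ τ σ Z ∧ W ⊆ Z).card : ℝ) := by
          exact_mod_cast hcount
      _ ≤ ∑ W ∈ Finset.powersetCard m (Finset.univ : Finset I), D := Finset.sum_le_sum hW
      _ = _ := by rw [Finset.sum_const, Finset.card_powersetCard, nsmul_eq_mul, Finset.card_univ]
  have hch : ((Fintype.card I).choose m : ℝ) * ((a : ℝ) - m) ^ m
      ≤ (Fintype.card I : ℝ) ^ m * a.choose m := by
    rw [← Nat.cast_sub hma.le]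
    exact_mod_cast choose_mul_pow_le (Fintype.card I) a m hma.le
  have hpos : (0 : ℝ) < a.choose m := by exact_mod_cast Nat.choose_pos hma.le
  have hpos2 : (0 : ℝ) < ((a : ℝ) - m) ^ m := by
    have : (m : ℝ) < a := by exact_mod_cast hma
    exact pow_pos (by linarith) _
  have e : ((Fintype.card E).factorial : ℝ) *
        (((Fintype.card I : ℝ) / (a - m)) ^ m * (t ^ (ℓ * m) + μ ^ s))
      = (Fintype.card I : ℝ) ^ m / ((a : ℝ) - m) ^ m * D := by
    rw [hD, div_pow]; ring
  rw [e, div_mul_eq_mul_div, le_div_iff₀ hpos2]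
  refine le_of_mul_le_mul_right ?_ hpos
  calc (bad.card : ℝ) * ((a : ℝ) - m) ^ m * a.choose m
      = (bad.card : ℝ) * a.choose m * ((a : ℝ) - m) ^ m := by ring
    _ ≤ (Fintype.card I).choose m * D * ((a : ℝ) - m) ^ m :=
        mul_le_mul_of_nonneg_right hcount' hpos2.le
    _ = (Fintype.card I).choose m * ((a : ℝ) - m) ^ m * D := by ring
    _ ≤ (Fintype.card I : ℝ) ^ m * a.choose m * D := mul_le_mul_of_nonneg_right hch hD0
    _ = _ := by ring

/-! ### Binomial probabilities and occupancy counts -/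

/-- The binomial probability mass function. -/
noncomputable def binomProb (n : ℕ) (θ : ℝ) (j : ℕ) : ℝ :=
  n.choose j * θ ^ j * (1 - θ) ^ (n - j)

theorem binomProb_nonneg {n : ℕ} {θ : ℝ} (h0 : 0 ≤ θ) (h1 : θ ≤ 1) (j : ℕ) :
    0 ≤ binomProb n θ j := by
  have : 0 ≤ 1 - θ := by linarith
  unfold binomProb; positivity

theorem sum_binomProb (n : ℕ) (θ : ℝ) : ∑ j ∈ Finset.range (n + 1), binomProb n θ j = 1 := by
  have := congrArg (Polynomial.eval θ) (bernsteinPolynomial.sum ℝ n)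
  simpa [Polynomial.eval_finsetSum, bernsteinPolynomial, binomProb] using this

theorem sum_mul_binomProb (n : ℕ) (θ : ℝ) :
    ∑ j ∈ Finset.range (n + 1), j * binomProb n θ j = n * θ := by
  have := congrArg (Polynomial.eval θ) (bernsteinPolynomial.sum_smul ℝ n)
  simpa [Polynomial.eval_finsetSum, bernsteinPolynomial, binomProb] using this

theorem binomProb_succ {n j : ℕ} (θ : ℝ) (hj : j < n) :
    binomProb n θ (j + 1) * ((j + 1) * (1 - θ)) = binomProb n θ j * ((n - j) * θ) := by
  have h1 : (n.choose (j + 1) : ℝ) * (j + 1) = n.choose j * (n - j) := by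
    rw [← Nat.cast_sub hj.le]
    exact_mod_cast Nat.choose_succ_right_eq n j
  have h2 : n - j = n - (j + 1) + 1 := by omega
  rw [binomProb, binomProb, h2, pow_succ, pow_succ]
  linear_combination (θ ^ j * θ * (1 - θ) ^ (n - (j + 1)) * (1 - θ)) * h1

/-- The mean is a mode, if it is an integer. -/
theorem binomProb_le_mode {n k : ℕ} (hk : k < n) {j : ℕ} (hj : j ≤ n) :
    binomProb n (k / n) j ≤ binomProb n (k / n) k := by
  have hn : (0 : ℝ) < n := by exact_mod_cast (by omega : 0 < n)
  set θ : ℝ := k / n with hθ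
  have hθn : n * θ = k := by rw [hθ]; field_simp
  have hθ0 : 0 ≤ θ := by positivity
  have hθ1 : θ < 1 := by rw [hθ, div_lt_one hn]; exact_mod_cast hk
  rcases le_total j k with hjk | hjk
  · have hstep : ∀ i, i < k → binomProb n θ i ≤ binomProb n θ (i + 1) := by
      intro i hi
      have hi' : (i : ℝ) + 1 ≤ k := by exact_mod_cast hi
      have hkn : (k : ℝ) < n := by exact_mod_cast hk
      have hθpos : 0 < θ := by
        rw [hθ]; refine div_pos ?_ hn; exact_mod_cast (by omega : 0 < k)
      have hc : ((i : ℝ) + 1) * (1 - θ) ≤ (n - i) * θ := by nlinarith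
      have hp : 0 < ((n : ℝ) - i) * θ := mul_pos (by linarith) hθpos
      refine le_of_mul_le_mul_right ?_ hp
      rw [← binomProb_succ θ (by omega)]
      exact mul_le_mul_of_nonneg_left hc (binomProb_nonneg hθ0 hθ1.le _)
    induction hd : k - j generalizing j with
    | zero => rw [show j = k by omega]
    | succ d ih => exact (hstep j (by omega)).trans (ih (by omega) (by omega) (by omega))
  · have hstep : ∀ i, k ≤ i → i < n → binomProb n θ (i + 1) ≤ binomProb n θ i := by
      intro i hi hin
      have hi' : (k : ℝ) ≤ i := by exact_mod_cast hi
      have hc : ((n : ℝ) - i) * θ ≤ (i + 1) * (1 - θ) := by nlinarith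
      have hp : 0 < ((i : ℝ) + 1) * (1 - θ) := mul_pos (by positivity) (by linarith)
      refine le_of_mul_le_mul_right ?_ hp
      rw [binomProb_succ θ hin]
      exact mul_le_mul_of_nonneg_left hc (binomProb_nonneg hθ0 hθ1.le _)
    induction j, hjk using Nat.le_induction with
    | base => exact le_rfl
    | succ i hi ih => exact (hstep i hi (by omega)).trans (ih (by omega))

/-- By Markov's inequality the `2 k + 1` values up to `2 k` carry at least the mass `(k + 1) / (2 k
+ 1)`, and none of them exceeds the mode `k`. The bound is free of `n`, which matters because `n`
will be the number `N ℓ` of all sockets and `k` only that of the defective ones. -/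
theorem one_div_le_binomProb {n k : ℕ} (hk : k ≤ n) (hn : 0 < n) :
    1 / (4 * (k : ℝ) + 2) ≤ binomProb n (k / n) k := by
  have hn' : (0 : ℝ) < n := by exact_mod_cast hn
  rcases hk.lt_or_eq with hk | rfl
  · set θ : ℝ := k / n with hθ
    have hθn : n * θ = k := by rw [hθ]; field_simp
    have hθ0 : 0 ≤ θ := by positivity
    have hθ1 : θ ≤ 1 := by rw [hθ, div_le_one hn']; exact_mod_cast hk.le
    have hak := binomProb_nonneg (n := n) hθ0 hθ1 k
    have hpt : ∀ j ∈ Finset.range (n + 1), (2 * (k : ℝ) + 1) * binomProb n θ j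
        ≤ (2 * k + 1) * (if j ∈ Finset.range (2 * k + 1) then binomProb n θ k else 0)
          + j * binomProb n θ j := by
      intro j hj
      have hj' : j ≤ n := by simpa [Nat.lt_succ_iff] using hj
      have haj := binomProb_nonneg (n := n) hθ0 hθ1 j
      split_ifs with h
      · have h1 := mul_le_mul_of_nonneg_left (binomProb_le_mode hk hj')
          (show (0 : ℝ) ≤ 2 * k + 1 by positivity)
        rw [← hθ] at h1
        have h2 : 0 ≤ (j : ℝ) * binomProb n θ j := by positivity
        linarith
      · rw [mul_zero, zero_add]
        refine mul_le_mul_of_nonneg_right ?_ haj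
        rw [Finset.mem_range, not_lt] at h
        exact_mod_cast h
    have hsum := Finset.sum_le_sum hpt
    rw [← Finset.mul_sum, sum_binomProb, Finset.sum_add_distrib, sum_mul_binomProb, hθn,
      ← Finset.mul_sum] at hsum
    have h3 : ∑ j ∈ Finset.range (n + 1),
        (if j ∈ Finset.range (2 * k + 1) then binomProb n θ k else 0)
        ≤ (2 * k + 1) * binomProb n θ k := by
      rw [Finset.sum_ite_mem, Finset.sum_const, nsmul_eq_mul]
      refine mul_le_mul_of_nonneg_right ?_ hak
      have : (Finset.range (n + 1) ∩ Finset.range (2 * k + 1)).card ≤ 2 * k + 1 :=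
        (Finset.card_le_card Finset.inter_subset_right).trans (by simp)
      exact_mod_cast this
    have h4 := mul_le_mul_of_nonneg_left h3 (show (0 : ℝ) ≤ 2 * k + 1 by positivity)
    rw [div_le_iff₀ (by positivity)]
    have hk0 : (0 : ℝ) ≤ k := by positivity
    nlinarith
  · rw [binomProb, div_self hn'.ne', div_le_iff₀ (by positivity)]
    simp only [Nat.choose_self, Nat.cast_one, one_pow, mul_one, sub_self, tsub_self, pow_zero,
      one_mul]
    linarith

/-- Number of ones of a bit pattern. -/
def ones {ι : Type*} [Fintype ι] (w : ι → Bool) : ℕ := (Finset.univ.filter fun i => w i = true).card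

section ones
variable {ι : Type*} [Fintype ι] [DecidableEq ι]

omit [DecidableEq ι] in
theorem noiseWeight_eq_pow (θ : ℝ) (w : ι → Bool) :
    noiseWeight θ w = θ ^ ones w * (1 - θ) ^ (Fintype.card ι - ones w) := by
  rw [noiseWeight, Finset.prod_ite, Finset.prod_const, Finset.prod_const, ones]
  congr 2
  have := Finset.card_filter_add_card_filter_not (s := (Finset.univ : Finset ι))
    (fun i => w i = true)
  rw [Finset.card_univ] at this
  omega

theorem card_ones_eq (k : ℕ) :
    (Finset.univ.filter fun w : ι → Bool => ones w = k).card = (Fintype.card ι).choose k := by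
  rw [← Finset.card_univ (α := ι), ← Finset.card_powersetCard]
  refine Finset.card_bij (fun w _ => Finset.univ.filter fun i => w i = true) ?_ ?_ ?_
  · intro w hw
    exact Finset.mem_powersetCard.2 ⟨Finset.subset_univ _, (Finset.mem_filter.1 hw).2⟩
  · intro w _ w' _ h
    funext i
    have := Finset.ext_iff.1 h i
    simp only [Finset.mem_filter, Finset.mem_univ, true_and] at this
    exact Bool.eq_iff_iff.2 this
  · intro T hT
    have e : (Finset.univ.filter fun i => decide (i ∈ T) = true) = T := by ext; simp
    refine ⟨fun i => decide (i ∈ T), ?_, e⟩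
    rw [Finset.mem_filter, ones, e]
    exact ⟨Finset.mem_univ _, (Finset.mem_powersetCard.1 hT).2⟩

/-- The conditional law given the number of ones costs at most a polynomial factor. -/
theorem sum_ones_eq_le {k : ℕ} (hk : k ≤ Fintype.card ι) (hι : 0 < Fintype.card ι)
    {f : (ι → Bool) → ℝ} (hf : ∀ w, 0 ≤ f w) :
    ∑ w ∈ Finset.univ.filter (fun w : ι → Bool => ones w = k), f w
      ≤ (Fintype.card ι).choose k *
        ((4 * k + 2) * noiseExp ((k : ℝ) / Fintype.card ι) f) := by
  set n := Fintype.card ι with hn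
  have hn' : (0 : ℝ) < n := by exact_mod_cast hι
  set θ : ℝ := (k : ℝ) / n with hθ
  have hθ0 : 0 ≤ θ := by positivity
  have hθ1 : θ ≤ 1 := by rw [hθ, div_le_one hn']; exact_mod_cast hk
  have h1 : θ ^ k * (1 - θ) ^ (n - k) *
      ∑ w ∈ Finset.univ.filter (fun w : ι → Bool => ones w = k), f w ≤ noiseExp θ f := by
    rw [noiseExp, Finset.mul_sum]
    calc _ = ∑ w ∈ Finset.univ.filter (fun w : ι → Bool => ones w = k), noiseWeight θ w * f w := by
          refine Finset.sum_congr rfl fun w hw => ?_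
          rw [noiseWeight_eq_pow, (Finset.mem_filter.1 hw).2]
      _ ≤ _ := Finset.sum_le_sum_of_subset_of_nonneg (Finset.filter_subset _ _)
          fun w _ _ => mul_nonneg (noiseWeight_nonneg hθ0 hθ1 w) (hf w)
  have h2 := one_div_le_binomProb hk hι
  rw [← hθ, binomProb, div_le_iff₀ (by positivity)] at h2
  set D := ∑ w ∈ Finset.univ.filter (fun w : ι → Bool => ones w = k), f w with hD
  have hD0 : 0 ≤ D := Finset.sum_nonneg fun w _ => hf w
  calc D = 1 * D := (one_mul D).symm
    _ ≤ (n.choose k * θ ^ k * (1 - θ) ^ (n - k) * (4 * k + 2)) * D :=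
        mul_le_mul_of_nonneg_right h2 hD0
    _ = n.choose k * ((4 * k + 2) * (θ ^ k * (1 - θ) ^ (n - k) * D)) := by ring
    _ ≤ _ := by gcongr

theorem noiseExp_ones_eq (θ : ℝ) (i : ℕ) :
    noiseExp θ (fun w : ι → Bool => if ones w = i then (1 : ℝ) else 0)
      = binomProb (Fintype.card ι) θ i := by
  rw [noiseExp]
  simp only [mul_ite, mul_one, mul_zero]
  rw [← Finset.sum_filter]
  calc _ = ∑ w ∈ Finset.univ.filter (fun w : ι → Bool => ones w = i),
        θ ^ i * (1 - θ) ^ (Fintype.card ι - i) := by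
        refine Finset.sum_congr rfl fun w hw => ?_
        rw [noiseWeight_eq_pow, (Finset.mem_filter.1 hw).2]
    _ = _ := by rw [Finset.sum_const, card_ones_eq, nsmul_eq_mul, binomProb, mul_assoc]

end ones

open Classical in
/-- Lower tail of the number of blocks with exactly `i` ones. -/
theorem noiseExp_occupancy_le {α β : Type*} [Fintype α] [DecidableEq α] [Fintype β]
    [DecidableEq β] {θ η : ℝ} (h0 : 0 ≤ θ) (h1 : θ ≤ 1) (hη0 : 0 ≤ η) (hη1 : η ≤ 1) (i : ℕ) :
    noiseExp θ (fun w : α × β → Bool =>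
      if ((Finset.univ.filter fun a => ones (fun b => w (a, b)) = i).card : ℝ)
        ≤ (1 - η) * (Fintype.card α * binomProb (Fintype.card β) θ i) then (1 : ℝ) else 0)
      ≤ Real.exp (-(η ^ 2 / 2 * (Fintype.card α * binomProb (Fintype.card β) θ i))) := by
  set P := binomProb (Fintype.card β) θ i with hP
  have hP0 : 0 ≤ P := binomProb_nonneg h0 h1 i
  set u : (β → Bool) → ℝ := fun v => if ones v = i then Real.exp (-η) else 1 with hu
  -- Chernoff's method with parameter `η` itself instead of the optimal one; together with `exp (-η)
  -- ≤ 1 - η + η ^ 2 / 2` it already gives the exponent `η ^ 2 / 2`.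
  have hpt : ∀ w : α × β → Bool,
      (if ((Finset.univ.filter fun a => ones (fun b => w (a, b)) = i).card : ℝ)
        ≤ (1 - η) * (Fintype.card α * P) then (1 : ℝ) else 0)
      ≤ ∏ a, (Real.exp (η * (1 - η) * P) * u (fun b => w (a, b))) := by
    intro w
    have e : ∏ a, (Real.exp (η * (1 - η) * P) * u (fun b => w (a, b)))
        = Real.exp (η * ((1 - η) * (Fintype.card α * P)
          - ((Finset.univ.filter fun a => ones (fun b => w (a, b)) = i).card : ℝ))) := by
      rw [Finset.prod_mul_distrib, Finset.prod_const, Finset.card_univ, ← Real.exp_nat_mul]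
      simp only [hu]
      rw [Finset.prod_ite, Finset.prod_const, Finset.prod_const, one_pow, mul_one,
        ← Real.exp_nat_mul, ← Real.exp_add]
      congr 1; ring
    rw [e]
    split_ifs with h
    · exact Real.one_le_exp (mul_nonneg hη0 (by linarith))
    · exact (Real.exp_pos _).le
  refine (noiseExp_mono h0 h1 hpt).trans ?_
  rw [noiseExp_block (fun _ v => Real.exp (η * (1 - η) * P) * u v), Finset.prod_const,
    Finset.card_univ]
  have hu1 : ∀ v : β → Bool, u v = 1 + -(1 - Real.exp (-η)) * if ones v = i then 1 else 0 := by
    intro v; simp only [hu]; split_ifs <;> ring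
  have hE : noiseExp θ (fun v : β → Bool => Real.exp (η * (1 - η) * P) * u v)
      = Real.exp (η * (1 - η) * P) * (1 - (1 - Real.exp (-η)) * P) := by
    simp only [hu1]
    have := noiseExp_ones_eq (ι := β) θ i
    rw [← hP] at this
    have h2 := sum_noiseWeight (ι := β) θ
    rw [noiseExp] at this ⊢
    calc _ = Real.exp (η * (1 - η) * P) * (∑ w : β → Bool, noiseWeight θ w
          + -(1 - Real.exp (-η)) *
            ∑ w : β → Bool, noiseWeight θ w * if ones w = i then (1 : ℝ) else 0) := by
          rw [Finset.mul_sum, ← Finset.sum_add_distrib, Finset.mul_sum]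
          exact Finset.sum_congr rfl fun w _ => by ring
      _ = _ := by rw [this, h2]; ring
  rw [hE]
  have hexp : Real.exp (-η) ≤ 1 - η + η ^ 2 / 2 := by
    have h3 := Real.quadratic_le_exp_of_nonneg hη0
    rw [Real.exp_neg, inv_le_comm₀ (Real.exp_pos _) (by nlinarith)]
    refine le_trans ?_ h3
    rw [inv_le_iff_one_le_mul₀ (by nlinarith)]
    nlinarith [sq_nonneg (η ^ 2)]
  have hbase : Real.exp (η * (1 - η) * P) * (1 - (1 - Real.exp (-η)) * P)
      ≤ Real.exp (-(η ^ 2 / 2 * P)) := by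
    calc _ ≤ Real.exp (η * (1 - η) * P) * Real.exp (-((1 - Real.exp (-η)) * P)) := by
          gcongr
          have := Real.add_one_le_exp (-((1 - Real.exp (-η)) * P))
          linarith
      _ = Real.exp (η * (1 - η) * P + -((1 - Real.exp (-η)) * P)) := (Real.exp_add _ _).symm
      _ ≤ _ := by
          apply Real.exp_le_exp.2
          nlinarith
  -- Needed only for a non-negative base when the bound for one block is raised to a power.
  have hP1 : P ≤ 1 := by
    rw [hP]
    by_cases hi : i ∈ Finset.range (Fintype.card β + 1)
    · rw [← sum_binomProb (Fintype.card β) θ]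
      exact Finset.single_le_sum (fun j _ => binomProb_nonneg h0 h1 j) hi
    · rw [Finset.mem_range, not_lt] at hi
      rw [binomProb, Nat.choose_eq_zero_of_lt (by omega)]
      norm_num
  have hpos : 0 ≤ Real.exp (η * (1 - η) * P) * (1 - (1 - Real.exp (-η)) * P) := by
    refine mul_nonneg (Real.exp_pos _).le ?_
    have h4 : 0 < Real.exp (-η) := Real.exp_pos _
    have h5 : Real.exp (-η) ≤ 1 := Real.exp_le_one_iff.2 (by linarith)
    nlinarith
  refine (pow_le_pow_left₀ hpos hbase _).trans (le_of_eq ?_)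
  rw [← Real.exp_nat_mul]
  congr 1; ring

open Classical in
/-- Upper tail of the number of ones in any of the blocks. -/
theorem noiseExp_max_occupancy_le {α β : Type*} [Fintype α] [DecidableEq α] [Fintype β]
    [DecidableEq β] {θ h : ℝ} (h0 : 0 ≤ θ) (h1 : θ ≤ 1) :
    noiseExp θ (fun w : α × β → Bool =>
      if ∃ a, h ≤ (ones (fun b => w (a, b)) : ℝ) then (1 : ℝ) else 0)
      ≤ Fintype.card α * Real.exp (8 * (Fintype.card β * θ) - 2 * h) := by
  have hpt : ∀ w : α × β → Bool,
      (if ∃ a, h ≤ (ones (fun b => w (a, b)) : ℝ) then (1 : ℝ) else 0)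
      ≤ ∑ a : α, Real.exp (-2 * h) * ∏ b, (if w (a, b) then Real.exp 2 else 1) := by
    intro w
    split_ifs with H
    · obtain ⟨a, ha⟩ := H
      refine le_trans ?_ (Finset.single_le_sum (fun a _ => ?_) (Finset.mem_univ a))
      · rw [Finset.prod_ite, Finset.prod_const, Finset.prod_const, one_pow, mul_one,
          ← Real.exp_nat_mul, ← Real.exp_add]
        refine Real.one_le_exp ?_
        rw [ones] at ha
        linarith
      · exact mul_nonneg (Real.exp_pos _).le
          (Finset.prod_nonneg fun b _ => by split_ifs <;> positivity)
    · exact Finset.sum_nonneg fun a _ => mul_nonneg (Real.exp_pos _).le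
          (Finset.prod_nonneg fun b _ => by split_ifs <;> positivity)
  refine (noiseExp_mono h0 h1 hpt).trans ?_
  rw [noiseExp_sum]
  have hE : ∀ a : α, noiseExp θ (fun w : α × β → Bool =>
      Real.exp (-2 * h) * ∏ b, (if w (a, b) then Real.exp 2 else 1))
      = Real.exp (-2 * h) * (θ * Real.exp 2 + (1 - θ)) ^ Fintype.card β := by
    intro a
    have hinj : Function.Injective (fun b : β => (a, b)) := fun b b' h => (Prod.ext_iff.1 h).2
    rw [noiseExp_comp_injective hinj
      (fun v : β → Bool => Real.exp (-2 * h) * ∏ b, (if v b then Real.exp 2 else 1))]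
    have : noiseExp θ (fun v : β → Bool => Real.exp (-2 * h) * ∏ b, (if v b then Real.exp 2 else 1))
        = Real.exp (-2 * h) * noiseExp θ (fun v : β → Bool => ∏ b, (if v b then Real.exp 2 else 1)) := by
      simp only [noiseExp, Finset.mul_sum]
      exact Finset.sum_congr rfl fun w _ => by ring
    rw [this, noiseExp_prod (fun _ x => if x then Real.exp 2 else 1)]
    simp
  simp only [hE]
  rw [Finset.sum_const, nsmul_eq_mul, Finset.card_univ]
  refine mul_le_mul_of_nonneg_left ?_ (by positivity)
  -- The constant `8` of the statement bounds `exp 2 - 1`, for an exponential moment with parameter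
  -- `2`.
  have he2 : Real.exp 2 ≤ 9 := by
    have h3 := Real.exp_one_lt_d9
    have : Real.exp 2 = Real.exp 1 * Real.exp 1 := by rw [← Real.exp_add]; norm_num
    rw [this]
    nlinarith [Real.exp_pos 1]
  have hb : θ * Real.exp 2 + (1 - θ) ≤ Real.exp (8 * θ) := by
    have := Real.add_one_le_exp (8 * θ)
    nlinarith
  calc _ ≤ Real.exp (-2 * h) * Real.exp (8 * θ) ^ Fintype.card β := by
        gcongr
    _ = _ := by
        rw [← Real.exp_nat_mul, ← Real.exp_add]
        congr 1; ring

/-! ### Random graphs -/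

section graph
variable {N ℓ M r : ℕ}

/-- The bin sockets that are paired with sockets of defective items. -/
def occ (S : Finset (Fin N)) (G : Graph N ℓ M r) : Fin M × Fin r → Bool :=
  fun s => decide ((G.symm s).1 ∈ S)

theorem mem_nbrs {G : Graph N ℓ M r} {b : Fin M} {v : Fin N} :
    v ∈ nbrs G b ↔ ∃ a, (G (v, a)).1 = b := by
  simp only [nbrs, Finset.mem_image, Finset.mem_univ, true_and]
  constructor
  · rintro ⟨s, rfl⟩
    exact ⟨(G.symm (b, s)).2, by simp⟩
  · rintro ⟨a, rfl⟩
    exact ⟨(G (v, a)).2, by simp⟩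

theorem ones_occ (S : Finset (Fin N)) (G : Graph N ℓ M r) : ones (occ S G) = S.card * ℓ := by
  have : (S ×ˢ (Finset.univ : Finset (Fin ℓ))).card = S.card * ℓ := by simp
  rw [ones, ← this]
  refine Finset.card_bij (fun s _ => G.symm s) ?_ ?_ ?_
  · intro s hs
    simpa [occ] using hs
  · intro s _ s' _ h
    exact G.symm.injective h
  · intro e he
    refine ⟨G e, ?_, by simp⟩
    simpa [occ] using he

theorem exists_perm_comp {ι : Type*} [Fintype ι] {w w' : ι → Bool} (h : ones w = ones w') :
    ∃ ρ : Equiv.Perm ι, ∀ i, w' (ρ i) = w i := by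
  have hc : Fintype.card {i // w i = true} = Fintype.card {i // w' i = true} := by
    rw [Fintype.card_subtype, Fintype.card_subtype]; exact h
  let e := Fintype.equivOfCardEq hc
  refine ⟨e.extendSubtype, fun i => ?_⟩
  cases hi : w i
  · have := e.extendSubtype_not_mem i (by simp [hi])
    simpa using this
  · exact e.extendSubtype_mem i hi

/-- The set of occupied bin sockets is uniformly distributed. -/
theorem sum_graph_occ (S : Finset (Fin N)) (f : (Fin M × Fin r → Bool) → ℝ) :
    ((M * r).choose (S.card * ℓ) : ℝ) * ∑ G : Graph N ℓ M r, f (occ S G)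
      = Fintype.card (Graph N ℓ M r) *
        ∑ w ∈ Finset.univ.filter (fun w => ones w = S.card * ℓ), f w := by
  set c : (Fin M × Fin r → Bool) → ℕ := fun w =>
    (Finset.univ.filter fun G : Graph N ℓ M r => occ S G = w).card with hc
  -- A permutation of the bin sockets that carries `w` to `w'` maps one fibre of `occ S` bijectively
  -- onto the other.
  have hcongr : ∀ w w', ones w = ones w' → c w = c w' := by
    intro w w' h
    obtain ⟨ρ, hρ⟩ := exists_perm_comp h
    refine Finset.card_bij (fun G _ => G.trans ρ) ?_ ?_ ?_
    · intro G hG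
      rw [Finset.mem_filter] at hG ⊢
      refine ⟨Finset.mem_univ _, funext fun s => ?_⟩
      have h2 := hρ (ρ.symm s)
      rw [Equiv.apply_symm_apply, ← hG.2] at h2
      rw [h2]; rfl
    · intro G _ G' _ h
      ext x : 1
      exact ρ.injective (Equiv.congr_fun h x)
    · intro G hG
      refine ⟨G.trans ρ.symm, ?_, by ext x : 1; simp⟩
      rw [Finset.mem_filter] at hG ⊢
      refine ⟨Finset.mem_univ _, funext fun s => ?_⟩
      rw [← hρ s, ← hG.2]; rfl
  have hfib : ∀ g : (Fin M × Fin r → Bool) → ℝ, ∑ G : Graph N ℓ M r, g (occ S G)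
      = ∑ w ∈ Finset.univ.filter (fun w => ones w = S.card * ℓ), (c w : ℝ) * g w := by
    intro g
    rw [← Finset.sum_fiberwise_of_maps_to (g := fun G : Graph N ℓ M r => occ S G)
      (t := Finset.univ.filter (fun w => ones w = S.card * ℓ))
      (fun G _ => Finset.mem_filter.2 ⟨Finset.mem_univ _, ones_occ S G⟩)]
    refine Finset.sum_congr rfl fun w _ => ?_
    rw [hc, ← nsmul_eq_mul, ← Finset.sum_const]
    refine Finset.sum_congr rfl fun G hG => ?_
    rw [(Finset.mem_filter.1 hG).2]
  by_cases hne : (Finset.univ.filter (fun w : Fin M × Fin r → Bool => ones w = S.card * ℓ)).Nonempty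
  · obtain ⟨w₀, hw₀⟩ := hne
    have hc0 : ∀ w ∈ Finset.univ.filter (fun w : Fin M × Fin r → Bool => ones w = S.card * ℓ),
        c w = c w₀ := fun w hw => hcongr _ _
          ((Finset.mem_filter.1 hw).2.trans (Finset.mem_filter.1 hw₀).2.symm)
    have h1 := hfib fun _ => 1
    have h2 := hfib f
    have e1 : ∀ g : (Fin M × Fin r → Bool) → ℝ,
        ∑ w ∈ Finset.univ.filter (fun w => ones w = S.card * ℓ), (c w : ℝ) * g w
        = c w₀ * ∑ w ∈ Finset.univ.filter (fun w => ones w = S.card * ℓ), g w := by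
      intro g
      rw [Finset.mul_sum]
      exact Finset.sum_congr rfl fun w hw => by rw [hc0 w hw]
    rw [e1, Finset.sum_const, Finset.sum_const, card_ones_eq] at h1
    rw [e1] at h2
    simp only [Finset.card_univ, nsmul_eq_mul, mul_one, Fintype.card_prod, Fintype.card_fin] at h1
    rw [h1, h2]; ring
  · have hem : IsEmpty (Graph N ℓ M r) :=
      ⟨fun G => hne ⟨occ S G, Finset.mem_filter.2 ⟨Finset.mem_univ _, ones_occ S G⟩⟩⟩
    rw [Finset.not_nonempty_iff_eq_empty.1 hne]
    simp

/-- The occupied sockets may be treated as independent at the price of a factor linear in `S.card *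
ℓ`, which exponential tails absorb. -/
theorem sum_graph_occ_le (S : Finset (Fin N)) (hMr : M * r = N * ℓ) (hpos : 0 < M * r)
    {f : (Fin M × Fin r → Bool) → ℝ} (hf : ∀ w, 0 ≤ f w) :
    ∑ G : Graph N ℓ M r, f (occ S G)
      ≤ Fintype.card (Graph N ℓ M r) * ((4 * ((S.card * ℓ : ℕ) : ℝ) + 2) *
        noiseExp (((S.card * ℓ : ℕ) : ℝ) / ((M * r : ℕ) : ℝ)) f) := by
  have hk : S.card * ℓ ≤ M * r := by
    rw [hMr]
    refine Nat.mul_le_mul_right ℓ ?_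
    simpa using Finset.card_le_univ S
  have hch : (0 : ℝ) < ((M * r).choose (S.card * ℓ) : ℝ) := by exact_mod_cast Nat.choose_pos hk
  have hcard : Fintype.card (Fin M × Fin r) = M * r := by simp
  have h1 := sum_ones_eq_le (ι := Fin M × Fin r) (k := S.card * ℓ) (by rwa [hcard])
    (by rwa [hcard]) hf
  rw [hcard] at h1
  refine le_of_mul_le_mul_left ?_ hch
  rw [sum_graph_occ]
  calc _ ≤ (Fintype.card (Graph N ℓ M r) : ℝ) * (((M * r).choose (S.card * ℓ) : ℝ) *
        ((4 * ((S.card * ℓ : ℕ) : ℝ) + 2) *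
          noiseExp (((S.card * ℓ : ℕ) : ℝ) / ((M * r : ℕ) : ℝ)) f)) :=
        mul_le_mul_of_nonneg_left h1 (by positivity)
    _ = _ := by ring

/-! ### Stuck sets, and the random permutation of the defective sockets. -/

/-- `Z` is a set of defective items that the error-free peeling decoder cannot enter, if the bins
in `F` are not used. -/
def Stuck (S : Finset (Fin N)) (F : Finset (Fin M)) (G : Graph N ℓ M r) (Z : Finset (Fin N)) :
    Prop :=
  Z ⊆ S ∧ ∀ v ∈ Z, ∀ b ∉ F, v ∈ nbrs G b →
    (nbrs G b).filter (· ∈ S) ≠ {v} ∧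
      ∀ u ∈ S, (nbrs G b).filter (· ∈ S) = {u, v} → u ∈ Z

/-- Sockets of defective items. -/
abbrev DefSocket (S : Finset (Fin N)) (ℓ : ℕ) : Type := {e : Fin N × Fin ℓ // e.1 ∈ S}

/-- The item of a socket. -/
def DefSocket.item {S : Finset (Fin N)} (e : DefSocket S ℓ) : {v // v ∈ S} := ⟨e.1.1, e.2⟩

/-- The sockets of defective items at the bin `b`. -/
def defAt (S : Finset (Fin N)) (G : Graph N ℓ M r) (b : Fin M) : Finset (DefSocket S ℓ) :=
  Finset.univ.filter fun e => (G e.1).1 = b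

theorem card_defAt (S : Finset (Fin N)) (G : Graph N ℓ M r) (b : Fin M) :
    (defAt S G b).card = ones (fun s => occ S G (b, s)) := by
  rw [ones]
  refine Finset.card_bij (fun e _ => (G e.1).2) ?_ ?_ ?_
  · intro e he
    have hb : (G e.1).1 = b := (Finset.mem_filter.1 he).2
    subst hb
    simp [occ, e.2]
  · intro e he e' he' h
    have hb : (G e.1).1 = b := (Finset.mem_filter.1 he).2
    have hb' : (G e'.1).1 = b := (Finset.mem_filter.1 he').2
    exact Subtype.ext (G.injective (Prod.ext (hb.trans hb'.symm) h))
  · intro s hs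
    have : (G.symm (b, s)).1 ∈ S := by simpa [occ] using hs
    exact ⟨⟨G.symm (b, s), this⟩, by simp [defAt], by simp⟩

/-- Sockets of defective items at the bins outside `F` that have exactly `i` such sockets. -/
def defOfDeg (S : Finset (Fin N)) (F : Finset (Fin M)) (G : Graph N ℓ M r) (i : ℕ) :
    Finset (DefSocket S ℓ) :=
  Finset.univ.filter fun e => (G e.1).1 ∉ F ∧ (defAt S G (G e.1).1).card = i

theorem card_defOfDeg_ge (S : Finset (Fin N)) (F : Finset (Fin M)) (G : Graph N ℓ M r) (i : ℕ) :
    (i : ℝ) * (((Finset.univ.filter fun b => ones (fun s => occ S G (b, s)) = i).card : ℝ)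
      - F.card) ≤ (defOfDeg S F G i).card := by
  set Q := Finset.univ.filter fun b => ones (fun s => occ S G (b, s)) = i with hQ
  have h1 : (defOfDeg S F G i).card = ∑ b ∈ Q \ F, i := by
    have hmaps : Set.MapsTo (fun e : DefSocket S ℓ => (G e.1).1) (defOfDeg S F G i)
        (Q \ F : Finset (Fin M)) := by
      intro e he
      have := (Finset.mem_filter.1 he).2
      rw [Finset.coe_sdiff]
      refine ⟨Finset.mem_filter.2 ⟨Finset.mem_univ _, ?_⟩, this.1⟩
      rw [← card_defAt]; exact this.2
    rw [Finset.card_eq_sum_card_fiberwise hmaps]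
    refine Finset.sum_congr rfl fun b hb => ?_
    rw [Finset.mem_sdiff, hQ, Finset.mem_filter, ← card_defAt] at hb
    refine Eq.trans ?_ hb.1.2
    congr 1
    ext e
    constructor
    · exact fun h => Finset.mem_filter.2 ⟨Finset.mem_univ _, (Finset.mem_filter.1 h).2⟩
    · intro h
      have h' : (G e.1).1 = b := (Finset.mem_filter.1 h).2
      refine Finset.mem_filter.2 ⟨Finset.mem_filter.2 ⟨Finset.mem_univ _, ?_⟩, h'⟩
      rw [h']
      exact ⟨hb.2, hb.1.2⟩
  rw [h1, Finset.sum_const, smul_eq_mul, Nat.cast_mul, mul_comm]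
  refine mul_le_mul_of_nonneg_right ?_ (by positivity)
  rw [sub_le_iff_le_add]
  exact_mod_cast (Finset.card_le_card_sdiff_add_card (s := Q) (t := F))

open Classical in
/-- Another socket of a defective item at the same bin, if there is one. -/
noncomputable def partner (S : Finset (Fin N)) (G : Graph N ℓ M r) (x : DefSocket S ℓ) :
    DefSocket S ℓ :=
  if h : ∃ y, y ≠ x ∧ (G y.1).1 = (G x.1).1 then h.choose else x

theorem partner_spec {S : Finset (Fin N)} {F : Finset (Fin M)} {G : Graph N ℓ M r}
    {x : DefSocket S ℓ} (hx : x ∈ defOfDeg S F G 2) :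
    partner S G x ≠ x ∧ defAt S G (G x.1).1 = {x, partner S G x} := by
  have h2 := (Finset.mem_filter.1 hx).2.2
  have hxm : x ∈ defAt S G (G x.1).1 := Finset.mem_filter.2 ⟨Finset.mem_univ _, rfl⟩
  have h : ∃ y, y ≠ x ∧ (G y.1).1 = (G x.1).1 := by
    obtain ⟨y, hy, hyx⟩ := Finset.exists_mem_ne (s := defAt S G (G x.1).1) (by omega) x
    exact ⟨y, hyx, (Finset.mem_filter.1 hy).2⟩
  have hp : partner S G x ≠ x ∧ (G (partner S G x).1).1 = (G x.1).1 := by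
    rw [partner, dif_pos h]; exact h.choose_spec
  refine ⟨hp.1, (Finset.eq_of_subset_of_card_le ?_ ?_).symm⟩
  · intro y hy
    rcases Finset.mem_insert.1 hy with rfl | hy
    · exact hxm
    · rw [Finset.mem_singleton.1 hy]
      exact Finset.mem_filter.2 ⟨Finset.mem_univ _, hp.2⟩
  · rw [h2, Finset.card_pair hp.1.symm]

theorem partner_injOn (S : Finset (Fin N)) (F : Finset (Fin M)) (G : Graph N ℓ M r) :
    Set.InjOn (partner S G) (defOfDeg S F G 2) := by
  intro x hx y hy hxy
  obtain ⟨h1, h2⟩ := partner_spec hx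
  obtain ⟨h3, h4⟩ := partner_spec hy
  have hb : (G x.1).1 = (G y.1).1 := by
    have e1 : partner S G x ∈ defAt S G (G x.1).1 := by rw [h2]; simp
    have e2 : partner S G y ∈ defAt S G (G y.1).1 := by rw [h4]; simp
    rw [← (Finset.mem_filter.1 e1).2, ← (Finset.mem_filter.1 e2).2, hxy]
  have e3 : y ∈ defAt S G (G x.1).1 := by rw [hb, h4]; simp
  rw [h2, Finset.mem_insert, Finset.mem_singleton] at e3
  rcases e3 with e3 | e3
  · exact e3.symm
  · exact absurd (hxy ▸ e3.symm) h3

/-- Permuting the sockets of the defective items. -/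
def permute {S : Finset (Fin N)} (σ : Equiv.Perm (DefSocket S ℓ)) (G : Graph N ℓ M r) :
    Graph N ℓ M r :=
  (Equiv.Perm.ofSubtype σ).trans G

theorem permute_apply {S : Finset (Fin N)} (σ : Equiv.Perm (DefSocket S ℓ)) (G : Graph N ℓ M r)
    (e : DefSocket S ℓ) : permute σ G e.1 = G (σ e).1 := by
  rw [permute, Equiv.trans_apply, Equiv.Perm.ofSubtype_apply_coe]

/-- Permuting the defective sockets does not change how many of them each bin holds. Hence the
degree classes and the partner map can be read off the unpermuted graph, while `σ` remains free to
be uniform. Two sockets of one item at a bin cause no trouble: the partner then belongs to the same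
item. -/
theorem Stuck.peelClosed {S : Finset (Fin N)} {F : Finset (Fin M)} {G : Graph N ℓ M r}
    {σ : Equiv.Perm (DefSocket S ℓ)} {Z : Finset (Fin N)} (h : Stuck S F (permute σ G) Z) :
    PeelClosed DefSocket.item (defOfDeg S F G 1) (defOfDeg S F G 2) (partner S G) σ
      (Z.subtype (· ∈ S)) := by
  intro e he
  have heZ : e.1.1 ∈ Z := Finset.mem_subtype.1 he
  set b := (G (σ e).1).1 with hb
  have hvb : e.1.1 ∈ nbrs (permute σ G) b := by
    rw [mem_nbrs]
    exact ⟨e.1.2, by rw [Prod.mk.eta, permute_apply]⟩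
  have hmem : ∀ u, u ∈ (nbrs (permute σ G) b).filter (· ∈ S) →
      ∃ f : DefSocket S ℓ, f.1.1 = u ∧ σ f ∈ defAt S G b := by
    intro u hu
    obtain ⟨hu1, hu2⟩ := Finset.mem_filter.1 hu
    obtain ⟨a, ha⟩ := mem_nbrs.1 hu1
    refine ⟨⟨(u, a), hu2⟩, rfl, Finset.mem_filter.2 ⟨Finset.mem_univ _, ?_⟩⟩
    rw [← ha, ← permute_apply]
  constructor
  · intro hT
    obtain ⟨hF, hc⟩ := (Finset.mem_filter.1 hT).2
    refine (h.2 _ heZ b hF hvb).1 ?_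
    refine Finset.eq_singleton_iff_unique_mem.2 ⟨Finset.mem_filter.2 ⟨hvb, e.2⟩, fun u hu => ?_⟩
    obtain ⟨f, rfl, hf⟩ := hmem u hu
    have : σ f = σ e := Finset.card_le_one.1 hc.le _ hf _
      (Finset.mem_filter.2 ⟨Finset.mem_univ _, rfl⟩)
    rw [σ.injective this]
  · intro hT
    obtain ⟨hF, _⟩ := (Finset.mem_filter.1 hT).2
    obtain ⟨h1, h2⟩ := partner_spec hT
    set f := σ.symm (partner S G (σ e)) with hf
    have hfu : (partner S G (σ e)) = σ f := by rw [hf, Equiv.apply_symm_apply]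
    refine Finset.mem_subtype.2 ((h.2 _ heZ b hF hvb).2 f.1.1 f.2 ?_)
    ext u
    rw [Finset.mem_insert, Finset.mem_singleton]
    constructor
    · intro hu
      obtain ⟨g, rfl, hg⟩ := hmem u hu
      rw [hb, h2, Finset.mem_insert, Finset.mem_singleton, hfu] at hg
      rcases hg with hg | hg
      · right; rw [σ.injective hg]
      · left; rw [σ.injective hg]
    · rintro (rfl | rfl)
      · refine Finset.mem_filter.2 ⟨mem_nbrs.2 ⟨f.1.2, ?_⟩, f.2⟩
        rw [Prod.mk.eta, permute_apply, ← hfu]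
        have e2 : partner S G (σ e) ∈ defAt S G (G (σ e).1).1 := by rw [h2]; simp
        exact (Finset.mem_filter.1 e2).2
      · exact Finset.mem_filter.2 ⟨hvb, e.2⟩

theorem card_defSocket (S : Finset (Fin N)) (ℓ : ℕ) :
    Fintype.card (DefSocket S ℓ) = S.card * ℓ := by
  rw [Fintype.card_subtype]
  have : (Finset.univ.filter fun e : Fin N × Fin ℓ => e.1 ∈ S) = S ×ˢ Finset.univ := by
    ext e; simp
  rw [this]; simp

theorem card_item_fiber (S : Finset (Fin N)) (ℓ : ℕ) (i : {v // v ∈ S}) :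
    (Finset.univ.filter fun e : DefSocket S ℓ => e.item = i).card = ℓ := by
  have : ℓ = (Finset.univ : Finset (Fin ℓ)).card := by simp
  conv_rhs => rw [this]
  refine Finset.card_bij (fun e _ => e.1.2) (fun _ _ => Finset.mem_univ _) ?_ ?_
  · intro e he e' he' h
    have h1 := (Finset.mem_filter.1 he).2.trans (Finset.mem_filter.1 he').2.symm
    exact Subtype.ext (Prod.ext (Subtype.ext_iff.1 h1) h)
  · intro a _
    exact ⟨⟨(i.1, a), i.2⟩, Finset.mem_filter.2 ⟨Finset.mem_univ _, rfl⟩, rfl⟩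

open Classical in
/-- If the numbers of bins with one and two defective sockets are as expected, then large stuck
sets are unlikely. -/
theorem card_stuck_perm_le {S : Finset (Fin N)} {F : Finset (Fin M)} {G : Graph N ℓ M r}
    {B a m s : ℕ} {t μ ζ D₁ D₂ : ℝ} (ht0 : 0 < t) (ht1 : t ≤ 1) (hμ0 : 0 ≤ μ) (hℓ1 : 1 ≤ ℓ)
    (hD₁ : D₁ ≤ ((Finset.univ.filter fun b => ones (fun s => occ S G (b, s)) = 1).card : ℝ))
    (hD₂ : D₂ ≤ ((Finset.univ.filter fun b => ones (fun s => occ S G (b, s)) = 2).card : ℝ))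
    (h1 : ((S.card * ℓ : ℕ) : ℝ) - (D₁ - F.card) ≤ μ * (((S.card * ℓ : ℕ) : ℝ) - B))
    (h2 : ((S.card * ℓ : ℕ) : ℝ) - (D₁ - F.card) - 2 * (D₂ - F.card) * (1 - t ^ (ℓ - 1) - ζ) + B
      ≤ t * (((S.card * ℓ : ℕ) : ℝ) - B))
    (h3 : (ℓ : ℝ) * B ≤ ζ * t * (((S.card * ℓ : ℕ) : ℝ) - B - 1)) (hζ : 0 ≤ ζ)
    (hζ1 : t ^ (ℓ - 1) + ζ ≤ 1)
    (hB : B + 1 < S.card * ℓ) (hcap : ℓ * m + (ℓ + 2) * s ≤ B) (hma : m < a) :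
    ((Finset.univ.filter fun σ : Equiv.Perm (DefSocket S ℓ) =>
        ∃ Z, Stuck S F (permute σ G) Z ∧ a ≤ Z.card).card : ℝ)
      ≤ (S.card * ℓ).factorial *
        (((S.card : ℝ) / (a - m)) ^ m * (t ^ (ℓ * m) + μ ^ s)) := by
  have hT1 := card_defOfDeg_ge S F G 1
  have hT2 := card_defOfDeg_ge S F G 2
  have hdisj : Disjoint (defOfDeg S F G 1) (defOfDeg S F G 2) := by
    rw [Finset.disjoint_left]
    intro x hx hx'
    have := (Finset.mem_filter.1 hx).2.2
    have := (Finset.mem_filter.1 hx').2.2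
    omega
  have hE := card_defSocket S ℓ
  have key := card_large_closed_le (I := {v // v ∈ S}) (item := DefSocket.item)
    (T₁ := defOfDeg S F G 1) (T₂ := defOfDeg S F G 2) (τ := partner S G) (ℓ := ℓ) (B := B)
    (t := t) (μ := μ) (ζ := ζ) (a := a) (m := m) (s := s) ht0 ht1 hμ0 (card_item_fiber S ℓ) hℓ1
    hdisj (partner_injOn S F G)
    (fun x hx => (partner_spec hx).1) ?_ ?_ ?_ hζ ?_ hcap hma
  · rw [hE, Fintype.card_coe] at key
    refine le_trans ?_ key
    have hsub : (Finset.univ.filter fun σ : Equiv.Perm (DefSocket S ℓ) =>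
        ∃ Z, Stuck S F (permute σ G) Z ∧ a ≤ Z.card)
        ⊆ (Finset.univ.filter fun σ : Equiv.Perm (DefSocket S ℓ) =>
          ∃ Z : Finset {v // v ∈ S}, PeelClosed DefSocket.item (defOfDeg S F G 1)
            (defOfDeg S F G 2) (partner S G) σ Z ∧ a ≤ Z.card) := by
      intro σ hσ
      obtain ⟨Z, hZ, ha⟩ := (Finset.mem_filter.1 hσ).2
      refine Finset.mem_filter.2 ⟨Finset.mem_univ _, _, hZ.peelClosed, ?_⟩
      rw [Finset.card_subtype, Finset.filter_true_of_mem fun v hv => hZ.1 hv]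
      exact ha
    exact_mod_cast Finset.card_le_card hsub
  · rw [hE]
    push_cast at hT1 h1 ⊢
    linarith
  · rw [hE]
    have h4 : 2 * (D₂ - F.card) * (1 - t ^ (ℓ - 1) - ζ)
        ≤ (defOfDeg S F G 2).card * (1 - t ^ (ℓ - 1) - ζ) := by
      refine mul_le_mul_of_nonneg_right ?_ (by linarith)
      push_cast at hT2
      linarith
    push_cast at hT1 h2 ⊢
    linarith
  · rwa [hE]
  · rwa [hE]

open Classical in
/-- Probability of a large stuck set, for a fixed set `F` of faulty bins. -/
theorem card_stuck_le {S : Finset (Fin N)} {F : Finset (Fin M)}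
    {B a m s : ℕ} {t μ ζ η : ℝ} (hMr : M * r = N * ℓ) (hpos : 0 < M * r) (ht0 : 0 < t)
    (ht1 : t ≤ 1) (hμ0 : 0 ≤ μ) (hℓ1 : 1 ≤ ℓ) (hη0 : 0 ≤ η) (hη1 : η ≤ 1) {P₁ P₂ : ℝ}
    (hP₁ : P₁ = M * binomProb r (((S.card * ℓ : ℕ) : ℝ) / ((M * r : ℕ) : ℝ)) 1)
    (hP₂ : P₂ = M * binomProb r (((S.card * ℓ : ℕ) : ℝ) / ((M * r : ℕ) : ℝ)) 2)
    (h1 : ((S.card * ℓ : ℕ) : ℝ) - ((1 - η) * P₁ - F.card) ≤ μ * (((S.card * ℓ : ℕ) : ℝ) - B))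
    (h2 : ((S.card * ℓ : ℕ) : ℝ) - ((1 - η) * P₁ - F.card)
      - 2 * ((1 - η) * P₂ - F.card) * (1 - t ^ (ℓ - 1) - ζ) + B
      ≤ t * (((S.card * ℓ : ℕ) : ℝ) - B))
    (h3 : (ℓ : ℝ) * B ≤ ζ * t * (((S.card * ℓ : ℕ) : ℝ) - B - 1)) (hζ : 0 ≤ ζ)
    (hζ1 : t ^ (ℓ - 1) + ζ ≤ 1)
    (hB : B + 1 < S.card * ℓ) (hcap : ℓ * m + (ℓ + 2) * s ≤ B) (hma : m < a) :
    ((Finset.univ.filter fun G : Graph N ℓ M r =>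
        ∃ Z, Stuck S F G Z ∧ a ≤ Z.card).card : ℝ)
      ≤ Fintype.card (Graph N ℓ M r) *
        ((4 * ((S.card * ℓ : ℕ) : ℝ) + 2) *
          (Real.exp (-(η ^ 2 / 2 * P₁)) + Real.exp (-(η ^ 2 / 2 * P₂))) +
        ((S.card : ℝ) / (a - m)) ^ m * (t ^ (ℓ * m) + μ ^ s)) := by
  set k : ℕ := S.card * ℓ with hk
  set θ : ℝ := (k : ℝ) / ((M * r : ℕ) : ℝ) with hθ
  have hθ0 : 0 ≤ θ := by positivity
  have hkM : k ≤ M * r := by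
    rw [hMr]
    refine Nat.mul_le_mul_right ℓ ?_
    simpa using Finset.card_le_univ S
  have hθ1 : θ ≤ 1 := by
    rw [hθ, div_le_one (by exact_mod_cast hpos)]; exact_mod_cast hkM
  set Q : ℝ := ((S.card : ℝ) / (a - m)) ^ m * (t ^ (ℓ * m) + μ ^ s) with hQ
  have hQ0 : 0 ≤ Q := by
    have : (m : ℝ) < a := by exact_mod_cast hma
    have : 0 ≤ (a : ℝ) - m := by linarith
    positivity
  let f : ℕ → ℝ → (Fin M × Fin r → Bool) → ℝ := fun i P w =>
    if ((Finset.univ.filter fun b => ones (fun s => w (b, s)) = i).card : ℝ) ≤ (1 - η) * P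
      then 1 else 0
  have hf0 : ∀ i P w, 0 ≤ f i P w := by
    intro i P w; simp only [f]; split_ifs <;> norm_num
  have hocc : ∀ (i : ℕ) (P : ℝ), P = M * binomProb r θ i → ∑ G : Graph N ℓ M r, f i P (occ S G)
      ≤ Fintype.card (Graph N ℓ M r) * ((4 * (k : ℝ) + 2) * Real.exp (-(η ^ 2 / 2 * P))) := by
    intro i P hP
    refine (sum_graph_occ_le S hMr hpos (hf0 i P)).trans ?_
    have := noiseExp_occupancy_le (α := Fin M) (β := Fin r) hθ0 hθ1 hη0 hη1 i
    rw [Fintype.card_fin, Fintype.card_fin, ← hP] at this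
    refine mul_le_mul_of_nonneg_left (mul_le_mul_of_nonneg_left ?_ (by positivity)) (by positivity)
    exact this
  -- For atypical occupancy one of the indicators `f` equals `1` and the trivial count suffices;
  -- otherwise the exploration bound applies to the permutations.
  have hpt : ∀ G : Graph N ℓ M r,
      ((Finset.univ.filter fun σ : Equiv.Perm (DefSocket S ℓ) =>
        ∃ Z, Stuck S F (permute σ G) Z ∧ a ≤ Z.card).card : ℝ)
      ≤ k.factorial * (f 1 P₁ (occ S G) + f 2 P₂ (occ S G) + Q) := by
    intro G
    have htriv : ((Finset.univ.filter fun σ : Equiv.Perm (DefSocket S ℓ) =>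
        ∃ Z, Stuck S F (permute σ G) Z ∧ a ≤ Z.card).card : ℝ) ≤ k.factorial := by
      have : (Finset.univ.filter fun σ : Equiv.Perm (DefSocket S ℓ) =>
        ∃ Z, Stuck S F (permute σ G) Z ∧ a ≤ Z.card).card ≤ k.factorial := by
        refine (Finset.card_filter_le _ _).trans ?_
        rw [Finset.card_univ, Fintype.card_perm, card_defSocket]
      exact_mod_cast this
    have hkf : (0 : ℝ) ≤ k.factorial := by positivity
    by_cases hg1 : ((Finset.univ.filter fun b => ones (fun s => occ S G (b, s)) = 1).card : ℝ)
        ≤ (1 - η) * P₁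
    · have : f 1 P₁ (occ S G) = 1 := if_pos hg1
      refine htriv.trans (le_mul_of_one_le_right hkf ?_)
      have := hf0 2 P₂ (occ S G)
      linarith
    by_cases hg2 : ((Finset.univ.filter fun b => ones (fun s => occ S G (b, s)) = 2).card : ℝ)
        ≤ (1 - η) * P₂
    · have : f 2 P₂ (occ S G) = 1 := if_pos hg2
      refine htriv.trans (le_mul_of_one_le_right hkf ?_)
      have := hf0 1 P₁ (occ S G)
      linarith
    refine (card_stuck_perm_le ht0 ht1 hμ0 hℓ1 (not_le.1 hg1).le (not_le.1 hg2).le h1 h2 h3 hζ hζ1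
      hB hcap hma).trans ?_
    refine mul_le_mul_of_nonneg_left ?_ hkf
    have := hf0 1 P₁ (occ S G)
    have := hf0 2 P₂ (occ S G)
    linarith
  -- For each `σ`, the map `permute σ` is a bijection of the ensemble, so a uniform graph may be
  -- permuted further by an independent uniform `σ`.
  have havg : (k.factorial : ℝ) * ((Finset.univ.filter fun G : Graph N ℓ M r =>
        ∃ Z, Stuck S F G Z ∧ a ≤ Z.card).card : ℝ)
      = ∑ G : Graph N ℓ M r, ((Finset.univ.filter fun σ : Equiv.Perm (DefSocket S ℓ) =>
        ∃ Z, Stuck S F (permute σ G) Z ∧ a ≤ Z.card).card : ℝ) := by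
    simp only [Finset.card_filter, Nat.cast_sum]
    rw [Finset.sum_comm]
    have : ∀ σ : Equiv.Perm (DefSocket S ℓ),
        ∑ G : Graph N ℓ M r, (((if ∃ Z, Stuck S F (permute σ G) Z ∧ a ≤ Z.card then 1 else 0 : ℕ)) : ℝ)
        = ∑ G : Graph N ℓ M r, (((if ∃ Z, Stuck S F G Z ∧ a ≤ Z.card then 1 else 0 : ℕ)) : ℝ) := by
      intro σ
      refine Fintype.sum_equiv
        ⟨permute σ, permute σ⁻¹, fun G => ?_, fun G => ?_⟩ _ _ fun G => rfl
      · ext x : 1; simp [permute]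
      · ext x : 1; simp [permute]
    simp only [this]
    rw [Finset.sum_const, Finset.card_univ, Fintype.card_perm, card_defSocket, nsmul_eq_mul]
  have hkpos : (0 : ℝ) < k.factorial := by positivity
  refine le_of_mul_le_mul_left ?_ hkpos
  rw [havg]
  refine (Finset.sum_le_sum fun G _ => hpt G).trans ?_
  rw [← Finset.mul_sum]
  refine mul_le_mul_of_nonneg_left ?_ hkpos.le
  rw [Finset.sum_add_distrib, Finset.sum_add_distrib, Finset.sum_const, nsmul_eq_mul,
    Finset.card_univ]
  have e1 := hocc 1 P₁ hP₁
  have e2 := hocc 2 P₂ hP₂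
  linarith

end graph

/-! ### Faulty bins and recovery -/

section recovery
variable {N ℓ M r p L : ℕ}

theorem prob_eq_noiseExp (q : ℝ)
    (E : Graph N ℓ M r → SigPerms p r → (TestIndex M p L → Bool) → Prop)
    [∀ G π w, Decidable (E G π w)] :
    prob q E = (∑ G : Graph N ℓ M r, ∑ π : SigPerms p r,
      noiseExp q (fun w => if E G π w then (1 : ℝ) else 0)) /
      (Fintype.card (Graph N ℓ M r) * Fintype.card (SigPerms p r)) := by
  rw [prob]
  congr 1
  refine Finset.sum_congr rfl fun G _ => Finset.sum_congr rfl fun π _ => ?_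
  rw [noiseExp]
  refine Finset.sum_congr rfl fun w _ => ?_
  split_ifs <;> simp

/-- The defective items at a bin. -/
def defItems (S : Finset (Fin N)) (G : Graph N ℓ M r) (b : Fin M) : Finset (Fin N) :=
  (nbrs G b).filter (· ∈ S)

theorem testResults_apply (C : BinCode (Nat.clog 2 r) L) (G : Graph N ℓ M r) (π : SigPerms p r)
    (S : Finset (Fin N)) (w : TestIndex M p L → Bool) (b : Fin M) (i : Fin p) (side : Bool)
    (t : Fin L) :
    testResults C G π S w (b, i, side, t) = xor (decide (∃ v, ∃ hv : v ∈ nbrs G b, v ∈ S ∧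
      xor side (codeword C π i (loc G b v hv) t) = true)) (w (b, i, side, t)) := by
  have : (∃ v ∈ S, testMatrix C G π (b, i, side, t) v = true) ↔ (∃ v, ∃ hv : v ∈ nbrs G b, v ∈ S ∧
      xor side (codeword C π i (loc G b v hv) t) = true) := by
    constructor
    · rintro ⟨v, hvS, h⟩
      rw [testMatrix] at h
      split_ifs at h with hv
      exact ⟨v, hv, hvS, h⟩
    · rintro ⟨v, hv, hvS, h⟩
      refine ⟨v, hvS, ?_⟩
      rw [testMatrix, dif_pos hv]
      exact h
  rw [testResults, addNoise]
  congr 1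
  exact decide_eq_decide.2 this

/-- The case `u = v` is allowed, so that bins with a single defective item are covered as well. -/
theorem testResults_pair {C : BinCode (Nat.clog 2 r) L} {G : Graph N ℓ M r} {π : SigPerms p r}
    {S : Finset (Fin N)} {w : TestIndex M p L → Bool} {b : Fin M} {u v : Fin N}
    (hu : u ∈ nbrs G b) (hv : v ∈ nbrs G b) (hD : defItems S G b = {u, v}) (i : Fin p)
    (side : Bool) (t : Fin L) :
    testResults C G π S w (b, i, side, t) =
      xor (xor side (codeword C π i (loc G b u hu) t) || xor side (codeword C π i (loc G b v hv) t))
        (w (b, i, side, t)) := by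
  rw [testResults_apply]
  congr 1
  rw [Bool.eq_iff_iff, decide_eq_true_iff, Bool.or_eq_true]
  have hmem : ∀ x, (x ∈ nbrs G b ∧ x ∈ S) ↔ (x = u ∨ x = v) := by
    intro x
    rw [← Finset.mem_filter (p := (· ∈ S)), ← defItems, hD, Finset.mem_insert,
      Finset.mem_singleton]
  constructor
  · rintro ⟨x, hx, hxS, h⟩
    rcases (hmem x).1 ⟨hx, hxS⟩ with rfl | rfl
    · exact Or.inl h
    · exact Or.inr h
  · rintro (h | h)
    · exact ⟨u, hu, ((hmem u).2 (Or.inl rfl)).2, h⟩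
    · exact ⟨v, hv, ((hmem v).2 (Or.inr rfl)).2, h⟩

theorem firstHalves_singleton {C : BinCode (Nat.clog 2 r) L} {G : Graph N ℓ M r}
    {π : SigPerms p r} {S : Finset (Fin N)} {w : TestIndex M p L → Bool} {b : Fin M} {v : Fin N}
    (hv : v ∈ nbrs G b) (hD : defItems S G b = {v}) (i : Fin p) :
    firstHalves (testResults C G π S w) b i
      = addNoise (codeword C π i (loc G b v hv)) (fun t => w (b, i, false, t)) := by
  funext t
  rw [firstHalves, testResults_pair hv hv (by simpa using hD)]
  simp [addNoise]

/-- Where the codeword of `u` is `0`, the OR in the first half is the bit of `v`; where it is `1`,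
its complement is `0` and the second half shows the complemented bit of `v`. Each position therefore
delivers the bit of `v` with exactly one noise bit. -/
theorem residual_pair {C : BinCode (Nat.clog 2 r) L} {G : Graph N ℓ M r}
    {π : SigPerms p r} {S : Finset (Fin N)} {w : TestIndex M p L → Bool} {b : Fin M} {u v : Fin N}
    (hu : u ∈ nbrs G b) (hv : v ∈ nbrs G b) (hD : defItems S G b = {u, v}) (i : Fin p) :
    residual C π (testResults C G π S w) b (loc G b u hu) i
      = addNoise (codeword C π i (loc G b v hv))
        (fun t => w (b, i, codeword C π i (loc G b u hu) t, t)) := by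
  funext t
  rw [residual, testResults_pair hu hv hD, testResults_pair hu hv hD, addNoise]
  cases codeword C π i (loc G b u hu) t <;> simp

/-- Some section is decoded incorrectly, when the codeword of location `j` is received with the
noise at the positions selected by `sel`. -/
def SectionError (C : BinCode (Nat.clog 2 r) L) (π : SigPerms p r) (j : Fin r)
    (sel : Fin p → Fin L → Bool) (x : Fin p × Bool × Fin L → Bool) : Prop :=
  ∃ i, C.dec (addNoise (codeword C π i j) (fun t => x (i, sel i t, t))) ≠ bits (sectionPerm π i j)

-- The selector is fixed in advance of the noise and picks one test per position, all distinct. The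
-- selected noise is thus again i.i.d., and the error probability of the code applies section by
-- section.
open Classical in
theorem noiseExp_sectionError_le {q δ : ℝ} (h0 : 0 ≤ q) (h1 : q ≤ 1)
    {C : BinCode (Nat.clog 2 r) L} (hδ : ∀ x, errorProb q C x ≤ δ) (π : SigPerms p r) (j : Fin r)
    (sel : Fin p → Fin L → Bool) :
    noiseExp q (fun x => if SectionError C π j sel x then (1 : ℝ) else 0) ≤ p * δ := by
  have hpt : ∀ x : Fin p × Bool × Fin L → Bool,
      (if SectionError C π j sel x then (1 : ℝ) else 0)
      ≤ ∑ i, if C.dec (addNoise (codeword C π i j) (fun t => x (i, sel i t, t)))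
          ≠ bits (sectionPerm π i j) then (1 : ℝ) else 0 := by
    intro x
    split_ifs with H
    · obtain ⟨i, hi⟩ := H
      refine le_trans ?_ (Finset.single_le_sum (fun i _ => ?_) (Finset.mem_univ i))
      · rw [if_pos hi]
      · split_ifs <;> norm_num
    · exact Finset.sum_nonneg fun i _ => by split_ifs <;> norm_num
  refine (noiseExp_mono h0 h1 hpt).trans ?_
  rw [noiseExp_sum]
  calc _ ≤ ∑ _i : Fin p, δ := by
        refine Finset.sum_le_sum fun i _ => ?_
        have hinj : Function.Injective (fun t : Fin L => (i, sel i t, t)) := by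
          intro t t' h
          exact (Prod.ext_iff.1 (Prod.ext_iff.1 h).2).2
        refine le_trans (le_of_eq ?_) (hδ (bits (sectionPerm π i j)))
        rw [errorProb_eq]
        exact noiseExp_comp_injective hinj (fun z =>
          if C.dec (addNoise (codeword C π i j) z) ≠ bits (sectionPerm π i j) then (1 : ℝ) else 0)
    _ = p * δ := by simp

/-- The noise at a bin with one or two defective items prevents their correct decoding. -/
def Faulty (C : BinCode (Nat.clog 2 r) L) (S : Finset (Fin N)) (G : Graph N ℓ M r)
    (π : SigPerms p r) (b : Fin M) (x : Fin p × Bool × Fin L → Bool) : Prop :=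
  ∃ u v, ∃ (hu : u ∈ nbrs G b) (hv : v ∈ nbrs G b), defItems S G b = {u, v} ∧
    (SectionError C π (loc G b v hv) (fun _ _ => false) x ∨
      SectionError C π (loc G b v hv) (fun i t => codeword C π i (loc G b u hu) t) x)

-- The factor `8` counts at most four ordered pairs of items, with two error events each. A bin with
-- more than two defective items is never faulty.
open Classical in
theorem noiseExp_faulty_le {q δ : ℝ} (h0 : 0 ≤ q) (h1 : q ≤ 1)
    {C : BinCode (Nat.clog 2 r) L} (hδ : ∀ x, errorProb q C x ≤ δ) (hδ0 : 0 ≤ δ)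
    (S : Finset (Fin N)) (G : Graph N ℓ M r) (π : SigPerms p r) (b : Fin M) :
    noiseExp q (fun x => if Faulty C S G π b x then (1 : ℝ) else 0) ≤ 8 * (p * δ) := by
  have hpδ : 0 ≤ p * δ := by positivity
  by_cases hcard : (defItems S G b).card ≤ 2
  · have hn : ∀ x : {x // x ∈ defItems S G b}, x.1 ∈ nbrs G b := fun x =>
      (Finset.mem_filter.1 x.2).1
    let f : {x // x ∈ defItems S G b} × {x // x ∈ defItems S G b} →
      (Fin p × Bool × Fin L → Bool) → ℝ := fun uv x =>
        (if SectionError C π (loc G b uv.2.1 (hn uv.2)) (fun _ _ => false) x then 1 else 0) +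
        (if SectionError C π (loc G b uv.2.1 (hn uv.2))
          (fun i t => codeword C π i (loc G b uv.1.1 (hn uv.1)) t) x then 1 else 0)
    have hf0 : ∀ uv x, 0 ≤ f uv x := by
      intro uv x; simp only [f]; split_ifs <;> norm_num
    have hpt : ∀ x, (if Faulty C S G π b x then (1 : ℝ) else 0) ≤ ∑ uv, f uv x := by
      intro x
      split_ifs with H
      · obtain ⟨u, v, hu, hv, hD, H⟩ := H
        have hu' : u ∈ defItems S G b := by rw [hD]; simp
        have hv' : v ∈ defItems S G b := by rw [hD]; simp
        refine le_trans ?_ (Finset.single_le_sum (fun uv _ => hf0 uv x)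
          (Finset.mem_univ (⟨u, hu'⟩, ⟨v, hv'⟩)))
        simp only [f]
        rcases H with H | H
        · rw [if_pos H]; split_ifs <;> norm_num
        · rw [if_pos H]; split_ifs <;> norm_num
      · exact Finset.sum_nonneg fun uv _ => hf0 uv x
    refine (noiseExp_mono h0 h1 hpt).trans ?_
    rw [noiseExp_sum]
    have hf : ∀ uv, noiseExp q (f uv) ≤ 2 * (p * δ) := by
      intro uv
      simp only [f]
      rw [noiseExp_add]
      have := noiseExp_sectionError_le h0 h1 hδ π (loc G b uv.2.1 (hn uv.2)) (fun _ _ => false)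
      have := noiseExp_sectionError_le h0 h1 hδ π (loc G b uv.2.1 (hn uv.2))
        (fun i t => codeword C π i (loc G b uv.1.1 (hn uv.1)) t)
      linarith
    refine (Finset.sum_le_sum fun uv _ => hf uv).trans ?_
    rw [Finset.sum_const, Finset.card_univ, Fintype.card_prod, Fintype.card_coe, nsmul_eq_mul]
    have : (((defItems S G b).card * (defItems S G b).card : ℕ) : ℝ) ≤ 4 := by
      exact_mod_cast (Nat.mul_le_mul hcard hcard).trans (by norm_num)
    nlinarith
  · have : ∀ x, (if Faulty C S G π b x then (1 : ℝ) else 0) = 0 := by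
      intro x
      rw [if_neg]
      rintro ⟨u, v, _, _, hD, _⟩
      exact hcard (hD ▸ Finset.card_le_two)
    simp only [this]
    rw [noiseExp_const]
    positivity

open Classical in
/-- Defective items that are not decoded form a stuck set, with respect to the faulty bins. -/
theorem stuck_not_decoded (C : BinCode (Nat.clog 2 r) L) (S : Finset (Fin N)) (G : Graph N ℓ M r)
    (π : SigPerms p r) (w : TestIndex M p L → Bool) :
    Stuck S (Finset.univ.filter fun b => Faulty C S G π b (fun x => w (b, x))) G
      (S.filter fun v => ¬ Decoded C G π (testResults C G π S w) v) := by
  refine ⟨Finset.filter_subset _ _, fun v hv b hb hvb => ?_⟩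
  obtain ⟨hvS, hvd⟩ := Finset.mem_filter.1 hv
  have hnf : ¬ Faulty C S G π b (fun x => w (b, x)) := fun h =>
    hb (Finset.mem_filter.2 ⟨Finset.mem_univ _, h⟩)
  constructor
  · intro hD
    apply hvd
    refine Decoded.singleton b v hvb fun i => ?_
    rw [firstHalves_singleton hvb hD]
    by_contra hne
    -- A bin with one defective item enters `Faulty` as the pair `{v, v}`.
    exact hnf ⟨v, v, hvb, hvb, by rw [Finset.pair_eq_singleton]; exact hD, Or.inl ⟨i, hne⟩⟩
  · intro u huS hD
    refine Finset.mem_filter.2 ⟨huS, fun hud => hvd ?_⟩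
    have hub : u ∈ nbrs G b := by
      have : u ∈ (nbrs G b).filter (· ∈ S) := by rw [hD]; simp
      exact (Finset.mem_filter.1 this).1
    refine Decoded.doubleton b u v hub hvb hud fun i => ?_
    rw [residual_pair hub hvb hD]
    by_contra hne
    exact hnf ⟨u, v, hub, hvb, hD, Or.inr ⟨i, hne⟩⟩

/-- Weighting each set `F` by `s ^ F.card` bounds the number of sets with at most `f` elements by
`exp (s * M) / s ^ f` for `M` bins. For `f` a small fraction of `M` and `s` small, this grows at an
arbitrarily small exponential rate. -/
theorem card_filter_card_le_mul_pow {α : Type*} [Fintype α] [DecidableEq α] {s : ℝ} (hs0 : 0 < s)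
    (hs1 : s ≤ 1) (f : ℕ) :
    ((Finset.univ.filter fun F : Finset α => F.card ≤ f).card : ℝ) * s ^ f
      ≤ Real.exp (s * Fintype.card α) := by
  calc ((Finset.univ.filter fun F : Finset α => F.card ≤ f).card : ℝ) * s ^ f
      = ∑ F ∈ Finset.univ.filter (fun F : Finset α => F.card ≤ f), s ^ f := by
        rw [Finset.sum_const, nsmul_eq_mul]
    _ ≤ ∑ F ∈ Finset.univ.filter (fun F : Finset α => F.card ≤ f), s ^ F.card :=
        Finset.sum_le_sum fun F hF =>
          pow_le_pow_of_le_one hs0.le hs1 (Finset.mem_filter.1 hF).2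
    _ ≤ ∑ F : Finset α, s ^ F.card :=
        Finset.sum_le_sum_of_subset_of_nonneg (Finset.filter_subset _ _)
          fun _ _ _ => by positivity
    _ = (s + 1) ^ Fintype.card α := by
        have := Fintype.sum_pow_mul_eq_add_pow α s 1
        simpa using this
    _ ≤ Real.exp s ^ Fintype.card α := by
        gcongr
        exact Real.add_one_le_exp s
    _ = _ := by rw [← Real.exp_nat_mul, mul_comm]

-- The actual set `F₀` of faulty bins is random. If it has at most `f` elements, it is one of the
-- sets in the union bound for stuck sets. Otherwise some `F` with more than `f` elements consists
-- of faulty bins only; independence across bins makes this cost `d ^ f` for each `F`, and the crude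
-- count `2 ^ M` of such sets is enough.
open Classical in
theorem noiseExp_not_recovers_le {q d ε : ℝ} (h0 : 0 ≤ q) (h1 : q ≤ 1)
    {C : BinCode (Nat.clog 2 r) L} (hd0 : 0 ≤ d) (hd1 : d ≤ 1) (S : Finset (Fin N)) {a f : ℕ}
    (ha : (a : ℝ) ≤ ε * S.card) (G : Graph N ℓ M r) (π : SigPerms p r)
    (hfault : ∀ b, noiseExp q (fun x => if Faulty C S G π b x then (1 : ℝ) else 0) ≤ d) :
    noiseExp q (fun w : TestIndex M p L → Bool => if ¬ Recovers C ε S G π w then (1 : ℝ) else 0)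
      ≤ ∑ F ∈ Finset.univ.filter (fun F : Finset (Fin M) => F.card ≤ f),
        (if ∃ Z, Stuck S F G Z ∧ a ≤ Z.card then (1 : ℝ) else 0) + 2 ^ M * d ^ f := by
  set few : Finset (Finset (Fin M)) := Finset.univ.filter fun F => F.card ≤ f with hfew
  have hw : ∀ w : TestIndex M p L → Bool,
      (if ¬ Recovers C ε S G π w then (1 : ℝ) else 0)
      ≤ ∑ F ∈ few, (if ∃ Z, Stuck S F G Z ∧ a ≤ Z.card then (1 : ℝ) else 0) +
        ∑ F ∈ fewᶜ, ∏ b, (if b ∈ F then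
          (if Faulty C S G π b (fun x => w (b, x)) then (1 : ℝ) else 0) else 1) := by
    intro w
    have hn1 : 0 ≤ ∑ F ∈ few, (if ∃ Z, Stuck S F G Z ∧ a ≤ Z.card then (1 : ℝ) else 0) :=
      Finset.sum_nonneg fun F _ => by split_ifs <;> norm_num
    have hn2 : ∀ F ∈ fewᶜ, 0 ≤ ∏ b, (if b ∈ F then
          (if Faulty C S G π b (fun x => w (b, x)) then (1 : ℝ) else 0) else 1) :=
      fun F _ => Finset.prod_nonneg fun b _ => by split_ifs <;> norm_num
    split_ifs with H
    · exact add_nonneg hn1 (Finset.sum_nonneg hn2)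
    · set F₀ := Finset.univ.filter fun b => Faulty C S G π b (fun x => w (b, x)) with hF₀
      by_cases hF : F₀ ∈ few
      · have hst := stuck_not_decoded C S G π w
        rw [← hF₀] at hst
        have hcard : a ≤ (S.filter fun v => ¬ Decoded C G π (testResults C G π S w) v).card := by
          have h2 := Finset.card_filter_add_card_filter_not (s := S)
            (fun v => Decoded C G π (testResults C G π S w) v)
          rw [Recovers, not_le] at H
          have h3 : (((S.filter fun v => Decoded C G π (testResults C G π S w) v).card : ℝ))
            + ((S.filter fun v => ¬ Decoded C G π (testResults C G π S w) v).card : ℝ) = S.card := by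
            exact_mod_cast h2
          have h4 : (a : ℝ)
              ≤ ((S.filter fun v => ¬ Decoded C G π (testResults C G π S w) v).card : ℝ) := by
            linarith
          exact_mod_cast h4
        have h5 := Finset.single_le_sum (f := fun F =>
          (if ∃ Z, Stuck S F G Z ∧ a ≤ Z.card then (1 : ℝ) else 0))
          (fun F _ => by positivity) hF
        rw [if_pos ⟨_, hst, hcard⟩] at h5
        have := Finset.sum_nonneg hn2
        linarith
      · have h5 := Finset.single_le_sum hn2 (Finset.mem_compl.2 hF)
        have h6 : ∏ b, (if b ∈ F₀ then
          (if Faulty C S G π b (fun x => w (b, x)) then (1 : ℝ) else 0) else 1) = 1 := by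
          refine Finset.prod_eq_one fun b _ => ?_
          split_ifs with h7 h8
          · rfl
          · exact absurd (Finset.mem_filter.1 h7).2 h8
          · rfl
        rw [h6] at h5
        linarith
  refine (noiseExp_mono h0 h1 hw).trans ?_
  rw [noiseExp_add, noiseExp_const, noiseExp_sum]
  refine add_le_add le_rfl ?_
  have hF : ∀ F ∈ fewᶜ, noiseExp q (fun w : TestIndex M p L → Bool => ∏ b, (if b ∈ F then
          (if Faulty C S G π b (fun x => w (b, x)) then (1 : ℝ) else 0) else 1)) ≤ d ^ f := by
    intro F hF
    have hblock := noiseExp_block (q := q) (α := Fin M) (β := Fin p × Bool × Fin L)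
      (fun b x => if b ∈ F then (if Faulty C S G π b x then (1 : ℝ) else 0) else 1)
    refine (le_of_eq hblock).trans ?_
    have hfF : f ≤ F.card := by
      rw [hfew, Finset.mem_compl, Finset.mem_filter] at hF
      have : ¬ F.card ≤ f := fun h => hF ⟨Finset.mem_univ _, h⟩
      omega
    calc _ ≤ ∏ b, (if b ∈ F then d else 1) := by
          refine Finset.prod_le_prod (fun b _ => noiseExp_nonneg h0 h1 fun w => ?_) fun b _ => ?_
          · split_ifs <;> norm_num
          · split_ifs
            · exact hfault b
            · rw [noiseExp_const]
      _ = d ^ F.card := by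
          rw [Finset.prod_ite_mem, Finset.univ_inter, Finset.prod_const]
      _ ≤ d ^ f := pow_le_pow_of_le_one hd0 hd1 hfF
  refine (Finset.sum_le_sum hF).trans ?_
  rw [Finset.sum_const, nsmul_eq_mul]
  refine mul_le_mul_of_nonneg_right ?_ (by positivity)
  have : (fewᶜ).card ≤ 2 ^ M := by
    refine (Finset.card_le_univ _).trans ?_
    rw [Fintype.card_finset, Fintype.card_fin]
  exact_mod_cast this

theorem sum_sum_div_le {α β : Type*} [Fintype α] [Fintype β] (hα : 0 < Fintype.card α)
    (hβ : 0 < Fintype.card β) {Y : α → β → ℝ} {X : α → ℝ} {A : ℝ} (hY : ∀ a b, Y a b ≤ X a)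
    (hX : ∑ a, X a ≤ Fintype.card α * A) :
    (∑ a, ∑ b, Y a b) / (Fintype.card α * Fintype.card β) ≤ A := by
  have hα' : (0 : ℝ) < Fintype.card α := by exact_mod_cast hα
  have hβ' : (0 : ℝ) < Fintype.card β := by exact_mod_cast hβ
  rw [div_le_iff₀ (by positivity)]
  calc ∑ a, ∑ b, Y a b ≤ ∑ a, ∑ _b : β, X a :=
        Finset.sum_le_sum fun a _ => Finset.sum_le_sum fun b _ => hY a b
    _ = (∑ a, X a) * Fintype.card β := by
        simp only [Finset.sum_const, Finset.card_univ, nsmul_eq_mul]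
        rw [← Finset.mul_sum, mul_comm]
    _ ≤ (Fintype.card α * A) * Fintype.card β := mul_le_mul_of_nonneg_right hX hβ'.le
    _ = _ := by ring

open Classical in
/-- Failure of the recovery requires a large stuck set with few faulty bins, or many faulty
bins. -/
theorem prob_not_recovers_le {q δ ε s Q : ℝ} (h0 : 0 ≤ q) (h1 : q ≤ 1)
    {C : BinCode (Nat.clog 2 r) L} (hδ : ∀ x, errorProb q C x ≤ δ) (hδ0 : 0 ≤ δ)
    (hδ1 : 8 * (p * δ) ≤ 1) (hs0 : 0 < s) (hs1 : s ≤ 1) (S : Finset (Fin N)) {a f : ℕ}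
    (ha : (a : ℝ) ≤ ε * S.card) (hG : 0 < Fintype.card (Graph N ℓ M r)) (hQ0 : 0 ≤ Q)
    (hQ : ∀ F : Finset (Fin M), F.card ≤ f →
      ((Finset.univ.filter fun G : Graph N ℓ M r => ∃ Z, Stuck S F G Z ∧ a ≤ Z.card).card : ℝ)
        ≤ Fintype.card (Graph N ℓ M r) * Q) :
    prob (N := N) (ℓ := ℓ) (M := M) (r := r) (p := p) (L := L) q
        (fun G π w => ¬ Recovers C ε S G π w)
      ≤ Real.exp (s * M) / s ^ f * Q + 2 ^ M * (8 * (p * δ)) ^ f := by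
  set d : ℝ := 8 * (p * δ) with hd
  have hd0 : 0 ≤ d := by positivity
  set few : Finset (Finset (Fin M)) := Finset.univ.filter fun F => F.card ≤ f with hfew
  have hpt : ∀ (G : Graph N ℓ M r) (π : SigPerms p r),
      noiseExp q (fun w : TestIndex M p L → Bool => if ¬ Recovers C ε S G π w then (1 : ℝ) else 0)
      ≤ ∑ F ∈ few, (if ∃ Z, Stuck S F G Z ∧ a ≤ Z.card then (1 : ℝ) else 0) + 2 ^ M * d ^ f :=
    fun G π => noiseExp_not_recovers_le h0 h1 hd0 hδ1 S ha G π
      fun b => noiseExp_faulty_le h0 h1 hδ hδ0 S G π b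
  rw [prob_eq_noiseExp]
  refine sum_sum_div_le hG Fintype.card_pos hpt ?_
  have hsum1 : ∑ G : Graph N ℓ M r, ∑ F ∈ few,
      (if ∃ Z, Stuck S F G Z ∧ a ≤ Z.card then (1 : ℝ) else 0)
      ≤ few.card * (Fintype.card (Graph N ℓ M r) * Q) := by
    rw [Finset.sum_comm, ← nsmul_eq_mul, ← Finset.sum_const]
    refine Finset.sum_le_sum fun F hF => ?_
    refine le_trans (le_of_eq ?_) (hQ F (Finset.mem_filter.1 hF).2)
    rw [Finset.sum_boole]
  have hfewc : (few.card : ℝ) ≤ Real.exp (s * M) / s ^ f := by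
    rw [le_div_iff₀ (by positivity)]
    have := card_filter_card_le_mul_pow (α := Fin M) hs0 hs1 f
    rwa [Fintype.card_fin] at this
  rw [Finset.sum_add_distrib, Finset.sum_const, Finset.card_univ, nsmul_eq_mul, mul_add]
  refine add_le_add (hsum1.trans ?_) le_rfl
  rw [mul_left_comm]
  exact mul_le_mul_of_nonneg_left (mul_le_mul_of_nonneg_right hfewc hQ0) (Nat.cast_nonneg _)

end recovery

/-! ### False alarms -/

theorem bits_injective {r : ℕ} : Function.Injective (bits (r := r)) := by
  intro j j' h
  apply Fin.ext
  apply Nat.eq_of_testBit_eq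
  intro t
  by_cases ht : t < Nat.clog 2 r
  · have := congrFun h (Fin.rev ⟨t, ht⟩)
    simpa [bits] using this
  · have hr : r ≤ 2 ^ t := (Nat.le_pow_clog one_lt_two r).trans
      (Nat.pow_le_pow_right two_pos (not_lt.1 ht))
    rw [Nat.testBit_lt_two_pow (j.2.trans_le hr), Nat.testBit_lt_two_pow (j'.2.trans_le hr)]

/-- A target that depends only on the values of `ρ` on `D` is hit at `j ∉ D` with probability at
most `1 / (r - |D|)`. -/
theorem card_perm_hit_le {r : ℕ} {β : Type*} [DecidableEq β] (D : Finset (Fin r))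
    (ζ : Equiv.Perm (Fin r) → β) {target : Fin r → β} (ht : Function.Injective target)
    (hζ : ∀ ρ ρ' : Equiv.Perm (Fin r), (∀ j ∈ D, ρ j = ρ' j) → ζ ρ = ζ ρ') {j : Fin r}
    (hj : j ∉ D) :
    (Finset.univ.filter fun ρ : Equiv.Perm (Fin r) => ζ ρ = target (ρ j)).card * (r - D.card)
      ≤ r.factorial := by
  set X : Fin r → Finset (Equiv.Perm (Fin r)) := fun k =>
    Finset.univ.filter fun ρ : Equiv.Perm (Fin r) => ζ ρ = target (ρ k) with hX
  -- Composing with the transposition of `j` and `k` leaves the values on `D`, hence the decoded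
  -- word, unchanged, so `j` is hit no more often than any other location outside `D`. These events
  -- are disjoint, since the target and `ρ` are injective.
  have hswap : ∀ k ∈ Dᶜ, (X j).card ≤ (X k).card := by
    intro k hk
    rw [Finset.mem_compl] at hk
    refine Finset.card_le_card_of_injOn (fun ρ => ρ * Equiv.swap j k) ?_ ?_
    · intro ρ hρ
      have h1 := (Finset.mem_filter.1 hρ).2
      refine Finset.mem_filter.2 ⟨Finset.mem_univ _, ?_⟩
      rw [Equiv.Perm.mul_apply, Equiv.swap_apply_right, ← h1]
      refine hζ _ _ fun i hi => ?_
      rw [Equiv.Perm.mul_apply, Equiv.swap_apply_of_ne_of_ne]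
      · rintro rfl; exact hj hi
      · rintro rfl; exact hk hi
    · intro ρ _ ρ' _ h
      exact mul_right_cancel h
  have hdis : (Dᶜ : Set (Fin r)).PairwiseDisjoint X := by
    intro k _ k' _ hkk'
    rw [Function.onFun, Finset.disjoint_left]
    intro ρ h1 h2
    have h3 := (Finset.mem_filter.1 h1).2.symm.trans (Finset.mem_filter.1 h2).2
    exact hkk' (ρ.injective (ht h3))
  calc (X j).card * (r - D.card) = ∑ _k ∈ Dᶜ, (X j).card := by
        rw [Finset.sum_const, Finset.card_compl, Fintype.card_fin, smul_eq_mul, mul_comm]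
    _ ≤ ∑ k ∈ Dᶜ, (X k).card := Finset.sum_le_sum hswap
    _ = (Dᶜ.biUnion X).card := by
        rw [Finset.card_biUnion]
        intro k hk k' hk' hne
        exact hdis (by simpa using hk) (by simpa using hk') hne
    _ ≤ r.factorial := by
        refine (Finset.card_le_univ _).trans ?_
        rw [Fintype.card_perm, Fintype.card_fin]

open Classical in
/-- All sections hit a common location outside `D`. -/
theorem card_sigPerms_hit_le {p r : ℕ} (hp : 1 ≤ p) {β : Type*} [DecidableEq β] (D : Finset (Fin r))
    (ζ : Fin p → Equiv.Perm (Fin r) → β) {target : Fin r → β} (ht : Function.Injective target)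
    (hζ : ∀ i, ∀ ρ ρ' : Equiv.Perm (Fin r), (∀ j ∈ D, ρ j = ρ' j) → ζ i ρ = ζ i ρ') :
    (Finset.univ.filter fun π : SigPerms p r => ∃ j ∉ D, ∀ i,
      ζ i (sectionPerm π i) = target (sectionPerm π i j)).card * (r - D.card) ^ (p - 1)
      ≤ r.factorial ^ (p - 1) := by
  set Y := Finset.univ.filter fun π : SigPerms p r => ∃ j ∉ D, ∀ i,
      ζ i (sectionPerm π i) = target (sectionPerm π i j) with hY
  rcases Y.eq_empty_or_nonempty with h | ⟨π₀, hπ₀⟩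
  · rw [h]; simp
  let i₀ : Fin p := ⟨0, hp⟩
  have hsec0 : ∀ π : SigPerms p r, sectionPerm π i₀ = 1 := fun π => dif_pos rfl
  obtain ⟨j₀, hj₀, h₀⟩ := (Finset.mem_filter.1 hπ₀).2
  have hsub : Y ⊆ Fintype.piFinset fun i : Fin (p - 1) =>
      Finset.univ.filter fun ρ : Equiv.Perm (Fin r) =>
        ζ ⟨i.1 + 1, by omega⟩ ρ = target (ρ j₀) := by
    intro π hπ
    obtain ⟨j, hj, h⟩ := (Finset.mem_filter.1 hπ).2
    -- Section `0` uses the identity, so its word is the same for all `π` and determines the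
    -- candidate location. Only the other `p - 1` sections contribute a small factor.
    have hjj : j = j₀ := by
      have h1 := h i₀
      have h2 := h₀ i₀
      rw [hsec0] at h1 h2
      exact ht (h1.symm.trans h2)
    subst hjj
    rw [Fintype.mem_piFinset]
    intro i
    have h3 := h ⟨i.1 + 1, by omega⟩
    have h4 : sectionPerm π ⟨i.1 + 1, by omega⟩ = π i := by
      rw [sectionPerm, dif_neg (by simp)]
      congr 1
    rw [h4] at h3
    exact Finset.mem_filter.2 ⟨Finset.mem_univ _, h3⟩
  calc Y.card * (r - D.card) ^ (p - 1)
      ≤ (Fintype.piFinset fun i : Fin (p - 1) =>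
        Finset.univ.filter fun ρ : Equiv.Perm (Fin r) =>
          ζ ⟨i.1 + 1, by omega⟩ ρ = target (ρ j₀)).card * (r - D.card) ^ (p - 1) :=
        Nat.mul_le_mul_right _ (Finset.card_le_card hsub)
    _ = ∏ i : Fin (p - 1), ((Finset.univ.filter fun ρ : Equiv.Perm (Fin r) =>
          ζ ⟨i.1 + 1, by omega⟩ ρ = target (ρ j₀)).card * (r - D.card)) := by
        rw [Fintype.card_piFinset, Finset.prod_mul_distrib, Finset.prod_const, Finset.card_univ,
          Fintype.card_fin]
    _ ≤ ∏ _i : Fin (p - 1), r.factorial :=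
        Finset.prod_le_prod' fun i _ => card_perm_hit_le D _ ht (hζ _) hj₀
    _ = _ := by rw [Finset.prod_const, Finset.card_univ, Fintype.card_fin]

section falseAlarm
variable {N ℓ M r p L : ℕ}

theorem loc_injective {G : Graph N ℓ M r} {b : Fin M} {u v : Fin N} {hu : u ∈ nbrs G b}
    {hv : v ∈ nbrs G b} (h : loc G b u hu = loc G b v hv) : u = v := by
  have key : ∀ {u v : Fin N}, u ∈ nbrs G b → u < v →
      ((nbrs G b).filter (· < u)).card < ((nbrs G b).filter (· < v)).card := by
    intro u v hu huv
    refine Finset.card_lt_card (Finset.ssubset_iff_of_subset ?_ |>.2 ⟨u, ?_, ?_⟩)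
    · intro x hx
      rw [Finset.mem_filter] at hx ⊢
      exact ⟨hx.1, hx.2.trans huv⟩
    · exact Finset.mem_filter.2 ⟨hu, huv⟩
    · simp
  have h' : ((nbrs G b).filter (· < u)).card = ((nbrs G b).filter (· < v)).card :=
    congrArg Fin.val h
  rcases lt_trichotomy u v with huv | huv | huv
  · exact absurd h' (key hu huv).ne
  · exact huv
  · exact absurd h' (key hv huv).ne'

/-- The locations of the defective items at a bin. -/
def defLocs (S : Finset (Fin N)) (G : Graph N ℓ M r) (b : Fin M) : Finset (Fin r) :=
  (defItems S G b).attach.image fun v => loc G b v.1 (Finset.mem_filter.1 v.2).1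

theorem mem_defLocs {S : Finset (Fin N)} {G : Graph N ℓ M r} {b : Fin M} {v : Fin N}
    (hv : v ∈ nbrs G b) : loc G b v hv ∈ defLocs S G b ↔ v ∈ S := by
  simp only [defLocs, Finset.mem_image, Finset.mem_attach, true_and, Subtype.exists]
  constructor
  · rintro ⟨u, hu, h⟩
    have := loc_injective h
    subst this
    exact (Finset.mem_filter.1 hu).2
  · intro hS
    exact ⟨v, Finset.mem_filter.2 ⟨hv, hS⟩, rfl⟩

theorem card_defItems_le (S : Finset (Fin N)) (G : Graph N ℓ M r) (b : Fin M) :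
    (defItems S G b).card ≤ ones (fun s => occ S G (b, s)) := by
  rw [ones]
  calc (defItems S G b).card ≤ ((Finset.univ.filter fun s : Fin r => occ S G (b, s) = true).image
        fun s => (G.symm (b, s)).1).card := by
        refine Finset.card_le_card fun v hv => ?_
        obtain ⟨hv1, hv2⟩ := Finset.mem_filter.1 hv
        obtain ⟨s, _, rfl⟩ := Finset.mem_image.1 hv1
        exact Finset.mem_image.2 ⟨s, Finset.mem_filter.2 ⟨Finset.mem_univ _, by simpa [occ] using hv2⟩,
          rfl⟩
    _ ≤ _ := Finset.card_image_le

theorem card_defLocs_le (S : Finset (Fin N)) (G : Graph N ℓ M r) (b : Fin M) :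
    (defLocs S G b).card ≤ ones (fun s => occ S G (b, s)) :=
  Finset.card_image_le.trans ((Finset.card_attach).le.trans (card_defItems_le S G b))

theorem sum_ones_occ (S : Finset (Fin N)) (G : Graph N ℓ M r) :
    ∑ b, ones (fun s => occ S G (b, s)) = S.card * ℓ := by
  rw [← ones_occ S G]
  simp only [ones, Finset.card_filter]
  rw [Fintype.sum_prod_type]

/-- The test results of one section of a bin, when the defective items have the locations `D` and
the section uses the permutation `ρ`. -/
def sectionWord (C : BinCode (Nat.clog 2 r) L) (D : Finset (Fin r)) (x : Bool → Fin L → Bool)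
    (ρ : Equiv.Perm (Fin r)) (side : Bool) (t : Fin L) : Bool :=
  xor (decide (∃ j ∈ D, xor side (C.enc (bits (ρ j)) t) = true)) (x side t)

theorem testResults_eq_sectionWord (C : BinCode (Nat.clog 2 r) L) (G : Graph N ℓ M r)
    (π : SigPerms p r) (S : Finset (Fin N)) (w : TestIndex M p L → Bool) (b : Fin M) (i : Fin p)
    (side : Bool) (t : Fin L) :
    testResults C G π S w (b, i, side, t) = sectionWord C (defLocs S G b)
      (fun side t => w (b, i, side, t)) (sectionPerm π i) side t := by
  rw [testResults_apply, sectionWord]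
  congr 1
  rw [decide_eq_decide]
  constructor
  · rintro ⟨v, hv, hvS, h⟩
    exact ⟨loc G b v hv, (mem_defLocs hv).2 hvS, h⟩
  · rintro ⟨j, hj, h⟩
    obtain ⟨v, _, rfl⟩ := Finset.mem_image.1 hj
    obtain ⟨hv1, hv2⟩ := Finset.mem_filter.1 v.2
    exact ⟨v.1, hv1, hv2, h⟩

theorem sectionWord_congr (C : BinCode (Nat.clog 2 r) L) {D : Finset (Fin r)}
    (x : Bool → Fin L → Bool) {ρ ρ' : Equiv.Perm (Fin r)} (h : ∀ j ∈ D, ρ j = ρ' j) :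
    sectionWord C D x ρ = sectionWord C D x ρ' := by
  funext side t
  rw [sectionWord, sectionWord]
  congr 1
  rw [decide_eq_decide]
  refine exists_congr fun j => and_congr_right fun hj => ?_
  rw [h j hj]

-- The word of a section depends on its permutation only through the values at the defective
-- locations, which is what `card_sigPerms_hit_le` requires. The noise and the code are arbitrary
-- here. The double-ton analogue needs `a` to be a defective location, so that its codeword too is
-- determined by these values.
open Classical in
theorem card_declares_firstHalves_le (hp : 1 ≤ p) (C : BinCode (Nat.clog 2 r) L) (G : Graph N ℓ M r)
    (S : Finset (Fin N)) (w : TestIndex M p L → Bool) (b : Fin M) :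
    (Finset.univ.filter fun π : SigPerms p r => ∃ j ∉ defLocs S G b,
      Declares C π (firstHalves (testResults C G π S w) b) j).card
        * (r - (defLocs S G b).card) ^ (p - 1) ≤ r.factorial ^ (p - 1) := by
  have := card_sigPerms_hit_le hp (defLocs S G b)
    (fun i ρ => C.dec (sectionWord C (defLocs S G b) (fun side t => w (b, i, side, t)) ρ false))
    bits_injective (fun i ρ ρ' h => by rw [sectionWord_congr C _ h])
  refine le_trans (le_of_eq ?_) this
  congr 2
  ext π
  rw [Finset.mem_filter, Finset.mem_filter]
  refine and_congr_right fun _ => exists_congr fun j => and_congr_right fun _ =>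
    forall_congr' fun i => ?_
  have : firstHalves (testResults C G π S w) b i
      = sectionWord C (defLocs S G b) (fun side t => w (b, i, side, t)) (sectionPerm π i) false := by
    funext t
    rw [firstHalves, testResults_eq_sectionWord]
  rw [this]

open Classical in
theorem card_declares_residual_le (hp : 1 ≤ p) (C : BinCode (Nat.clog 2 r) L) (G : Graph N ℓ M r)
    (S : Finset (Fin N)) (w : TestIndex M p L → Bool) (b : Fin M) {a : Fin r}
    (ha : a ∈ defLocs S G b) :
    (Finset.univ.filter fun π : SigPerms p r => ∃ j ∉ defLocs S G b,
      Declares C π (residual C π (testResults C G π S w) b a) j).card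
        * (r - (defLocs S G b).card) ^ (p - 1) ≤ r.factorial ^ (p - 1) := by
  have := card_sigPerms_hit_le hp (defLocs S G b)
    (fun i ρ => C.dec (fun t => if C.enc (bits (ρ a)) t then
      !(sectionWord C (defLocs S G b) (fun side t => w (b, i, side, t)) ρ true t)
      else sectionWord C (defLocs S G b) (fun side t => w (b, i, side, t)) ρ false t))
    bits_injective (fun i ρ ρ' h => by rw [sectionWord_congr C _ h, h a ha])
  refine le_trans (le_of_eq ?_) this
  congr 2
  ext π
  rw [Finset.mem_filter, Finset.mem_filter]
  refine and_congr_right fun _ => exists_congr fun j => and_congr_right fun _ =>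
    forall_congr' fun i => ?_
  have : residual C π (testResults C G π S w) b a i = fun t =>
      if C.enc (bits (sectionPerm π i a)) t then
      !(sectionWord C (defLocs S G b) (fun side t => w (b, i, side, t)) (sectionPerm π i) true t)
      else sectionWord C (defLocs S G b) (fun side t => w (b, i, side, t)) (sectionPerm π i) false t := by
    funext t
    rw [residual, testResults_eq_sectionWord, testResults_eq_sectionWord]
    rfl
  rw [this]

/-- A false alarm requires that a location without a defective item is declared, by the singleton
rule, or by the double-ton rule for a defective item. -/
theorem exists_declares_of_not_noFalseAlarm {C : BinCode (Nat.clog 2 r) L} {S : Finset (Fin N)}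
    {G : Graph N ℓ M r} {π : SigPerms p r} {w : TestIndex M p L → Bool}
    (h : ¬ NoFalseAlarm C S G π w) :
    ∃ b, (∃ j ∉ defLocs S G b, Declares C π (firstHalves (testResults C G π S w) b) j) ∨
      ∃ a ∈ defLocs S G b, ∃ j ∉ defLocs S G b,
        Declares C π (residual C π (testResults C G π S w) b a) j := by
  by_contra hcon
  push Not at hcon
  apply h
  intro v hv
  -- As long as no false item is declared, every known item of a bin is defective; so the first
  -- false alarm is a singleton declaration or a double-ton declaration starting from a defective
  -- item.
  induction hv with
  | singleton b v hv hd =>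
    by_contra hS
    exact (hcon b).1 _ (fun hm => hS ((mem_defLocs hv).1 hm)) hd
  | doubleton b u v hu hv _ hd ih =>
    by_contra hS
    exact (hcon b).2 _ ((mem_defLocs hu).2 ih) _ (fun hm => hS ((mem_defLocs hv).1 hm)) hd

-- Union bound over one singleton decision per bin and one double-ton decision per defective
-- location of a bin, at most `M + S.card * ℓ` in all. The hypothesis `hd` leaves at least `r / 2`
-- non-defective locations in each bin.
open Classical in
theorem card_falseAlarm_le (hp : 1 ≤ p) (C : BinCode (Nat.clog 2 r) L) (G : Graph N ℓ M r)
    (S : Finset (Fin N)) (w : TestIndex M p L → Bool) (hr : 0 < r)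
    (hd : ∀ b, 2 * (ones (fun s => occ S G (b, s)) : ℝ) ≤ r) :
    ((Finset.univ.filter fun π : SigPerms p r => ¬ NoFalseAlarm C S G π w).card : ℝ)
      ≤ Fintype.card (SigPerms p r) * (((M : ℝ) + S.card * ℓ) * (2 / r) ^ (p - 1)) := by
  set c : ℝ := ((Fintype.card (SigPerms p r) : ℕ) : ℝ) with hc
  have hc' : c = (r.factorial : ℝ) ^ (p - 1) := by
    rw [hc]
    simp [SigPerms, Fintype.card_perm]
  have hr' : (0 : ℝ) < r := by exact_mod_cast hr
  have hX : ∀ (b : Fin M) (X : ℕ), X * (r - (defLocs S G b).card) ^ (p - 1) ≤ r.factorial ^ (p - 1) →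
      (X : ℝ) ≤ c * (2 / r) ^ (p - 1) := by
    intro b X h
    have h1 : ((defLocs S G b).card : ℝ) ≤ r / 2 := by
      have : ((defLocs S G b).card : ℝ) ≤ (ones (fun s => occ S G (b, s)) : ℝ) := by
        exact_mod_cast card_defLocs_le S G b
      linarith [hd b]
    have h2 : (r : ℝ) / 2 ≤ ((r - (defLocs S G b).card : ℕ) : ℝ) := by
      rw [Nat.cast_sub]
      · linarith
      · have : ((defLocs S G b).card : ℝ) ≤ r := by linarith
        exact_mod_cast this
    have h3 : (X : ℝ) * ((r : ℝ) / 2) ^ (p - 1) ≤ c := by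
      rw [hc']
      calc (X : ℝ) * ((r : ℝ) / 2) ^ (p - 1)
          ≤ X * ((r - (defLocs S G b).card : ℕ) : ℝ) ^ (p - 1) := by gcongr
        _ ≤ _ := by exact_mod_cast h
    have h4 : ((r : ℝ) / 2) ^ (p - 1) * (2 / r) ^ (p - 1) = 1 := by
      rw [← mul_pow]
      have : (r : ℝ) / 2 * (2 / r) = 1 := by field_simp
      rw [this, one_pow]
    calc (X : ℝ) = X * ((r : ℝ) / 2) ^ (p - 1) * (2 / r) ^ (p - 1) := by
          rw [mul_assoc, h4, mul_one]
      _ ≤ c * (2 / r) ^ (p - 1) := by gcongr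
  let Q₁ : Fin M → Finset (SigPerms p r) := fun b => Finset.univ.filter fun π =>
    ∃ j ∉ defLocs S G b, Declares C π (firstHalves (testResults C G π S w) b) j
  let Q₂ : Fin M → Fin r → Finset (SigPerms p r) := fun b a => Finset.univ.filter fun π =>
    ∃ j ∉ defLocs S G b, Declares C π (residual C π (testResults C G π S w) b a) j
  have hsub : (Finset.univ.filter fun π : SigPerms p r => ¬ NoFalseAlarm C S G π w)
      ⊆ Finset.univ.biUnion fun b => Q₁ b ∪ (defLocs S G b).biUnion (Q₂ b) := by
    intro π hπ
    obtain ⟨b, h⟩ := exists_declares_of_not_noFalseAlarm (Finset.mem_filter.1 hπ).2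
    refine Finset.mem_biUnion.2 ⟨b, Finset.mem_univ _, Finset.mem_union.2 ?_⟩
    rcases h with h | ⟨a, ha, h⟩
    · exact Or.inl (Finset.mem_filter.2 ⟨Finset.mem_univ _, h⟩)
    · exact Or.inr (Finset.mem_biUnion.2 ⟨a, ha, Finset.mem_filter.2 ⟨Finset.mem_univ _, h⟩⟩)
  have hcard : (Finset.univ.filter fun π : SigPerms p r => ¬ NoFalseAlarm C S G π w).card
      ≤ ∑ b, ((Q₁ b).card + ∑ a ∈ defLocs S G b, (Q₂ b a).card) := by
    refine (Finset.card_le_card hsub).trans (Finset.card_biUnion_le.trans ?_)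
    refine Finset.sum_le_sum fun b _ => (Finset.card_union_le _ _).trans ?_
    exact Nat.add_le_add_left Finset.card_biUnion_le _
  calc ((Finset.univ.filter fun π : SigPerms p r => ¬ NoFalseAlarm C S G π w).card : ℝ)
      ≤ ∑ b, (((Q₁ b).card : ℝ) + ∑ a ∈ defLocs S G b, ((Q₂ b a).card : ℝ)) := by
        exact_mod_cast hcard
    _ ≤ ∑ b, (c * (2 / r) ^ (p - 1) + ∑ _a ∈ defLocs S G b, c * (2 / r) ^ (p - 1)) := by
        refine Finset.sum_le_sum fun b _ => add_le_add ?_ (Finset.sum_le_sum fun a ha => ?_)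
        · exact hX b _ (card_declares_firstHalves_le hp C G S w b)
        · exact hX b _ (card_declares_residual_le hp C G S w b ha)
    _ = ((M : ℝ) + ((∑ b, (defLocs S G b).card : ℕ) : ℝ)) * (c * (2 / r) ^ (p - 1)) := by
        simp only [Finset.sum_const, nsmul_eq_mul, Finset.sum_add_distrib, Finset.card_univ,
          Fintype.card_fin, Nat.cast_sum, Finset.sum_mul, add_mul]
    _ ≤ ((M : ℝ) + S.card * ℓ) * (c * (2 / r) ^ (p - 1)) := by
        have h5 : ∑ b, (defLocs S G b).card ≤ S.card * ℓ := by
          rw [← sum_ones_occ S G]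
          exact Finset.sum_le_sum fun b _ => card_defLocs_le S G b
        have h6 : ((∑ b, (defLocs S G b).card : ℕ) : ℝ) ≤ S.card * ℓ := by exact_mod_cast h5
        gcongr
    _ = _ := by ring

open Classical in
/-- Probability of a false alarm. -/
theorem prob_falseAlarm_le {q : ℝ} (h0 : 0 ≤ q) (h1 : q ≤ 1) (hp : 1 ≤ p)
    (C : BinCode (Nat.clog 2 r) L) (S : Finset (Fin N)) (hMr : M * r = N * ℓ) (hpos : 0 < M * r)
    (hG : 0 < Fintype.card (Graph N ℓ M r)) :
    prob (N := N) (ℓ := ℓ) (M := M) (r := r) (p := p) (L := L) q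
        (fun G π w => ¬ NoFalseAlarm C S G π w)
      ≤ ((M : ℝ) + S.card * ℓ) * (2 / r) ^ (p - 1) + (4 * ((S.card * ℓ : ℕ) : ℝ) + 2) *
        (M * Real.exp (8 * (r * (((S.card * ℓ : ℕ) : ℝ) / ((M * r : ℕ) : ℝ))) - r)) := by
  have hr : 0 < r := Nat.pos_of_mul_pos_left hpos
  set A : ℝ := ((M : ℝ) + S.card * ℓ) * (2 / r) ^ (p - 1) with hA
  have hA0 : 0 ≤ A := by positivity
  set θ : ℝ := ((S.card * ℓ : ℕ) : ℝ) / ((M * r : ℕ) : ℝ) with hθ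
  have hθ0 : 0 ≤ θ := by positivity
  have hθ1 : θ ≤ 1 := by
    have hkM : S.card * ℓ ≤ M * r := by
      rw [hMr]
      refine Nat.mul_le_mul_right ℓ ?_
      simpa using Finset.card_le_univ S
    rw [hθ, div_le_one (by exact_mod_cast hpos)]; exact_mod_cast hkM
  -- Graphs with a bin at least half full of defective sockets are paid for by the second summand of
  -- the bound.
  let big : (Fin M × Fin r → Bool) → ℝ := fun w =>
    if ∃ b, (r : ℝ) / 2 ≤ (ones (fun s => w (b, s)) : ℝ) then 1 else 0
  have hbig0 : ∀ w, 0 ≤ big w := by intro w; simp only [big]; split_ifs <;> norm_num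
  have hcpos : (0 : ℝ) < Fintype.card (SigPerms p r) := by exact_mod_cast Fintype.card_pos
  have hg : ∀ G : Graph N ℓ M r, (∑ π : SigPerms p r,
      noiseExp q (fun w : TestIndex M p L → Bool =>
        if ¬ NoFalseAlarm C S G π w then (1 : ℝ) else 0)) / Fintype.card (SigPerms p r)
      ≤ big (occ S G) + A := by
    intro G
    rw [div_le_iff₀ hcpos, ← noiseExp_sum]
    have hpt : ∀ w : TestIndex M p L → Bool,
        ∑ π : SigPerms p r, (if ¬ NoFalseAlarm C S G π w then (1 : ℝ) else 0)
        ≤ (big (occ S G) + A) * Fintype.card (SigPerms p r) := by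
      intro w
      rw [Finset.sum_boole]
      by_cases hd : ∃ b, (r : ℝ) / 2 ≤ (ones (fun s => occ S G (b, s)) : ℝ)
      · have : big (occ S G) = 1 := if_pos hd
        rw [this]
        have h2 : ((Finset.univ.filter fun π : SigPerms p r => ¬ NoFalseAlarm C S G π w).card : ℝ)
            ≤ Fintype.card (SigPerms p r) := by
          exact_mod_cast Finset.card_le_univ _
        nlinarith
      · push Not at hd
        have := card_falseAlarm_le hp C G S w hr (fun b => by linarith [hd b])
        have := hbig0 (occ S G)
        nlinarith
    refine (noiseExp_mono h0 h1 hpt).trans (le_of_eq ?_)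
    rw [noiseExp_const]
  rw [prob_eq_noiseExp]
  have hgpos : (0 : ℝ) < Fintype.card (Graph N ℓ M r) := by exact_mod_cast hG
  rw [mul_comm, ← div_div, Finset.sum_div, div_le_iff₀ hgpos]
  refine (Finset.sum_le_sum fun G _ => hg G).trans ?_
  rw [Finset.sum_add_distrib, Finset.sum_const, Finset.card_univ, nsmul_eq_mul, add_comm, add_mul,
    mul_comm A]
  refine add_le_add le_rfl ?_
  refine (sum_graph_occ_le S hMr hpos hbig0).trans ?_
  rw [mul_comm]
  refine mul_le_mul_of_nonneg_right (mul_le_mul_of_nonneg_left ?_ (by positivity)) hgpos.le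
  have := noiseExp_max_occupancy_le (α := Fin M) (β := Fin r) (h := (r : ℝ) / 2) hθ0 hθ1
  rw [Fintype.card_fin, Fintype.card_fin, mul_div_cancel₀ _ (two_ne_zero)] at this
  refine le_trans (le_of_eq ?_) this
  refine congrArg (noiseExp θ) (funext fun w => ?_)
  simp only [big]
  congr

end falseAlarm

/-! ### Density evolution -/

/-- The strict inequality that makes the exploration of unmarked items subcritical. -/
def Subcritical (ε : ℝ) (ℓ : ℕ) (c t : ℝ) : Prop :=
  0 < t ∧ t < 1 ∧ t ^ ℓ < ε ∧
    1 - Real.exp (-(ℓ / c)) - ℓ / c * Real.exp (-(ℓ / c)) * (1 - t ^ (ℓ - 1)) < t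

/-- The limit `a` is a fixed point `u ^ (ℓ - 1)`, where `u` is the survival probability of one
socket. An item survives with probability `u ^ ℓ = a * u < a ≤ ε`; this strict gap leaves room to
move from `u` to a slightly larger `t`. Convexity of the power makes the drift inequality strict
there. -/
theorem exists_subcritical_of_densityEvolution {ε c : ℝ} {ℓ : ℕ} (hε1 : ε < 1) (hc : 0 < c)
    (h : DensityEvolution ε ℓ c) : 2 ≤ ℓ ∧ ∃ t, Subcritical ε ℓ c t := by
  obtain ⟨a, haε, ha⟩ := h
  have hℓ : 2 ≤ ℓ := by
    by_contra hlt
    have h0 : ℓ - 1 = 0 := by omega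
    -- For `ℓ ≤ 1` the exponent `ℓ - 1` is `0`, so density evolution stays at `1` and contradicts `ε
    -- < 1`.
    have h1 : ∀ x, deStep ℓ c x = 1 := fun x => by rw [deStep, h0, pow_zero]
    have h2 : ∀ j : ℕ, (deStep ℓ c)^[j] 1 = 1 := fun j => Function.iterate_fixed (h1 1) j
    simp only [h2] at ha
    have := tendsto_nhds_unique ha tendsto_const_nhds
    linarith
  refine ⟨hℓ, ?_⟩
  set l : ℝ := ℓ / c with hl
  have hlpos : 0 < l := by
    rw [hl]; refine div_pos ?_ hc
    exact_mod_cast (by omega : 0 < ℓ)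
  set ρ₁ := Real.exp (-l) with hρ₁
  set ρ₂ := l * ρ₁ with hρ₂
  have hρ₁0 : 0 < ρ₁ := Real.exp_pos _
  have hρ₂0 : 0 < ρ₂ := by positivity
  have hρ : ρ₁ + ρ₂ < 1 := by
    have h1 := Real.add_one_lt_exp hlpos.ne'
    have h2 : Real.exp l * ρ₁ = 1 := by rw [hρ₁, ← Real.exp_add]; simp
    nlinarith
  have hstep : ∀ x, deStep ℓ c x = (1 - (ρ₁ + ρ₂ * (1 - x))) ^ (ℓ - 1) := fun x => rfl
  have hmap : ∀ x ∈ Set.Icc (0 : ℝ) 1, deStep ℓ c x ∈ Set.Icc (0 : ℝ) 1 := by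
    rintro x ⟨hx0, hx1⟩
    rw [hstep]
    have h1 : 0 ≤ 1 - (ρ₁ + ρ₂ * (1 - x)) := by nlinarith
    exact ⟨pow_nonneg h1 _, pow_le_one₀ h1 (by nlinarith)⟩
  have hit : ∀ j : ℕ, (deStep ℓ c)^[j] 1 ∈ Set.Icc (0 : ℝ) 1 := by
    intro j
    induction j with
    | zero => simp
    | succ j ih => rw [Function.iterate_succ_apply']; exact hmap _ ih
  have haI : a ∈ Set.Icc (0 : ℝ) 1 := isClosed_Icc.mem_of_tendsto ha (Eventually.of_forall hit)
  have hcont : Continuous (deStep ℓ c) := by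
    have : deStep ℓ c = fun x => (1 - (ρ₁ + ρ₂ * (1 - x))) ^ (ℓ - 1) := funext hstep
    rw [this]; fun_prop
  have hfix : deStep ℓ c a = a := isFixedPt_of_tendsto_iterate ha hcont.continuousAt
  set u := 1 - (ρ₁ + ρ₂ * (1 - a)) with hu
  have hua : u ^ (ℓ - 1) = a := by rw [← hstep] at *; exact hfix
  have hu0 : 0 < u := by rw [hu]; nlinarith [haI.1]
  have hu1 : u < 1 := by rw [hu]; nlinarith [haI.2]
  have huε : u ^ ℓ < ε := by
    have h1 : u ^ ℓ = a * u := by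
      rw [← hua, ← pow_succ]; congr 1; omega
    have h2 : 0 < a := by rw [← hua]; positivity
    rw [h1]; nlinarith
  have hcts : Tendsto (fun s : ℝ => (u + s * (1 - u)) ^ ℓ) (𝓝[>] 0) (𝓝 (u ^ ℓ)) := by
    have : Continuous fun s : ℝ => (u + s * (1 - u)) ^ ℓ := by fun_prop
    have h2 := this.tendsto 0
    simp only [zero_mul, add_zero] at h2
    exact h2.mono_left nhdsWithin_le_nhds
  have hev1 : ∀ᶠ s in 𝓝[>] (0 : ℝ), (u + s * (1 - u)) ^ ℓ < ε :=
    hcts.eventually (gt_mem_nhds huε)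
  have hev2 : ∀ᶠ s in 𝓝[>] (0 : ℝ), s < 1 :=
    (eventually_lt_nhds (show (0 : ℝ) < 1 by norm_num)).filter_mono nhdsWithin_le_nhds
  obtain ⟨s, hs1, hs2, hs3⟩ := (hev1.and (hev2.and self_mem_nhdsWithin)).exists
  have hs3' : 0 < s := hs3
  -- Along the segment from `u` to `1` the slack in the drift inequality is at least `s * ρ₁`.
  refine ⟨u + s * (1 - u), by nlinarith, by nlinarith, hs1, ?_⟩
  have hconv := ((convexOn_pow (ℓ - 1) : ConvexOn ℝ (Set.Ici 0) fun x : ℝ => x ^ (ℓ - 1)).2)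
    (Set.mem_Ici.2 hu0.le) (Set.mem_Ici.2 (zero_le_one' ℝ))
    (show 0 ≤ 1 - s by linarith) hs3'.le (by ring)
  simp only [smul_eq_mul, one_pow, mul_one, hua] at hconv
  have he : (1 - s) * u + s = u + s * (1 - u) := by ring
  rw [he] at hconv
  have h3 := mul_le_mul_of_nonneg_left hconv hρ₂0.le
  have h4 : u = 1 - ρ₁ - ρ₂ + ρ₂ * a := by rw [hu]; ring
  have h5 : 0 < s * ρ₁ := by positivity
  nlinarith

/-- Reduces the transcendental condition to rational arithmetic through `exp (1 - l) ≥ 2 - l`, the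
tangent at `l = 1`. It is accurate enough because `l = ℓ / c` is close to `1` for all tabulated
constants. -/
theorem subcritical_of_le {ε c t : ℝ} {ℓ : ℕ} (hc : 0 < c) (ht0 : 0 < t) (ht1 : t < 1)
    (htε : t ^ ℓ < ε) (h : 2.7182818286 * (1 - t) * c ^ 2
      < (2 * c - ℓ) * (c + ℓ * (1 - t ^ (ℓ - 1)))) : Subcritical ε ℓ c t := by
  refine ⟨ht0, ht1, htε, ?_⟩
  set l : ℝ := ℓ / c with hl
  have hl0 : 0 ≤ l := by positivity
  have hlc : (ℓ : ℝ) = l * c := by rw [hl]; field_simp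
  have h1 : 2.7182818286 * (1 - t) < (2 - l) * (1 + l * (1 - t ^ (ℓ - 1))) := by
    have hc2 : 0 < c ^ 2 := by positivity
    refine lt_of_mul_lt_mul_right ?_ hc2.le
    calc _ < _ := h
      _ = _ := by rw [hlc]; ring
  have h2 : 2 - l ≤ 2.7182818286 * Real.exp (-l) := by
    have h3 := Real.add_one_le_exp (1 - l)
    have h4 : Real.exp (1 - l) = Real.exp 1 * Real.exp (-l) := by
      rw [← Real.exp_add]; congr 1
    have h5 := Real.exp_one_lt_d9
    have h6 := Real.exp_pos (-l)
    nlinarith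
  have h7 : 0 ≤ 1 + l * (1 - t ^ (ℓ - 1)) := by
    have : t ^ (ℓ - 1) ≤ 1 := pow_le_one₀ ht0.le ht1.le
    have : 0 ≤ l * (1 - t ^ (ℓ - 1)) := mul_nonneg hl0 (by linarith)
    linarith
  have h8 := mul_le_mul_of_nonneg_right h2 h7
  have h9 : 2.7182818286 * (1 - t)
      < 2.7182818286 * (Real.exp (-l) * (1 + l * (1 - t ^ (ℓ - 1)))) := by linarith
  have h10 := lt_of_mul_lt_mul_left h9 (by norm_num)
  linarith

/-- The constants are rounded, so the limit of density evolution is avoided. Each witness is `ε ^ (1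
/ ℓ)` rounded down to two decimals, which leaves ample room in the drift inequality. -/
theorem exists_subcritical_of_table {ε c : ℝ} {ℓ : ℕ} (h : (ε, c, ℓ) ∈ constantsTable) :
    2 ≤ ℓ ∧ ∃ t, Subcritical ε ℓ c t := by
  simp only [constantsTable, Set.mem_insert_iff, Set.mem_singleton_iff, Prod.mk.injEq] at h
  rcases h with ⟨rfl, rfl, rfl⟩ | ⟨rfl, rfl, rfl⟩ | ⟨rfl, rfl, rfl⟩ | ⟨rfl, rfl, rfl⟩ |
    ⟨rfl, rfl, rfl⟩ | ⟨rfl, rfl, rfl⟩ | ⟨rfl, rfl, rfl⟩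
  · exact ⟨by norm_num, 0.37, subcritical_of_le (by norm_num) (by norm_num) (by norm_num)
      (by norm_num) (by norm_num)⟩
  · exact ⟨by norm_num, 0.35, subcritical_of_le (by norm_num) (by norm_num) (by norm_num)
      (by norm_num) (by norm_num)⟩
  · exact ⟨by norm_num, 0.31, subcritical_of_le (by norm_num) (by norm_num) (by norm_num)
      (by norm_num) (by norm_num)⟩
  · exact ⟨by norm_num, 0.31, subcritical_of_le (by norm_num) (by norm_num) (by norm_num)
      (by norm_num) (by norm_num)⟩
  · exact ⟨by norm_num, 0.31, subcritical_of_le (by norm_num) (by norm_num) (by norm_num)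
      (by norm_num) (by norm_num)⟩
  · exact ⟨by norm_num, 0.29, subcritical_of_le (by norm_num) (by norm_num) (by norm_num)
      (by norm_num) (by norm_num)⟩
  · exact ⟨by norm_num, 0.29, subcritical_of_le (by norm_num) (by norm_num) (by norm_num)
      (by norm_num) (by norm_num)⟩

/-! ### Exponential bounds -/

theorem eventually_poly_mul_exp_le (C : ℝ) {g γ : ℝ} (h : γ < g) :
    ∀ᶠ x : ℝ in atTop, C * (x + 1) * Real.exp (-(g * x)) ≤ Real.exp (-(γ * x)) := by
  have hb : 0 < g - γ := by linarith
  have h1 := isLittleO_pow_exp_pos_mul_atTop 1 hb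
  have h0 := isLittleO_pow_exp_pos_mul_atTop 0 hb
  have h2 := (h1.add h0).const_mul_left C
  filter_upwards [h2.bound one_pos] with x hx
  simp only [pow_one, pow_zero, one_mul, Real.norm_eq_abs, Real.abs_exp] at hx
  have h3 : C * (x + 1) ≤ Real.exp ((g - γ) * x) := (le_abs_self _).trans hx
  calc C * (x + 1) * Real.exp (-(g * x))
      ≤ Real.exp ((g - γ) * x) * Real.exp (-(g * x)) :=
        mul_le_mul_of_nonneg_right h3 (Real.exp_pos _).le
    _ = Real.exp (-(γ * x)) := by rw [← Real.exp_add]; congr 1; ring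

theorem eventually_lt_of_continuousAt {f g : ℝ → ℝ} (hf : ContinuousAt f 0) (hg : ContinuousAt g 0)
    (h : f 0 < g 0) : ∀ᶠ x in 𝓝[>] (0 : ℝ), f x < g x :=
  (hf.eventually_lt hg h).filter_mono nhdsWithin_le_nhds

/-- The moment bound for stuck sets is exponentially small for a suitable number of items. -/
theorem exists_moment_bound {ε t μ σ δ₀ : ℝ} {ℓ : ℕ} (hε1 : ε < 1) (ht0 : 0 < t)
    (htε : t ^ ℓ < ε) (hμ0 : 0 < μ) (hμ1 : μ < 1) (hσ : 0 < σ) (hδ₀ : 0 < δ₀) :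
    ∃ δ : ℝ, 0 < δ ∧ δ < δ₀ ∧ ∃ γ : ℝ, 0 < γ ∧ ∀ᶠ K : ℕ in atTop, ⌊δ * K⌋₊ < ⌊ε * K⌋₊ ∧
      ((K : ℝ) / (⌊ε * K⌋₊ - ⌊δ * K⌋₊)) ^ ⌊δ * K⌋₊ * (t ^ (ℓ * ⌊δ * K⌋₊) + μ ^ ⌊σ * K⌋₊)
        ≤ Real.exp (-(γ * K)) := by
  have hε0 : 0 < ε := lt_trans (by positivity) htε
  have hlμ : Real.log μ < 0 := Real.log_neg hμ0 hμ1
  -- The second `δ` absorbs rounding: `⌊ε K⌋ - ⌊δ K⌋ ≥ (ε - 2 δ) K` once `δ K ≥ 1`.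
  have e1 : ∀ᶠ δ in 𝓝[>] (0 : ℝ), t ^ ℓ < ε - 2 * δ :=
    eventually_lt_of_continuousAt (by fun_prop) (by fun_prop) (by simpa using htε)
  -- `σ` is fixed before `δ`, so for small `δ` the decay of `μ ^ (σ K)` beats the averaging factor
  -- `(1 / (ε - 2 δ)) ^ (δ K)`.
  have e2 : ∀ᶠ δ in 𝓝[>] (0 : ℝ), -(δ * Real.log (ε - 2 * δ)) + σ * Real.log μ < 0 := by
    refine eventually_lt_of_continuousAt (f := fun δ => -(δ * Real.log (ε - 2 * δ)) + σ * Real.log μ)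
      (g := fun _ => 0) ?_ continuousAt_const ?_
    · have : ContinuousAt (fun δ : ℝ => Real.log (ε - 2 * δ)) 0 :=
        ContinuousAt.log (by fun_prop) (by simpa using hε0.ne')
      exact ((continuousAt_id.mul this).neg).add continuousAt_const
    · simp only [zero_mul, neg_zero, zero_add]
      exact mul_neg_of_pos_of_neg hσ hlμ
  have e3 : ∀ᶠ δ in 𝓝[>] (0 : ℝ), δ < δ₀ :=
    (eventually_lt_nhds hδ₀).filter_mono nhdsWithin_le_nhds
  obtain ⟨δ, h1, h2, h3, h4⟩ := (e1.and (e2.and (e3.and self_mem_nhdsWithin))).exists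
  have hδ : 0 < δ := h4
  set e' := ε - 2 * δ with he'
  have htl : 0 < t ^ ℓ := by positivity
  have he'0 : 0 < e' := lt_trans htl h1
  have he'1 : e' < 1 := by linarith
  set A := t ^ ℓ / e' with hA
  have hA0 : 0 < A := by positivity
  have hA1 : A < 1 := by rw [hA, div_lt_one he'0]; exact h1
  have hlA : Real.log A < 0 := Real.log_neg hA0 hA1
  set g₁ := -(δ * Real.log A) with hg₁
  have hg₁0 : 0 < g₁ := by rw [hg₁]; nlinarith
  set g₂ := -(-(δ * Real.log e') + σ * Real.log μ) with hg₂
  have hg₂0 : 0 < g₂ := by rw [hg₂]; linarith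
  set γ := min g₁ g₂ / 2 with hγ
  have hmin : 0 < min g₁ g₂ := lt_min hg₁0 hg₂0
  refine ⟨δ, hδ, h3, γ, by positivity, ?_⟩
  have hp := (eventually_poly_mul_exp_le (1 / A + 1 / μ) (show γ < min g₁ g₂ by
    rw [hγ]; linarith)).natCast_atTop
  have hlarge : ∀ᶠ K : ℕ in atTop, 1 / δ < K :=
    tendsto_natCast_atTop_atTop.eventually_gt_atTop _
  filter_upwards [hp, hlarge] with K hK hKδ
  have hδK : 1 < δ * K := by rw [div_lt_iff₀ hδ] at hKδ; linarith
  have hK0 : (0 : ℝ) < K := by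
    by_contra hc
    push Not at hc
    nlinarith
  set m := ⌊δ * K⌋₊ with hm
  set a := ⌊ε * K⌋₊ with ha
  set s := ⌊σ * K⌋₊ with hs
  have hm1 : (m : ℝ) ≤ δ * K := Nat.floor_le (by positivity)
  have hm2 : δ * K - 1 < m := by have := Nat.lt_floor_add_one (δ * K); linarith
  have ha2 : ε * K - 1 < a := by have := Nat.lt_floor_add_one (ε * K); linarith
  have hs2 : σ * K - 1 < s := by have := Nat.lt_floor_add_one (σ * K); linarith
  have ham : e' * K ≤ (a : ℝ) - m := by rw [he']; nlinarith
  have he'K : 0 < e' * K := by positivity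
  refine ⟨?_, ?_⟩
  · have : (m : ℝ) < a := by linarith
    exact_mod_cast this
  have hratio : (K : ℝ) / (a - m) ≤ 1 / e' := by
    rw [div_le_div_iff₀ (by linarith) he'0]; linarith
  have hratio0 : 0 ≤ (K : ℝ) / (a - m) := div_nonneg hK0.le (by linarith)
  have b1 : (1 / e') ^ m * t ^ (ℓ * m) ≤ 1 / A * Real.exp (-(g₁ * K)) := by
    have : (1 / e') ^ m * t ^ (ℓ * m) = A ^ m := by
      rw [pow_mul, ← mul_pow, hA]; congr 1; ring
    rw [this, ← Real.rpow_natCast]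
    calc A ^ (m : ℝ) ≤ A ^ (δ * K - 1) :=
          Real.rpow_le_rpow_of_exponent_ge hA0 hA1.le hm2.le
      _ = A⁻¹ * Real.exp (-(g₁ * K)) := by
          rw [Real.rpow_sub_one hA0.ne', Real.rpow_def_of_pos hA0, hg₁, div_eq_inv_mul]
          congr 2; ring
      _ = _ := by rw [one_div]
  have b2 : (1 / e') ^ m * μ ^ s ≤ 1 / μ * Real.exp (-(g₂ * K)) := by
    have hinv : 1 ≤ 1 / e' := by rw [le_div_iff₀ he'0]; linarith
    have c1 : (1 / e') ^ m ≤ Real.exp (-(δ * Real.log e') * K) := by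
      rw [← Real.rpow_natCast]
      calc (1 / e') ^ (m : ℝ) ≤ (1 / e') ^ (δ * K) :=
            Real.rpow_le_rpow_of_exponent_le hinv hm1
        _ = _ := by
            rw [Real.rpow_def_of_pos (by positivity), one_div, Real.log_inv]
            congr 1; ring
    have c2 : μ ^ s ≤ μ⁻¹ * Real.exp (σ * Real.log μ * K) := by
      rw [← Real.rpow_natCast]
      calc μ ^ (s : ℝ) ≤ μ ^ (σ * K - 1) :=
            Real.rpow_le_rpow_of_exponent_ge hμ0 hμ1.le hs2.le
        _ = _ := by
            rw [Real.rpow_sub_one hμ0.ne', Real.rpow_def_of_pos hμ0, div_eq_inv_mul]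
            congr 2; ring
    calc (1 / e') ^ m * μ ^ s
        ≤ Real.exp (-(δ * Real.log e') * K) * (μ⁻¹ * Real.exp (σ * Real.log μ * K)) := by
          gcongr
      _ = 1 / μ * Real.exp (-(g₂ * K)) := by
          rw [mul_left_comm, ← Real.exp_add, one_div, hg₂]
          congr 2; ring
  have hmono : ∀ g, min g₁ g₂ ≤ g → Real.exp (-(g * K)) ≤ Real.exp (-(min g₁ g₂ * K)) := by
    intro g hg
    apply Real.exp_le_exp.2
    nlinarith
  calc ((K : ℝ) / (a - m)) ^ m * (t ^ (ℓ * m) + μ ^ s)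
      ≤ (1 / e') ^ m * (t ^ (ℓ * m) + μ ^ s) := by gcongr
    _ = (1 / e') ^ m * t ^ (ℓ * m) + (1 / e') ^ m * μ ^ s := mul_add _ _ _
    _ ≤ 1 / A * Real.exp (-(min g₁ g₂ * K)) + 1 / μ * Real.exp (-(min g₁ g₂ * K)) := by
        refine add_le_add (b1.trans ?_) (b2.trans ?_)
        · exact mul_le_mul_of_nonneg_left (hmono _ (min_le_left _ _)) (by positivity)
        · exact mul_le_mul_of_nonneg_left (hmono _ (min_le_right _ _)) (by positivity)
    _ = (1 / A + 1 / μ) * 1 * Real.exp (-(min g₁ g₂ * K)) := by ring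
    _ ≤ (1 / A + 1 / μ) * (K + 1) * Real.exp (-(min g₁ g₂ * K)) := by
        gcongr
        linarith
    _ ≤ _ := hK

/-! ### Choice of constants and the exponential bound for stuck sets. -/

/-- A slack for all inequalities used in the exploration. -/
theorem exists_slack {ρ₁ ρ₂ t : ℝ} {ℓ : ℕ} (hℓ : 2 ≤ ℓ) (hρ₁ : 0 < ρ₁) (hρ₂ : 0 < ρ₂)
    (ht0 : 0 < t) (ht1 : t < 1) (hsub : 1 - ρ₁ - ρ₂ * (1 - t ^ (ℓ - 1)) < t) :
    ∃ x : ℝ, 0 < x ∧ x < 1 ∧ x < ρ₁ / 2 ∧ x < ρ₂ / 4 ∧ t ^ (ℓ - 1) + x < 1 ∧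
      1 - ((1 - x) * (ρ₁ - x) - x) < (1 - ρ₁ / 2) * (1 - x ^ 2) ∧
      1 - ((1 - x) * (ρ₁ - x) - x) - 2 * ((1 - x) * (ρ₂ / 2 - x) - x) * (1 - t ^ (ℓ - 1) - x)
        + x ^ 2 < t * (1 - x ^ 2) ∧
      ℓ * x < t * (1 - 2 * x ^ 2) := by
  have htl : t ^ (ℓ - 1) < 1 := pow_lt_one₀ ht0.le ht1 (by omega)
  -- All conditions are continuous and strict at `x = 0`, where the three drift conditions read `1 -
  -- ρ₁ < 1 - ρ₁ / 2`, `hsub` and `0 < t`. The one parameter `x` serves as Chernoff deviation, as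
  -- `ζ`, as error of the Poisson approximation and as bound for the faulty bins per socket; the
  -- exploration budget is the fraction `x ^ 2` of the sockets.
  have e1 : ∀ᶠ x in 𝓝[>] (0 : ℝ), x < 1 :=
    (eventually_lt_nhds one_pos).filter_mono nhdsWithin_le_nhds
  have e2 : ∀ᶠ x in 𝓝[>] (0 : ℝ), x < ρ₁ / 2 :=
    (eventually_lt_nhds (by positivity)).filter_mono nhdsWithin_le_nhds
  have e3 : ∀ᶠ x in 𝓝[>] (0 : ℝ), x < ρ₂ / 4 :=
    (eventually_lt_nhds (by positivity)).filter_mono nhdsWithin_le_nhds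
  have e4 : ∀ᶠ x in 𝓝[>] (0 : ℝ), t ^ (ℓ - 1) + x < 1 :=
    eventually_lt_of_continuousAt (by fun_prop) (by fun_prop) (by simpa using htl)
  have e5 : ∀ᶠ x in 𝓝[>] (0 : ℝ),
      1 - ((1 - x) * (ρ₁ - x) - x) < (1 - ρ₁ / 2) * (1 - x ^ 2) :=
    eventually_lt_of_continuousAt (by fun_prop) (by fun_prop) (by norm_num; linarith)
  have e6 : ∀ᶠ x in 𝓝[>] (0 : ℝ),
      1 - ((1 - x) * (ρ₁ - x) - x) - 2 * ((1 - x) * (ρ₂ / 2 - x) - x) * (1 - t ^ (ℓ - 1) - x)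
        + x ^ 2 < t * (1 - x ^ 2) :=
    eventually_lt_of_continuousAt (by fun_prop) (by fun_prop) (by norm_num; linarith)
  have e7 : ∀ᶠ x in 𝓝[>] (0 : ℝ), ℓ * x < t * (1 - 2 * x ^ 2) :=
    eventually_lt_of_continuousAt (by fun_prop) (by fun_prop) (by norm_num; linarith)
  obtain ⟨x, h1, h2, h3, h4, h5, h6, h7, h8⟩ :=
    (e1.and (e2.and (e3.and (e4.and (e5.and (e6.and (e7.and self_mem_nhdsWithin))))))).exists
  exact ⟨x, h8, h1, h2, h3, h4, h5, h6, h7⟩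

/-- From `(1 - θ)⁻¹ = 1 + θ / (1 - θ) ≤ exp (θ / (1 - θ))`. When `r θ` converges and `θ → 0`, the
left side tends to the Poisson weight of an empty bin. -/
theorem exp_neg_le_one_sub_pow {θ : ℝ} (h0 : 0 ≤ θ) (h1 : θ < 1) {r j : ℕ} (hj : j ≤ r) :
    Real.exp (-(r * θ / (1 - θ))) ≤ (1 - θ) ^ j := by
  have hpos : 0 < 1 - θ := by linarith
  have h2 : Real.exp (-(θ / (1 - θ))) ≤ 1 - θ := by
    have h3 := Real.add_one_le_exp (θ / (1 - θ))
    have h4 : θ / (1 - θ) + 1 = (1 - θ)⁻¹ := by field_simp; ring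
    rw [h4] at h3
    rw [Real.exp_neg]
    exact inv_le_of_inv_le₀ hpos h3
  calc Real.exp (-(r * θ / (1 - θ))) = Real.exp (-(θ / (1 - θ))) ^ r := by
        rw [← Real.exp_nat_mul]; congr 1; ring
    _ ≤ (1 - θ) ^ r := pow_le_pow_left₀ (Real.exp_pos _).le h2 r
    _ ≤ (1 - θ) ^ j := pow_le_pow_of_le_one hpos.le (by linarith) hj

/-- Expected numbers of bins with one and with two defective sockets. -/
theorem eventually_expected_occupancy {K M r : ℕ → ℕ} {ℓ : ℕ} {c x : ℝ} (hc : 0 < c)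
    (hx : 0 < x) (hK : Tendsto K atTop atTop)
    (hM : Tendsto (fun k => (M k : ℝ) / (K k : ℝ)) atTop (𝓝 c))
    (hr : Tendsto r atTop atTop) :
    ∀ᶠ k in atTop,
      (Real.exp (-(ℓ / c)) - x) * ((K k * ℓ : ℕ) : ℝ)
        ≤ M k * binomProb (r k) (((K k * ℓ : ℕ) : ℝ) / ((M k * r k : ℕ) : ℝ)) 1 ∧
      (ℓ / c * Real.exp (-(ℓ / c)) / 2 - x) * ((K k * ℓ : ℕ) : ℝ)
        ≤ M k * binomProb (r k) (((K k * ℓ : ℕ) : ℝ) / ((M k * r k : ℕ) : ℝ)) 2 := by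
  have hr' : Tendsto (fun k => (r k : ℝ)) atTop atTop := tendsto_natCast_atTop_atTop.comp hr
  set l : ℕ → ℝ := fun k => ℓ / ((M k : ℝ) / (K k : ℝ)) with hl
  have hlt : Tendsto l atTop (𝓝 (ℓ / c)) := tendsto_const_nhds.div hM hc.ne'
  set θ : ℕ → ℝ := fun k => l k / r k with hθ
  have hθt : Tendsto θ atTop (𝓝 0) := hlt.div_atTop hr'
  have hE : Tendsto (fun k => Real.exp (-(l k / (1 - θ k)))) atTop (𝓝 (Real.exp (-(ℓ / c)))) := by
    have h1 : Tendsto (fun k => l k / (1 - θ k)) atTop (𝓝 ((ℓ / c) / (1 - 0))) :=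
      hlt.div (tendsto_const_nhds.sub hθt) (by norm_num)
    rw [sub_zero, div_one] at h1
    exact (Real.continuous_exp.tendsto _).comp h1.neg
  -- With `l = r θ` and `n = M l` sockets, `M * r.choose 2 * θ ^ 2 = n * (l - θ) / 2`. The factor `1
  -- / 2` remains because bins are counted here, each holding two sockets.
  have hE2 : Tendsto (fun k => (l k - θ k) / 2 * Real.exp (-(l k / (1 - θ k)))) atTop
      (𝓝 (ℓ / c * Real.exp (-(ℓ / c)) / 2)) := by
    have := ((hlt.sub hθt).div_const 2).mul hE
    rw [sub_zero] at this
    convert this using 2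
    ring
  have ev1 := hE.eventually (lt_mem_nhds (show Real.exp (-(ℓ / c)) - x < Real.exp (-(ℓ / c)) by
    linarith))
  have ev2 := hE2.eventually (lt_mem_nhds (show ℓ / c * Real.exp (-(ℓ / c)) / 2 - x
    < ℓ / c * Real.exp (-(ℓ / c)) / 2 by linarith))
  have ev3 := hθt.eventually (gt_mem_nhds one_pos)
  have ev4 := hM.eventually (lt_mem_nhds hc)
  filter_upwards [ev1, ev2, ev3, ev4, hK.eventually_ge_atTop 1, hr.eventually_ge_atTop 2]
    with k h1 h2 h3 h4 h5 h6
  have hKpos : (0 : ℝ) < K k := by exact_mod_cast h5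
  have hMpos : (0 : ℝ) < M k := by
    by_contra hcon
    push Not at hcon
    have : (M k : ℝ) = 0 := le_antisymm hcon (by positivity)
    rw [this, zero_div] at h4
    exact lt_irrefl _ h4
  have hrpos : (0 : ℝ) < r k := by exact_mod_cast (by omega : 0 < r k)
  have eθ : ((K k * ℓ : ℕ) : ℝ) / ((M k * r k : ℕ) : ℝ) = θ k := by
    simp only [hθ, hl]; push_cast; field_simp
  have erθ : (r k : ℝ) * θ k = l k := by simp only [hθ]; field_simp
  have en : (M k : ℝ) * l k = ((K k * ℓ : ℕ) : ℝ) := by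
    simp only [hl]; push_cast; field_simp
  have hθ0 : 0 ≤ θ k := by simp only [hθ, hl]; positivity
  set n : ℝ := ((K k * ℓ : ℕ) : ℝ) with hn
  have hn0 : 0 ≤ n := by positivity
  rw [eθ]
  constructor
  · have hp := exp_neg_le_one_sub_pow hθ0 h3 (show r k - 1 ≤ r k by omega)
    rw [erθ] at hp
    calc (Real.exp (-(ℓ / c)) - x) * n ≤ (1 - θ k) ^ (r k - 1) * n :=
          mul_le_mul_of_nonneg_right (h1.le.trans hp) hn0
      _ = M k * binomProb (r k) (θ k) 1 := by
          rw [binomProb, Nat.choose_one_right, ← en, ← erθ]; ring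
  · have hp := exp_neg_le_one_sub_pow hθ0 h3 (show r k - 2 ≤ r k by omega)
    rw [erθ] at hp
    have hlθ : 0 ≤ (l k - θ k) / 2 := by
      rw [← erθ]
      have : (1 : ℝ) ≤ r k := by exact_mod_cast (by omega : 1 ≤ r k)
      nlinarith
    calc (ℓ / c * Real.exp (-(ℓ / c)) / 2 - x) * n
        ≤ ((l k - θ k) / 2 * (1 - θ k) ^ (r k - 2)) * n :=
          mul_le_mul_of_nonneg_right (h2.le.trans (mul_le_mul_of_nonneg_left hp hlθ)) hn0
      _ = M k * binomProb (r k) (θ k) 2 := by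
          rw [binomProb, Nat.cast_choose_two, ← en, ← erθ]; ring

theorem eventually_pos_of_ratio {K M : ℕ → ℕ} {c : ℝ} (hc : 0 < c)
    (hM : Tendsto (fun k => (M k : ℝ) / (K k : ℝ)) atTop (𝓝 c)) : ∀ᶠ k in atTop, 0 < M k := by
  filter_upwards [hM.eventually (lt_mem_nhds hc)] with k hk
  rcases Nat.eq_zero_or_pos (M k) with h | h
  · rw [h, Nat.cast_zero, zero_div] at hk
    exact absurd hk (lt_irrefl _)
  · exact h

/-- The drift inequalities of the exploration, with a slack `x`. -/
theorem drift_of_slack {x ρ₁ ρ₂ t T l n B f P₁ P₂ : ℝ} (hx0 : 0 < x) (hx1 : x < 1)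
    (hρ₁1 : ρ₁ < 1) (ht0 : 0 < t) (hl : 0 < l) (hn0 : 0 < n) (hx4 : T + x < 1)
    (hx5 : 1 - ((1 - x) * (ρ₁ - x) - x) < (1 - ρ₁ / 2) * (1 - x ^ 2))
    (hx6 : 1 - ((1 - x) * (ρ₁ - x) - x) - 2 * ((1 - x) * (ρ₂ / 2 - x) - x) * (1 - T - x) + x ^ 2
      < t * (1 - x ^ 2))
    (hx7 : l * x < t * (1 - 2 * x ^ 2)) (hBle : B ≤ x ^ 2 * n) (hx2n : 1 ≤ x ^ 2 * n)
    (hf : f ≤ x * n) (hP1 : (ρ₁ - x) * n ≤ P₁) (hP2 : (ρ₂ / 2 - x) * n ≤ P₂) :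
    n - ((1 - x) * P₁ - f) ≤ (1 - ρ₁ / 2) * (n - B) ∧
      n - ((1 - x) * P₁ - f) - 2 * ((1 - x) * P₂ - f) * (1 - T - x) + B ≤ t * (n - B) ∧
      l * B ≤ x * t * (n - B - 1) ∧ B + 1 < n := by
  have hQ1 : (1 - x) * ((ρ₁ - x) * n) ≤ (1 - x) * P₁ :=
    mul_le_mul_of_nonneg_left hP1 (by linarith)
  have hQ2 : (1 - x) * ((ρ₂ / 2 - x) * n) ≤ (1 - x) * P₂ :=
    mul_le_mul_of_nonneg_left hP2 (by linarith)
  have hx2 : 0 < 1 - 2 * x ^ 2 := by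
    have h1 : 0 < l * x := by positivity
    exact pos_of_mul_pos_right (h1.trans hx7) ht0.le
  refine ⟨?_, ?_, ?_, ?_⟩
  · have h1 := mul_lt_mul_of_pos_right hx5 hn0
    have h2 : (1 - ρ₁ / 2) * (n - x ^ 2 * n) ≤ (1 - ρ₁ / 2) * (n - B) :=
      mul_le_mul_of_nonneg_left (by linarith) (by linarith)
    linarith
  · have h1 := mul_lt_mul_of_pos_right hx6 hn0
    have h2 : t * (n - x ^ 2 * n) ≤ t * (n - B) :=
      mul_le_mul_of_nonneg_left (by linarith) ht0.le
    have h3 : 2 * ((1 - x) * ((ρ₂ / 2 - x) * n) - x * n) * (1 - T - x)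
        ≤ 2 * ((1 - x) * P₂ - f) * (1 - T - x) :=
      mul_le_mul_of_nonneg_right (by linarith) (by linarith)
    linarith
  · have h1 : l * B ≤ l * (x ^ 2 * n) := mul_le_mul_of_nonneg_left hBle hl.le
    have h2 : x * t * (n - 2 * (x ^ 2 * n)) ≤ x * t * (n - B - 1) :=
      mul_le_mul_of_nonneg_left (by linarith) (by positivity)
    have h3 : l * x * (x * n) ≤ t * (1 - 2 * x ^ 2) * (x * n) :=
      mul_le_mul_of_nonneg_right hx7.le (by positivity)
    linarith
  · have := mul_pos hx2 hn0
    linarith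

/-- Each halving of a rate, in `g / 2` and `γ₂ / 2`, pays for one prefactor linear in `K`. -/
theorem exp_bound_of_linear {K n x g d l P₁ P₂ W γ₁ γ₂ : ℝ} (hK : 0 ≤ K) (hn : n = K * l)
    (hl : 0 ≤ l) (hg : g = x ^ 2 / 2 * d) (hP₁ : d * K ≤ P₁) (hP₂ : d * K ≤ P₂)
    (hγ₂g : γ₂ ≤ g / 2) (hγ₂ : γ₂ ≤ γ₁) (hW : W ≤ Real.exp (-(γ₁ * K)))
    (hpoly : (8 * l + 4) * (K + 1) * Real.exp (-(g * K)) ≤ Real.exp (-(g / 2 * K)))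
    (hpoly2 : 2 * (K + 1) * Real.exp (-(γ₂ * K)) ≤ Real.exp (-(γ₂ / 2 * K))) :
    (4 * n + 2) * (Real.exp (-(x ^ 2 / 2 * P₁)) + Real.exp (-(x ^ 2 / 2 * P₂))) + W
      ≤ Real.exp (-(γ₂ / 2 * K)) := by
  have hn0 : 0 ≤ n := by rw [hn]; positivity
  have hexp : ∀ P, d * K ≤ P → Real.exp (-(x ^ 2 / 2 * P)) ≤ Real.exp (-(g * K)) := by
    intro P hP
    apply Real.exp_le_exp.2
    have : x ^ 2 / 2 * (d * K) ≤ x ^ 2 / 2 * P := mul_le_mul_of_nonneg_left hP (by positivity)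
    rw [hg]; linarith
  have hle : ∀ γ, γ₂ ≤ γ → Real.exp (-(γ * K)) ≤ Real.exp (-(γ₂ * K)) := by
    intro γ hγ
    exact Real.exp_le_exp.2 (neg_le_neg (mul_le_mul_of_nonneg_right hγ hK))
  have hfirst : (4 * n + 2) * (Real.exp (-(x ^ 2 / 2 * P₁)) + Real.exp (-(x ^ 2 / 2 * P₂)))
      ≤ Real.exp (-(γ₂ * K)) := by
    calc _ ≤ (4 * n + 2) * (Real.exp (-(g * K)) + Real.exp (-(g * K))) :=
          mul_le_mul_of_nonneg_left (add_le_add (hexp _ hP₁) (hexp _ hP₂)) (by linarith)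
      _ = (8 * n + 4) * Real.exp (-(g * K)) := by ring
      _ ≤ (8 * l + 4) * (K + 1) * Real.exp (-(g * K)) := by
          refine mul_le_mul_of_nonneg_right ?_ (Real.exp_pos _).le
          rw [hn]; nlinarith
      _ ≤ Real.exp (-(g / 2 * K)) := hpoly
      _ ≤ _ := hle _ hγ₂g
  have hone : (1 : ℝ) ≤ K + 1 := by linarith
  calc _ ≤ Real.exp (-(γ₂ * K)) + Real.exp (-(γ₂ * K)) :=
        add_le_add hfirst (hW.trans (hle _ hγ₂))
    _ = 2 * 1 * Real.exp (-(γ₂ * K)) := by ring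
    _ ≤ 2 * (K + 1) * Real.exp (-(γ₂ * K)) := by gcongr
    _ ≤ _ := hpoly2

open Classical in
/-- Large stuck sets are exponentially unlikely, uniformly over small sets of faulty bins. -/
theorem exists_stuck_bound {ε c t : ℝ} {ℓ : ℕ} (hℓ : 2 ≤ ℓ) (hc : 0 < c) (hε1 : ε < 1)
    (hsub : Subcritical ε ℓ c t) :
    ∃ γ : ℝ, 0 < γ ∧ ∃ φ : ℝ, 0 < φ ∧
      ∀ (N K M r : ℕ → ℕ) (S : (k : ℕ) → Finset (Fin (N k))),
        (∀ k, M k * r k = N k * ℓ) → (∀ k, (S k).card = K k) → Tendsto K atTop atTop →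
        Tendsto (fun k => (M k : ℝ) / (K k : ℝ)) atTop (𝓝 c) → Tendsto r atTop atTop →
        ∀ᶠ k in atTop, ∀ F : Finset (Fin (M k)), (F.card : ℝ) ≤ φ * K k →
          ((Finset.univ.filter fun G : Graph (N k) ℓ (M k) (r k) =>
            ∃ Z, Stuck (S k) F G Z ∧ ⌊ε * K k⌋₊ ≤ Z.card).card : ℝ)
          ≤ Fintype.card (Graph (N k) ℓ (M k) (r k)) * Real.exp (-(γ * K k)) := by
  obtain ⟨ht0, ht1, htε, hlt⟩ := hsub
  have hℓ0 : (0 : ℝ) < ℓ := by exact_mod_cast (by omega : 0 < ℓ)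
  set ρ₁ := Real.exp (-(ℓ / c)) with hρ₁
  set ρ₂ := ℓ / c * ρ₁ with hρ₂
  have hρ₁0 : 0 < ρ₁ := Real.exp_pos _
  have hρ₂0 : 0 < ρ₂ := by positivity
  have hρ₁1 : ρ₁ < 1 := by
    rw [hρ₁, Real.exp_lt_one_iff]
    have : (0 : ℝ) < ℓ / c := by positivity
    linarith
  obtain ⟨x, hx0, hx1, hxρ₁, hxρ₂, hx4, hx5, hx6, hx7⟩ := exists_slack hℓ hρ₁0 hρ₂0 ht0 ht1 hlt
  set μ := 1 - ρ₁ / 2 with hμ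
  have hμ0 : 0 < μ := by rw [hμ]; linarith
  have hμ1 : μ < 1 := by rw [hμ]; linarith
  -- Half of the budget `B = x ^ 2 K ℓ` goes to `s = σ K` steps of cost `ℓ + 2`, the other half to
  -- the `ℓ m` initial sockets, which is why `δ < x ^ 2 / 2` is requested below.
  set σ := x ^ 2 * ℓ / (2 * (ℓ + 2)) with hσ
  have hσ0 : 0 < σ := by positivity
  obtain ⟨δ, hδ0, hδ1, γ₁, hγ₁, hmom⟩ := exists_moment_bound (ℓ := ℓ) hε1 ht0 htε hμ0 hμ1
    hσ0 (show 0 < x ^ 2 / 2 by positivity)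
  set g := x ^ 2 / 2 * min (ρ₁ / 2) (ρ₂ / 4) with hg
  have hmin0 : 0 < min (ρ₁ / 2) (ρ₂ / 4) := lt_min (by positivity) (by positivity)
  have hg0 : 0 < g := by positivity
  set γ₂ := min (g / 2) γ₁ with hγ₂
  have hγ₂0 : 0 < γ₂ := lt_min (by positivity) hγ₁
  refine ⟨γ₂ / 2, by positivity, x * ℓ, by positivity, ?_⟩
  intro N K M r S hMr hS hK hM hr
  have hK' : Tendsto (fun k => (K k : ℝ)) atTop atTop := tendsto_natCast_atTop_atTop.comp hK
  have hpoly := hK'.eventually (eventually_poly_mul_exp_le (8 * ℓ + 4) (show g / 2 < g by linarith))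
  have hpoly2 := hK'.eventually (eventually_poly_mul_exp_le 2 (show γ₂ / 2 < γ₂ by linarith))
  filter_upwards [eventually_expected_occupancy (ℓ := ℓ) hc hx0 hK hM hr, hK.eventually hmom,
    hpoly, hpoly2, eventually_pos_of_ratio hc hM, hr.eventually_gt_atTop 0,
    hK'.eventually_ge_atTop (1 / x ^ 2), hK.eventually_ge_atTop 1]
    with k hocc hmomk hpolyk hpoly2k hMpos hrpos hKx hK1 F hF
  clear hpoly hpoly2
  obtain ⟨hP1, hP2⟩ := hocc
  obtain ⟨hma, hmomk⟩ := hmomk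
  set m := ⌊δ * K k⌋₊ with hm
  set a := ⌊ε * K k⌋₊ with ha
  set s := ⌊σ * K k⌋₊ with hs
  set n : ℝ := ((K k * ℓ : ℕ) : ℝ) with hn
  have hnK : n = K k * ℓ := by rw [hn]; push_cast; ring
  have hKpos : (0 : ℝ) < K k := by exact_mod_cast hK1
  have hℓ1 : (1 : ℝ) ≤ ℓ := by exact_mod_cast (by omega : 1 ≤ ℓ)
  have hKn : (K k : ℝ) ≤ n := by rw [hnK]; exact le_mul_of_one_le_right hKpos.le hℓ1
  have hn0 : 0 < n := by linarith
  set P₁ := (M k : ℝ) * binomProb (r k) (n / ((M k * r k : ℕ) : ℝ)) 1 with hP₁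
  set P₂ := (M k : ℝ) * binomProb (r k) (n / ((M k * r k : ℕ) : ℝ)) 2 with hP₂
  set B := ⌊x ^ 2 * n⌋₊ with hB
  clear_value B P₁ P₂ n m a s γ₂ g σ ρ₂ ρ₁
  have hBle : (B : ℝ) ≤ x ^ 2 * n := by rw [hB]; exact Nat.floor_le (by positivity)
  have hx2n : 1 ≤ x ^ 2 * n := by
    rw [div_le_iff₀ (by positivity)] at hKx
    calc 1 ≤ K k * x ^ 2 := hKx
      _ = x ^ 2 * K k := mul_comm _ _
      _ ≤ _ := mul_le_mul_of_nonneg_left hKn (sq_nonneg x)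
  have hFn : (F.card : ℝ) ≤ x * n := by rw [hnK]; linarith
  rw [← hρ₁] at hP1 hP2
  rw [← hρ₂] at hP2
  obtain ⟨d1, d2, d3, d4⟩ := drift_of_slack (f := F.card) (B := B) hx0 hx1 hρ₁1 ht0 hℓ0 hn0 hx4
    hx5 hx6 hx7 hBle hx2n hFn hP1 hP2
  have hcap : ℓ * m + (ℓ + 2) * s ≤ B := by
    rw [hB]
    apply Nat.le_floor
    have h1 : (m : ℝ) ≤ δ * K k := by rw [hm]; exact Nat.floor_le (by positivity)
    have h2 : (s : ℝ) ≤ σ * K k := by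
      rw [hs]; exact Nat.floor_le (mul_nonneg hσ0.le hKpos.le)
    have h3 : ((ℓ : ℝ) + 2) * σ = x ^ 2 * ℓ / 2 := by rw [hσ]; field_simp
    push_cast
    calc (ℓ : ℝ) * m + (ℓ + 2) * s ≤ ℓ * (x ^ 2 / 2 * K k) + (ℓ + 2) * (σ * K k) := by
          gcongr
          exact h1.trans (mul_le_mul_of_nonneg_right hδ1.le hKpos.le)
      _ = ℓ * (x ^ 2 / 2 * K k) + ((ℓ + 2) * σ) * K k := by ring
      _ = x ^ 2 * n := by rw [h3, hnK]; ring
  have hd1 : min (ρ₁ / 2) (ρ₂ / 4) * K k ≤ P₁ := by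
    refine le_trans (mul_le_mul ((min_le_left _ _).trans ?_) hKn hKpos.le ?_) hP1 <;> linarith
  have hd2 : min (ρ₁ / 2) (ρ₂ / 4) * K k ≤ P₂ := by
    refine le_trans (mul_le_mul ((min_le_right _ _).trans ?_) hKn hKpos.le ?_) hP2 <;> linarith
  have hfin := exp_bound_of_linear (x := x) hKpos.le hnK hℓ0.le hg hd1 hd2 (hγ₂.trans_le (min_le_left _ _))
    (hγ₂.trans_le (min_le_right _ _)) hmomk hpolyk hpoly2k
  have hcard : (((S k).card * ℓ : ℕ) : ℝ) = n := by rw [hS k, hn]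
  have key := card_stuck_le (S := S k) (F := F) (B := B) (a := a) (m := m) (s := s) (t := t)
    (μ := μ) (ζ := x) (η := x) (P₁ := P₁) (P₂ := P₂) (hMr k) (Nat.mul_pos hMpos hrpos) ht0 ht1.le
    hμ0.le (by omega) hx0.le hx1.le (by rw [hcard, hP₁]) (by rw [hcard, hP₂]) (by rw [hcard]; exact d1)
    (by rw [hcard]; exact d2) (by rw [hcard]; exact d3) hx0.le hx4.le
    (by rw [hn] at d4; rw [hS k]; exact_mod_cast d4) hcap hma
  refine key.trans (mul_le_mul_of_nonneg_left ?_ (Nat.cast_nonneg _))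
  rw [hcard, hS k]
  exact hfin

/-! ### The probability of insufficient recovery. -/

theorem card_graph_pos {N ℓ M r : ℕ} (hMr : M * r = N * ℓ) :
    0 < Fintype.card (Graph N ℓ M r) := by
  have : Nonempty (Graph N ℓ M r) :=
    ⟨Fintype.equivOfCardEq (by simp only [Fintype.card_prod, Fintype.card_fin]; exact hMr.symm)⟩
  exact Fintype.card_pos

/-- The error probabilities of the codes vanish when the number of locations grows. -/
theorem eventually_errorProb_le {q R κ : ℝ} (hκ : 0 < κ) {C : (n : ℕ) → BinCode n (codeLen R n)}
    (hC : ReliableCodes q R κ C) {r : ℕ → ℕ} (hr : Tendsto r atTop atTop) {δ : ℝ} (hδ : 0 < δ) :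
    ∀ᶠ k in atTop, ∀ x, errorProb q (C (Nat.clog 2 (r k))) x ≤ δ := by
  have hclog : Tendsto (fun k => Nat.clog 2 (r k)) atTop atTop := by
    refine tendsto_atTop.2 fun b => ?_
    filter_upwards [hr.eventually_ge_atTop (2 ^ b)] with k hk
    exact (Nat.pow_le_pow_iff_right one_lt_two).1 (hk.trans (Nat.le_pow_clog one_lt_two _))
  have hlim : Tendsto (fun n : ℕ => (2 : ℝ) ^ (-(κ * n))) atTop (𝓝 0) := by
    have h1 : ∀ n : ℕ, (2 : ℝ) ^ (-(κ * n)) = ((2 : ℝ) ^ (-κ)) ^ n := by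
      intro n
      rw [← Real.rpow_natCast, ← Real.rpow_mul two_pos.le]
      congr 1; ring
    simp only [h1]
    exact tendsto_pow_atTop_nhds_zero_of_lt_one (by positivity)
      (Real.rpow_lt_one_of_one_lt_of_neg one_lt_two (by linarith))
  have h2 := hC.and (hlim.eventually (gt_mem_nhds hδ))
  filter_upwards [hclog.eventually h2] with k hk x
  exact ((hk.1 x).trans hk.2).le

/-- The probability that too few defective items are recovered is exponentially small. -/
theorem exists_recovery_bound {q R κ ε c t : ℝ} {ℓ p : ℕ} (hq0 : 0 ≤ q) (hq1 : q ≤ 1)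
    (hκ : 0 < κ) {C : (n : ℕ) → BinCode n (codeLen R n)} (hC : ReliableCodes q R κ C)
    (hℓ : 2 ≤ ℓ) (hp : 1 ≤ p) (hc : 0 < c) (hε1 : ε < 1) (hsub : Subcritical ε ℓ c t) :
    ∃ γ : ℝ, 0 < γ ∧
      ∀ (N K M r : ℕ → ℕ) (S : (k : ℕ) → Finset (Fin (N k))),
        (∀ k, M k * r k = N k * ℓ) → (∀ k, (S k).card = K k) → Tendsto K atTop atTop →
        Tendsto (fun k => (M k : ℝ) / (K k : ℝ)) atTop (𝓝 c) → Tendsto r atTop atTop →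
        ∀ᶠ k in atTop, prob (N := N k) (ℓ := ℓ) (M := M k) (r := r k) (p := p)
          (L := codeLen R (Nat.clog 2 (r k))) q (fun G π w =>
            ¬ Recovers (C (Nat.clog 2 (r k))) ε (S k) G π w) ≤ Real.exp (-(γ * K k)) := by
  classical
  obtain ⟨γ₀, hγ₀, φ, hφ, hstuck⟩ := exists_stuck_bound hℓ hc hε1 hsub
  have hp0 : (0 : ℝ) < p := by exact_mod_cast hp
  have hε0 : 0 < ε := lt_trans (pow_pos hsub.1 ℓ) hsub.2.2.1
  -- `s` and `ψ` are chosen so that the number of sets of at most `ψ K` faulty bins, bounded by `exp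
  -- (s M) / s ^ (ψ K)`, costs at most half of the exponent `γ₀`; `M ≤ 2 c K` is used throughout.
  set s := min 1 (γ₀ / (8 * c)) with hs
  have hs0 : 0 < s := lt_min one_pos (by positivity)
  have hs1 : s ≤ 1 := min_le_left _ _
  have hsc : s * (2 * c) ≤ γ₀ / 4 := by
    have : s ≤ γ₀ / (8 * c) := min_le_right _ _
    rw [le_div_iff₀ (by positivity)] at this
    linarith
  have hls : Real.log s ≤ 0 := Real.log_nonpos hs0.le hs1
  set ψ := min φ (γ₀ / (4 * (1 - Real.log s))) with hψ
  have hψ0 : 0 < ψ := lt_min hφ (div_pos hγ₀ (by linarith))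
  have hψs : ψ * (-Real.log s) ≤ γ₀ / 4 := by
    have : ψ ≤ γ₀ / (4 * (1 - Real.log s)) := min_le_right _ _
    rw [le_div_iff₀ (by linarith)] at this
    linarith
  -- `A` and `d` make `d ^ (ψ K) = exp (-A K)` beat the count `2 ^ M ≤ exp (2 c K log 2)` with `γ₀
  -- K` to spare. Reliability is needed only to bring the fault probability below the constant `d`.
  set A := γ₀ + 2 * c * Real.log 2 with hA
  have hlog2 : 0 < Real.log 2 := Real.log_pos one_lt_two
  have hA0 : 0 < A := by positivity
  set d := Real.exp (-(A / ψ)) with hd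
  have hd0 : 0 < d := Real.exp_pos _
  have hd1 : d ≤ 1 := Real.exp_le_one_iff.2 (by have := div_pos hA0 hψ0; linarith)
  refine ⟨γ₀ / 4, by positivity, ?_⟩
  intro N K M r S hMr hS hK hM hr
  have hK' : Tendsto (fun k => (K k : ℝ)) atTop atTop := tendsto_natCast_atTop_atTop.comp hK
  set δ := d / (8 * p) with hδ
  have hδ0 : 0 < δ := by positivity
  have hdδ : 8 * (p * δ) = d := by rw [hδ]; field_simp
  have hpoly := hK'.eventually (eventually_poly_mul_exp_le (1 + Real.exp (A / ψ))
    (show γ₀ / 4 < γ₀ / 2 by linarith))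
  filter_upwards [hstuck N K M r S hMr hS hK hM hr, eventually_errorProb_le hκ hC hr hδ0, hpoly,
    hM.eventually (gt_mem_nhds (show c < 2 * c by linarith)), hK.eventually_ge_atTop 1]
    with k hst herr hpolyk hM2 hK1
  have hKpos : (0 : ℝ) < K k := by exact_mod_cast hK1
  have hM2' : (M k : ℝ) ≤ 2 * c * K k := by rw [div_lt_iff₀ hKpos] at hM2; exact hM2.le
  set f := ⌊ψ * K k⌋₊ with hf
  have hf1 : (f : ℝ) ≤ ψ * K k := Nat.floor_le (by positivity)
  have hf2 : ψ * K k - 1 ≤ f := by have := Nat.lt_floor_add_one (ψ * K k); linarith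
  have key := prob_not_recovers_le (p := p) (ε := ε) (s := s) (Q := Real.exp (-(γ₀ * K k)))
    hq0 hq1 herr hδ0.le (by rw [hdδ]; exact hd1) hs0 hs1 (S k) (a := ⌊ε * K k⌋₊) (f := f)
    (by rw [hS k]; exact Nat.floor_le (by positivity)) (card_graph_pos (hMr k))
    (Real.exp_pos _).le (fun F hF => hst F (by
      have h1 : (F.card : ℝ) ≤ f := by exact_mod_cast hF
      have h2 : ψ * K k ≤ φ * K k := mul_le_mul_of_nonneg_right (min_le_left _ _) hKpos.le
      linarith))
  rw [hdδ] at key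
  refine key.trans ?_
  have b1 : Real.exp (s * M k) / s ^ f * Real.exp (-(γ₀ * K k)) ≤ Real.exp (-(γ₀ / 2 * K k)) := by
    have e1 : s ^ f = Real.exp (f * Real.log s) := by
      rw [mul_comm, Real.exp_mul, Real.exp_log hs0, Real.rpow_natCast]
    rw [e1, ← Real.exp_sub, ← Real.exp_add]
    apply Real.exp_le_exp.2
    have h1 : s * M k ≤ γ₀ / 4 * K k := by
      calc s * M k ≤ s * (2 * c * K k) := mul_le_mul_of_nonneg_left hM2' hs0.le
        _ = s * (2 * c) * K k := by ring
        _ ≤ _ := mul_le_mul_of_nonneg_right hsc hKpos.le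
    have h2 : f * (-Real.log s) ≤ γ₀ / 4 * K k := by
      calc f * (-Real.log s) ≤ ψ * K k * (-Real.log s) :=
            mul_le_mul_of_nonneg_right hf1 (by linarith)
        _ = ψ * (-Real.log s) * K k := by ring
        _ ≤ _ := mul_le_mul_of_nonneg_right hψs hKpos.le
    linarith
  have b2 : (2 : ℝ) ^ M k * d ^ f ≤ Real.exp (A / ψ) * Real.exp (-(γ₀ / 2 * K k)) := by
    have e1 : (2 : ℝ) ^ M k = Real.exp (M k * Real.log 2) := by
      rw [mul_comm, Real.exp_mul, Real.exp_log two_pos, Real.rpow_natCast]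
    have e2 : d ^ f = Real.exp (f * -(A / ψ)) := by rw [hd, ← Real.exp_nat_mul]
    rw [e1, e2, ← Real.exp_add, ← Real.exp_add]
    apply Real.exp_le_exp.2
    have h1 : M k * Real.log 2 ≤ 2 * c * K k * Real.log 2 :=
      mul_le_mul_of_nonneg_right hM2' hlog2.le
    have h2 : (ψ * K k - 1) * (A / ψ) ≤ f * (A / ψ) :=
      mul_le_mul_of_nonneg_right hf2 (by positivity)
    have h3 : (ψ * K k - 1) * (A / ψ) = A * K k - A / ψ := by field_simp
    have h4 : 0 < γ₀ * K k := by positivity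
    rw [hA] at h3
    rw [hA] at h2 ⊢
    linarith
  calc _ ≤ Real.exp (-(γ₀ / 2 * K k)) + Real.exp (A / ψ) * Real.exp (-(γ₀ / 2 * K k)) :=
        add_le_add b1 b2
    _ = (1 + Real.exp (A / ψ)) * 1 * Real.exp (-(γ₀ / 2 * K k)) := by ring
    _ ≤ (1 + Real.exp (A / ψ)) * (K k + 1) * Real.exp (-(γ₀ / 2 * K k)) := by
        gcongr
        linarith
    _ ≤ _ := hpolyk

/-! ### Asymptotics and the main theorem -/

section probBounds
variable {N ℓ M r p L : ℕ}

open Classical in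
theorem prob_le_one {q : ℝ} (h0 : 0 ≤ q) (h1 : q ≤ 1)
    (hG : 0 < Fintype.card (Graph N ℓ M r))
    (E : Graph N ℓ M r → SigPerms p r → (TestIndex M p L → Bool) → Prop) : prob q E ≤ 1 := by
  rw [prob_eq_noiseExp]
  refine sum_sum_div_le hG Fintype.card_pos (X := fun _ => 1) (fun G π => ?_) ?_
  · calc _ ≤ noiseExp q (fun _ : TestIndex M p L → Bool => (1 : ℝ)) :=
          noiseExp_mono h0 h1 fun w => by split_ifs <;> norm_num
      _ = 1 := noiseExp_const 1
  · simp

open Classical in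
theorem prob_nonneg {q : ℝ} (h0 : 0 ≤ q) (h1 : q ≤ 1)
    (E : Graph N ℓ M r → SigPerms p r → (TestIndex M p L → Bool) → Prop) : 0 ≤ prob q E := by
  rw [prob_eq_noiseExp]
  refine div_nonneg (Finset.sum_nonneg fun G _ => Finset.sum_nonneg fun π _ =>
    noiseExp_nonneg h0 h1 fun w => ?_) (by positivity)
  split_ifs <;> norm_num

open Classical in
theorem one_le_prob_and_add {q : ℝ} (h0 : 0 ≤ q) (h1 : q ≤ 1)
    (hG : 0 < Fintype.card (Graph N ℓ M r))
    (A B : Graph N ℓ M r → SigPerms p r → (TestIndex M p L → Bool) → Prop) :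
    1 ≤ prob q (fun G π w => A G π w ∧ B G π w) + prob q (fun G π w => ¬ A G π w) +
      prob q (fun G π w => ¬ B G π w) := by
  have hG' : (0 : ℝ) < Fintype.card (Graph N ℓ M r) := by exact_mod_cast hG
  have hP : (0 : ℝ) < Fintype.card (SigPerms p r) := by exact_mod_cast Fintype.card_pos
  simp only [prob_eq_noiseExp]
  rw [← add_div, ← add_div, le_div_iff₀ (by positivity), one_mul]
  simp only [← Finset.sum_add_distrib, ← noiseExp_add]
  have hone : ∀ (G : Graph N ℓ M r) (π : SigPerms p r), (1 : ℝ) ≤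
      noiseExp q (fun w : TestIndex M p L → Bool => ((if A G π w ∧ B G π w then (1 : ℝ) else 0) +
        (if ¬ A G π w then 1 else 0)) + (if ¬ B G π w then 1 else 0)) := by
    intro G π
    calc (1 : ℝ) = noiseExp q (fun _ : TestIndex M p L → Bool => (1 : ℝ)) := (noiseExp_const 1).symm
      _ ≤ _ := noiseExp_mono h0 h1 fun w => by
          by_cases hA : A G π w <;> by_cases hB : B G π w <;> simp [hA, hB]
  calc (Fintype.card (Graph N ℓ M r) : ℝ) * Fintype.card (SigPerms p r)
      = ∑ _G : Graph N ℓ M r, ∑ _π : SigPerms p r, (1 : ℝ) := by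
        simp [Finset.sum_const, Finset.card_univ]
    _ ≤ _ := Finset.sum_le_sum fun G _ => Finset.sum_le_sum fun π _ => hone G π

end probBounds

theorem tendsto_logb_two_atTop {r : ℕ → ℕ} (hr : Tendsto r atTop atTop) :
    Tendsto (fun k => Real.logb 2 (r k)) atTop atTop :=
  (Real.tendsto_logb_atTop one_lt_two).comp (tendsto_natCast_atTop_atTop.comp hr)

theorem abs_clog_sub_logb_le {r : ℕ} (hr : 1 ≤ r) :
    |(Nat.clog 2 r : ℝ) - Real.logb 2 r| ≤ 1 := by
  have h0 : 0 ≤ Real.logb 2 r := Real.logb_nonneg one_lt_two (by exact_mod_cast hr)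
  have h := Real.natCeil_logb_natCast 2 r
  rw [Nat.cast_ofNat] at h
  have h1 := Nat.le_ceil (Real.logb 2 r)
  have h2 := Nat.ceil_lt_add_one h0
  rw [h] at h1 h2
  rw [abs_le]
  constructor <;> linarith

theorem abs_codeLen_sub_le {R : ℝ} (hR : 0 < R) (n : ℕ) : |(codeLen R n : ℝ) - n / R| ≤ 1 := by
  have h1 := Nat.le_ceil ((n : ℝ) / R)
  have h2 := Nat.ceil_lt_add_one (show 0 ≤ (n : ℝ) / R by positivity)
  rw [codeLen, abs_le]
  constructor <;> linarith

/-- The block length is asymptotic to the logarithm of the number of items per bin and rate. -/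
theorem codeLen_isEquivalent {R c : ℝ} {ℓ : ℕ} (hR : 0 < R) (hc : 0 < c) {N K M r : ℕ → ℕ}
    (hMr : ∀ k, M k * r k = N k * ℓ) (hK : Tendsto K atTop atTop)
    (hM : Tendsto (fun k => (M k : ℝ) / (K k : ℝ)) atTop (𝓝 c)) (hr : Tendsto r atTop atTop) :
    (fun k => (codeLen R (Nat.clog 2 (r k)) : ℝ)) ~[atTop]
      (fun k => 1 / R * Real.logb 2 ((N k : ℝ) * (ℓ : ℝ) / (c * (K k : ℝ)))) := by
  have hratio : Tendsto (fun k => Real.logb 2 ((M k : ℝ) / (K k : ℝ) / c)) atTop (𝓝 0) := by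
    have h1 := hM.div_const c
    rw [div_self hc.ne'] at h1
    have h2 := (Real.continuousAt_logb (b := 2) one_ne_zero).tendsto.comp h1
    rwa [Real.logb_one] at h2
  -- As `M r = N ℓ`, the argument is `r` times the ratio `M / (c K)`, whose logarithm vanishes in
  -- the limit.
  have hsplit : ∀ᶠ k in atTop, Real.logb 2 ((N k : ℝ) * (ℓ : ℝ) / (c * (K k : ℝ)))
      = Real.logb 2 (r k) + Real.logb 2 ((M k : ℝ) / (K k : ℝ) / c) := by
    filter_upwards [hK.eventually_ge_atTop 1, hr.eventually_ge_atTop 1,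
      eventually_pos_of_ratio hc hM] with k h1 h2 h3
    have hKpos : (0 : ℝ) < K k := by exact_mod_cast h1
    have hrpos : (0 : ℝ) < r k := by exact_mod_cast h2
    have hMpos : (0 : ℝ) < M k := by exact_mod_cast h3
    have e : (M k : ℝ) * r k = N k * ℓ := by exact_mod_cast hMr k
    rw [← Real.logb_mul hrpos.ne' (by positivity), ← e]
    congr 1
    field_simp
  have htop : Tendsto (fun k => 1 / R * Real.logb 2 ((N k : ℝ) * (ℓ : ℝ) / (c * (K k : ℝ))))
      atTop atTop := by
    refine Tendsto.const_mul_atTop (by positivity) ?_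
    exact ((tendsto_logb_two_atTop hr).atTop_add hratio).congr' (hsplit.mono fun k hk => hk.symm)
  -- The two sides differ by a bounded amount, caused by two roundings and the ratio, while the
  -- right side tends to infinity.
  refine IsLittleO.isEquivalent (IsBigO.trans_isLittleO (g := fun _ => (1 : ℝ)) ?_ ?_)
  · refine IsBigO.of_bound (1 + 2 / R) ?_
    filter_upwards [hsplit, hratio.eventually (Metric.ball_mem_nhds 0 one_pos),
      hr.eventually_ge_atTop 1] with k h1 h2 h3
    rw [dist_zero_right, Real.norm_eq_abs] at h2
    have a1 := abs_codeLen_sub_le hR (Nat.clog 2 (r k))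
    have a2 := abs_clog_sub_logb_le h3
    simp only [Pi.sub_apply, norm_one, mul_one, Real.norm_eq_abs]
    rw [h1]
    set u := Real.logb 2 ((M k : ℝ) / (K k : ℝ) / c)
    set n := Nat.clog 2 (r k)
    have e : (codeLen R n : ℝ) - 1 / R * (Real.logb 2 (r k) + u)
        = (codeLen R n - n / R) + 1 / R * ((n - Real.logb 2 (r k)) - u) := by ring
    rw [e]
    calc _ ≤ |(codeLen R n : ℝ) - n / R| + |1 / R * ((n - Real.logb 2 (r k)) - u)| := abs_add_le _ _
      _ = |(codeLen R n : ℝ) - n / R| + 1 / R * |(n - Real.logb 2 (r k)) - u| := by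
          rw [abs_mul, abs_of_pos (show 0 < 1 / R by positivity)]
      _ ≤ 1 + 1 / R * (1 + 1) := by
          refine add_le_add a1 (mul_le_mul_of_nonneg_left ?_ (by positivity))
          exact (abs_sub _ _).trans (add_le_add a2 h2.le)
      _ = 1 + 2 / R := by ring
  · refine isLittleO_const_left.2 (Or.inr ?_)
    exact tendsto_norm_atTop_atTop.comp htop

theorem card_testIndex_isEquivalent {R c : ℝ} {ℓ : ℕ} (hR : 0 < R) (hc : 0 < c) (p : ℕ)
    {N K M r : ℕ → ℕ} (hMr : ∀ k, M k * r k = N k * ℓ) (hK : Tendsto K atTop atTop)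
    (hM : Tendsto (fun k => (M k : ℝ) / (K k : ℝ)) atTop (𝓝 c)) (hr : Tendsto r atTop atTop) :
    (fun k => (Fintype.card (TestIndex (M k) p (codeLen R (Nat.clog 2 (r k)))) : ℝ))
      ~[atTop] (fun k => 2 * (p : ℝ) * (1 / R) * c * (K k : ℝ) *
        Real.logb 2 ((N k : ℝ) * (ℓ : ℝ) / (c * (K k : ℝ)))) := by
  have h1 : (fun k => (M k : ℝ)) ~[atTop] (fun k => c * (K k : ℝ)) := by
    refine isEquivalent_of_tendsto_one ?_
    have := hM.div_const c
    rw [div_self hc.ne'] at this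
    refine this.congr fun k => ?_
    rw [Pi.div_apply, div_div, mul_comm c]
  have h2 := (h1.mul (IsEquivalent.refl (u := fun _ : ℕ => 2 * (p : ℝ)))).mul
    (codeLen_isEquivalent (R := R) hR hc hMr hK hM hr)
  convert h2 using 1
  · funext k
    simp only [TestIndex, Fintype.card_prod, Fintype.card_fin, Fintype.card_bool, Pi.mul_apply]
    push_cast
    ring
  · funext k
    simp only [Pi.mul_apply]
    ring

/-! ### Growth of the right degree, and vanishing of the false-alarm probability. -/

/-- With `y = N ^ (1 / p)`, a number of defectives `K = o(N ^ (1 - 1 / p))` is `o(y ^ (p - 1))`. -/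
theorem rpow_one_sub_inv_eq {p : ℕ} (hp : 1 ≤ p) (n : ℕ) :
    (n : ℝ) ^ (1 - 1 / (p : ℝ)) = ((n : ℝ) ^ (1 / (p : ℝ))) ^ (p - 1) := by
  have hp0 : (p : ℝ) ≠ 0 := by exact_mod_cast (by omega : p ≠ 0)
  rw [← Real.rpow_natCast, ← Real.rpow_mul (Nat.cast_nonneg n), Nat.cast_sub hp]
  congr 1
  push_cast
  field_simp

theorem rpow_inv_pow_eq {p : ℕ} (hp : 1 ≤ p) (n : ℕ) :
    ((n : ℝ) ^ (1 / (p : ℝ))) ^ p = n := by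
  rw [one_div, Real.rpow_inv_natCast_pow (Nat.cast_nonneg n) (by omega)]

/-- The number of sockets per bin is at least proportional to `N ^ (1 / p)`. -/
theorem eventually_le_rightDegree {c : ℝ} {ℓ p : ℕ} (hc : 0 < c) (hp : 1 ≤ p) {N K M r : ℕ → ℕ}
    (hMr : ∀ k, M k * r k = N k * ℓ) (hK : Tendsto K atTop atTop)
    (ho : (fun k => (K k : ℝ)) =o[atTop] (fun k => (N k : ℝ) ^ (1 - 1 / (p : ℝ))))
    (hM : Tendsto (fun k => (M k : ℝ) / (K k : ℝ)) atTop (𝓝 c)) :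
    ∀ᶠ k in atTop, (K k : ℝ) ≤ ((N k : ℝ) ^ (1 / (p : ℝ))) ^ (p - 1) ∧
      (N k : ℝ) * ℓ / (2 * c * K k) ≤ r k ∧ ℓ / (2 * c) * (N k : ℝ) ^ (1 / (p : ℝ)) ≤ r k := by
  filter_upwards [ho.bound one_pos, hM.eventually (gt_mem_nhds (show c < 2 * c by linarith)),
    hK.eventually_ge_atTop 1] with k h1 h2 h3
  have hKpos : (0 : ℝ) < K k := by exact_mod_cast h3
  rw [rpow_one_sub_inv_eq hp, one_mul, Real.norm_of_nonneg hKpos.le,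
    Real.norm_of_nonneg (by positivity)] at h1
  rw [div_lt_iff₀ hKpos] at h2
  have e : (M k : ℝ) * r k = N k * ℓ := by exact_mod_cast hMr k
  have h4 : (N k : ℝ) * ℓ / (2 * c * K k) ≤ r k := by
    rw [div_le_iff₀ (by positivity), ← e, mul_comm]
    exact mul_le_mul_of_nonneg_left h2.le (Nat.cast_nonneg _)
  refine ⟨h1, h4, le_trans ?_ h4⟩
  set y := (N k : ℝ) ^ (1 / (p : ℝ)) with hy
  have hy0 : 0 ≤ y := by positivity
  have hN : (N k : ℝ) = y ^ (p - 1) * y := by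
    rw [← pow_succ, Nat.sub_add_cancel hp, hy, rpow_inv_pow_eq hp]
  rw [le_div_iff₀ (by positivity), hN]
  calc ℓ / (2 * c) * y * (2 * c * K k) = ℓ * y * K k := by field_simp
    _ ≤ ℓ * y * y ^ (p - 1) := mul_le_mul_of_nonneg_left h1 (by positivity)
    _ = _ := by ring

theorem tendsto_rpow_inv_atTop {p : ℕ} (hp : 1 ≤ p) {N : ℕ → ℕ} (hN : Tendsto N atTop atTop) :
    Tendsto (fun k => (N k : ℝ) ^ (1 / (p : ℝ))) atTop atTop := by
  have hp0 : (0 : ℝ) < p := by exact_mod_cast hp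
  exact (tendsto_rpow_atTop (show (0 : ℝ) < 1 / p by positivity)).comp
    (tendsto_natCast_atTop_atTop.comp hN)

/-- A growing right degree underlies the Poisson limit of the occupancies, the reliability of the
codes and the false-alarm bound. -/
theorem tendsto_rightDegree {c : ℝ} {ℓ p : ℕ} (hc : 0 < c) (hℓ : 2 ≤ ℓ) (hp : 1 ≤ p)
    {N K M r : ℕ → ℕ} (hMr : ∀ k, M k * r k = N k * ℓ) (hK : Tendsto K atTop atTop)
    (hKN : ∀ k, K k ≤ N k)
    (ho : (fun k => (K k : ℝ)) =o[atTop] (fun k => (N k : ℝ) ^ (1 - 1 / (p : ℝ))))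
    (hM : Tendsto (fun k => (M k : ℝ) / (K k : ℝ)) atTop (𝓝 c)) : Tendsto r atTop atTop := by
  have hℓ0 : (0 : ℝ) < ℓ := by exact_mod_cast (by omega : 0 < ℓ)
  have hN : Tendsto N atTop atTop := tendsto_atTop_mono hKN hK
  have h1 := (tendsto_rpow_inv_atTop hp hN).const_mul_atTop (show 0 < ℓ / (2 * c) by positivity)
  exact tendsto_natCast_atTop_iff.1 (tendsto_atTop_mono' _
    ((eventually_le_rightDegree hc hp hMr hK ho hM).mono fun k hk => hk.2.2) h1)

/-- For `p = 1` the assumption would read `K = o(1)`, against `K → ∞`. So at least one randomly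
permuted section is present. -/
theorem two_le_of_isLittleO {p : ℕ} (hp : 1 ≤ p) {N K : ℕ → ℕ} (hK : Tendsto K atTop atTop)
    (ho : (fun k => (K k : ℝ)) =o[atTop] (fun k => (N k : ℝ) ^ (1 - 1 / (p : ℝ)))) : 2 ≤ p := by
  by_contra hcon
  obtain rfl : p = 1 := by omega
  obtain ⟨k, h1, h2⟩ := ((ho.bound (show (0 : ℝ) < 1 / 2 by norm_num)).and
    (hK.eventually_ge_atTop 1)).exists
  have h3 : (1 : ℝ) ≤ K k := by exact_mod_cast h2
  norm_num at h1
  linarith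

/-- False alarms are unlikely. -/
theorem tendsto_prob_falseAlarm {q R c : ℝ} {ℓ p : ℕ} (hq0 : 0 ≤ q) (hq1 : q ≤ 1) (hc : 0 < c)
    (hℓ : 2 ≤ ℓ) (hp : 1 ≤ p) (C : (n : ℕ) → BinCode n (codeLen R n)) {N K M r : ℕ → ℕ}
    (S : (k : ℕ) → Finset (Fin (N k))) (hMr : ∀ k, M k * r k = N k * ℓ)
    (hS : ∀ k, (S k).card = K k) (hK : Tendsto K atTop atTop)
    (ho : (fun k => (K k : ℝ)) =o[atTop] (fun k => (N k : ℝ) ^ (1 - 1 / (p : ℝ))))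
    (hM : Tendsto (fun k => (M k : ℝ) / (K k : ℝ)) atTop (𝓝 c)) :
    ∃ B : ℕ → ℝ, Tendsto B atTop (𝓝 0) ∧ ∀ᶠ k in atTop,
      prob (N := N k) (ℓ := ℓ) (M := M k) (r := r k) (p := p)
        (L := codeLen R (Nat.clog 2 (r k))) q (fun G π w =>
          ¬ NoFalseAlarm (C (Nat.clog 2 (r k))) (S k) G π w) ≤ B k := by
  have hp2 := two_le_of_isLittleO hp hK ho
  have hℓ0 : (0 : ℝ) < ℓ := by exact_mod_cast (by omega : 0 < ℓ)
  have hKN : ∀ k, K k ≤ N k := fun k => by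
    rw [← hS k]; simpa using Finset.card_le_univ (S k)
  have hN : Tendsto N atTop atTop := tendsto_atTop_mono hKN hK
  have hr := tendsto_rightDegree hc hℓ hp hMr hK hKN ho hM
  set y : ℕ → ℝ := fun k => (N k : ℝ) ^ (1 / (p : ℝ)) with hy
  have hyt : Tendsto y atTop atTop := tendsto_rpow_inv_atTop hp hN
  have ho' : Tendsto (fun k => (K k : ℝ) / y k ^ (p - 1)) atTop (𝓝 0) := by
    have := ho.tendsto_div_nhds_zero
    simpa only [rpow_one_sub_inv_eq hp] using this
  set a : ℝ := ℓ / (2 * c) with ha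
  have ha0 : 0 < a := by positivity
  have hexp : Tendsto (fun k => y k ^ (2 * (p - 1)) / Real.exp (a * y k)) atTop (𝓝 0) :=
    ((isLittleO_pow_exp_pos_mul_atTop (2 * (p - 1)) ha0).tendsto_div_nhds_zero).comp hyt
  set A₁ : ℝ := (2 * c + ℓ) * (4 * c / ℓ) ^ (p - 1) with hA₁
  set A₂ : ℝ := (4 * ℓ + 2) * (2 * c) * Real.exp (8 * (2 * ℓ / c)) with hA₂
  -- The first term is the union bound for false declarations, `K (K / N) ^ (p - 1)` with `N = y ^
  -- p`. The second bounds the chance of a half-full bin: two prefactors of order `K ≤ y ^ (p - 1)`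
  -- times `exp (-r)` with `r ≥ a y`.
  refine ⟨fun k => A₁ * ((K k : ℝ) / y k ^ (p - 1)) ^ p +
    A₂ * (y k ^ (2 * (p - 1)) / Real.exp (a * y k)), ?_, ?_⟩
  · have h1 := ((ho'.pow p).const_mul A₁).add (hexp.const_mul A₂)
    rwa [zero_pow (by omega), mul_zero, mul_zero, add_zero] at h1
  filter_upwards [eventually_le_rightDegree hc hp hMr hK ho hM, hr.eventually_ge_atTop 1,
    hM.eventually (gt_mem_nhds (show c < 2 * c by linarith)),
    hM.eventually (lt_mem_nhds (show c / 2 < c by linarith)), hK.eventually_ge_atTop 1,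
    hyt.eventually_gt_atTop 0] with k h1 h2 h3 h4 h5 hy0
  obtain ⟨hKy, hr1, hr2⟩ := h1
  have hKpos : (0 : ℝ) < K k := by exact_mod_cast h5
  have hrpos : (0 : ℝ) < r k := by exact_mod_cast h2
  rw [div_lt_iff₀ hKpos] at h3
  rw [lt_div_iff₀ hKpos] at h4
  have hMpos : (0 : ℝ) < M k := lt_trans (by positivity) h4
  have hMpos' : 0 < M k := by exact_mod_cast hMpos
  have hNy : (N k : ℝ) = y k ^ (p - 1) * y k := by
    rw [← pow_succ, Nat.sub_add_cancel hp, hy]; exact (rpow_inv_pow_eq hp _).symm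
  have hNpos : (0 : ℝ) < N k := by rw [hNy]; positivity
  refine (prob_falseAlarm_le hq0 hq1 hp _ _ (hMr k) (Nat.mul_pos hMpos' h2)
    (card_graph_pos (hMr k))).trans (add_le_add ?_ ?_)
  · rw [hS k]
    have e1 : 2 / (r k : ℝ) ≤ 4 * c / ℓ * (K k / N k) := by
      rw [div_le_iff₀ hrpos]
      rw [div_le_iff₀ (by positivity)] at hr1
      have : 4 * c / ℓ * (K k / N k) * r k = 2 * (r k * (2 * c * K k)) / (N k * ℓ) := by
        field_simp; ring
      rw [this, le_div_iff₀ (by positivity)]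
      linarith
    have e2 : (K k : ℝ) * (K k / N k) ^ (p - 1) = (K k / y k ^ (p - 1)) ^ p := by
      obtain ⟨m, rfl⟩ : ∃ m, p = m + 1 := ⟨p - 1, by omega⟩
      simp only [Nat.add_sub_cancel] at hNy ⊢
      rw [hNy]
      field_simp
      ring
    calc _ ≤ ((2 * c + ℓ) * K k) * (4 * c / ℓ * (K k / N k)) ^ (p - 1) := by
          refine mul_le_mul ?_ (pow_le_pow_left₀ (by positivity) e1 _) (by positivity)
            (by positivity)
          linarith
      _ = A₁ * (K k * (K k / N k) ^ (p - 1)) := by rw [mul_pow, hA₁]; ring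
      _ = _ := by rw [e2]
  · rw [hS k]
    have e1 : (r k : ℝ) * (((K k * ℓ : ℕ) : ℝ) / ((M k * r k : ℕ) : ℝ)) ≤ 2 * ℓ / c := by
      have : (r k : ℝ) * (((K k * ℓ : ℕ) : ℝ) / ((M k * r k : ℕ) : ℝ)) = K k * ℓ / M k := by
        push_cast; field_simp
      rw [this, div_le_div_iff₀ hMpos hc]
      nlinarith
    have e2 : (4 : ℝ) * ((K k * ℓ : ℕ) : ℝ) + 2 ≤ (4 * ℓ + 2) * y k ^ (p - 1) := by
      have : (1 : ℝ) ≤ K k := by exact_mod_cast h5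
      push_cast
      calc (4 : ℝ) * (K k * ℓ) + 2 ≤ (4 * ℓ + 2) * K k := by linarith
        _ ≤ _ := mul_le_mul_of_nonneg_left hKy (by positivity)
    have e3 : (M k : ℝ) ≤ 2 * c * y k ^ (p - 1) :=
      h3.le.trans (mul_le_mul_of_nonneg_left hKy (by positivity))
    have e4 : Real.exp (8 * (r k * (((K k * ℓ : ℕ) : ℝ) / ((M k * r k : ℕ) : ℝ))) - r k)
        ≤ Real.exp (8 * (2 * ℓ / c)) / Real.exp (a * y k) := by
      rw [← Real.exp_sub]
      apply Real.exp_le_exp.2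
      have hr2' : a * y k ≤ r k := hr2
      linarith
    calc _ ≤ (4 * ℓ + 2) * y k ^ (p - 1) * (2 * c * y k ^ (p - 1) *
          (Real.exp (8 * (2 * ℓ / c)) / Real.exp (a * y k))) := by
          refine mul_le_mul e2 (mul_le_mul e3 e4 (Real.exp_pos _).le (by positivity))
            (by positivity) (by positivity)
      _ = _ := by rw [hA₂, two_mul (p - 1), pow_add]; ring

end RobustSaffron

theorem mainTheorem3 (q R : ℝ) (hq0 : 0 < q) (hq : q < 1 / 2) (hR0 : 0 < R)
    (hR : R < 1 + q * Real.logb 2 q + (1 - q) * Real.logb 2 (1 - q)) :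
    -- capacity-approaching codes with maximum-likelihood decoders exist
    (∃ κ : ℝ, 0 < κ ∧ ∃ C : (n : ℕ) → BinCode n (codeLen R n),
      ReliableCodes q R κ C ∧ ∀ n, IsMLDecoder q (C n)) ∧
    -- and the scheme works with every such sequence of codes
    ∀ κ : ℝ, 0 < κ → ∀ C : (n : ℕ) → BinCode n (codeLen R n), ReliableCodes q R κ C →
    ∀ (ε c : ℝ) (ℓ : ℕ), 0 < ε → ε < 1 → 0 < c →
      (DensityEvolution ε ℓ c ∨ (ε, c, ℓ) ∈ constantsTable) →
    ∀ p : ℕ, 1 ≤ p →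
    ∃ γ : ℝ, 0 < γ ∧
    ∀ (N K M r : ℕ → ℕ) (S : (k : ℕ) → Finset (Fin (N k))),
      (∀ k, M k * r k = N k * ℓ) →
      (∀ k, (S k).card = K k) →
      Tendsto K atTop atTop →
      (fun k => (K k : ℝ)) =o[atTop] (fun k => (N k : ℝ) ^ (1 - 1 / (p : ℝ))) →
      Tendsto (fun k => (M k : ℝ) / (K k : ℝ)) atTop (𝓝 c) →
      -- the number of tests
      (fun k => (Fintype.card (TestIndex (M k) p (codeLen R (Nat.clog 2 (r k)))) : ℝ))
        ~[atTop] (fun k => 2 * (p : ℝ) * (1 / R) * c * (K k : ℝ) *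
          Real.logb 2 ((N k : ℝ) * (ℓ : ℝ) / (c * (K k : ℝ)))) ∧
      -- recovery with high probability, without false alarms
      Tendsto (fun k => prob (N := N k) (ℓ := ℓ) (M := M k) (r := r k) (p := p)
          (L := codeLen R (Nat.clog 2 (r k))) q (fun G π w =>
            Recovers (C (Nat.clog 2 (r k))) ε (S k) G π w ∧
            NoFalseAlarm (C (Nat.clog 2 (r k))) (S k) G π w))
        atTop (𝓝 1) ∧
      -- error rate of the recovery
      (fun k => prob (N := N k) (ℓ := ℓ) (M := M k) (r := r k) (p := p)
          (L := codeLen R (Nat.clog 2 (r k))) q (fun G π w =>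
            ¬ Recovers (C (Nat.clog 2 (r k))) ε (S k) G π w))
        =O[atTop] (fun k => (N k : ℝ) ^ (-κ) + Real.exp (-(γ * (K k : ℝ)))) := by
  refine ⟨exists_reliableCodes hq0 (by linarith) hR0 hR, ?_⟩
  intro κ hκ C hC ε c ℓ _ hε1 hc hconst p hp
  have hq1 : q ≤ 1 := by linarith
  obtain ⟨hℓ, t, hsub⟩ : 2 ≤ ℓ ∧ ∃ t, Subcritical ε ℓ c t :=
    hconst.elim (exists_subcritical_of_densityEvolution hε1 hc) exists_subcritical_of_table
  obtain ⟨γ, hγ, hrec⟩ := exists_recovery_bound hq0.le hq1 hκ hC hℓ hp hc hε1 hsub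
  refine ⟨γ, hγ, fun N K M r S hMr hS hK ho hM => ?_⟩
  have hKN : ∀ k, K k ≤ N k := fun k => by
    rw [← hS k]; simpa using Finset.card_le_univ (S k)
  have hr := tendsto_rightDegree hc hℓ hp hMr hK hKN ho hM
  have hrec' := hrec N K M r S hMr hS hK hM hr
  refine ⟨card_testIndex_isEquivalent hR0 hc p hMr hK hM hr, ?_, ?_⟩
  · obtain ⟨B, hB0, hB⟩ := tendsto_prob_falseAlarm hq0.le hq1 hc hℓ hp C S hMr hS hK ho hM
    have hexp : Tendsto (fun k => Real.exp (-(γ * K k))) atTop (𝓝 0) :=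
      Real.tendsto_exp_neg_atTop_nhds_zero.comp
        ((tendsto_natCast_atTop_atTop.comp hK).const_mul_atTop hγ)
    have hlow := (tendsto_const_nhds (x := (1 : ℝ))).sub (hexp.add hB0)
    rw [add_zero, sub_zero] at hlow
    refine tendsto_of_tendsto_of_tendsto_of_le_of_le' hlow tendsto_const_nhds ?_
      (Eventually.of_forall fun k => prob_le_one hq0.le hq1 (card_graph_pos (hMr k)) _)
    filter_upwards [hrec', hB] with k h1 h2
    have h3 := one_le_prob_and_add (p := p) (L := codeLen R (Nat.clog 2 (r k))) hq0.le hq1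
      (card_graph_pos (hMr k)) (fun G π w => Recovers (C (Nat.clog 2 (r k))) ε (S k) G π w)
      (fun G π w => NoFalseAlarm (C (Nat.clog 2 (r k))) (S k) G π w)
    linarith
  -- The recovery bound `exp (-γ K)` is already one of the two summands; the other is non-negative.
  · refine IsBigO.of_bound 1 ?_
    filter_upwards [hrec'] with k hk
    have h1 : 0 ≤ (N k : ℝ) ^ (-κ) := by positivity
    have h2 := Real.exp_pos (-(γ * (K k : ℝ)))
    rw [one_mul, Real.norm_of_nonneg (prob_nonneg hq0.le hq1 _), Real.norm_of_nonneg (by linarith)]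
    linarith
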